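/- Let $(M,g,J)$ be an almost Kähler 4-manifold: a smooth 4-manifold with a smooth Riemannian metric $g$ and a smooth $g$-orthogonal almost complex structure $J$ whose fundamental 2-form $\Omega(X,Y)=g(JX,Y)$ is closed. Let $\nabla$ be the Levi-Civita connection, $R$ the curvature tensor, with sign such that $R(X,Y,X,Y)$ is the sectional curvature of an orthonormal pair $X,Y$, $Ric$ the Ricci tensor, $s$ the scalar curvature, $Ric_0=Ric-\frac s4 g$ the traceless Ricci tensor, $h=\frac12\left(Ric-\frac s6 g\right)$ the normalized Ricci tensor, and $W$ the Weyl conformal tensor. For a local orthonormal frame $(e_i)$ put $(\delta W)(X,Y,Z)=-\sum_{i=1}^4(\nabla_{e_i}W)(e_i,X,Y,Z)$, and let $$B(X,Y)=\sum_{i=1}^4\left[(\nabla_{e_i}\delta W)(X,e_i,Y)+W(X,e_i,h(e_i),Y)\right]$$ be the Bach tensor of $g$. Assume that the Ricci tensor is $J$-invariant, i.e. $Ric(JX,JY)=Ric(X,Y)$ for all tangent vectors $X,Y$. Then $$B=-\frac13(\nabla ds)^{inv}+\frac16(\nabla ds)^{anti}-\frac{\Delta s}{12}\,g-\frac s6\,Ric_0+S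 .$$ Here $\Delta s=-\mathrm{tr}_g\nabla ds$; for a bilinear form $T$, $T^{inv}(X,Y)=\frac12\left(T(X,Y)+T(JX,JY)\right)$ and $T^{anti}=T-T^{inv}$ are its $J$-invariant and $J$-anti-invariant parts; and $$S=\sum_{i=1}^4(\nabla_{e_i}\rho_0)\circ(\nabla_{e_i}\Omega),\qquad \rho_0(X,Y)=Ric_0(JX,Y),$$ where a bilinear form $\phi$ is identified with the endomorphism given by $g(\phi(X),Y)=\phi(X,Y)$ and $\circ$ is composition of endomorphisms. The tensor $S$ is symmetric and $J$-anti-invariant, i.e. $S(JX,JY)=-S(X,Y)$. Moreover, if in addition $s$ is constant and $B=0$, then either $g$ is Einstein (i.e. $Ric_0=0$ everywhere) or $s=0$. -/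

import Mathlib

open scoped Manifold ContDiff Matrix

noncomputable section

namespace BachFormula

/-! ### Tensor calculus in a coordinate domain of `ℝ⁴`

A Riemannian metric is given by its component matrix `G u = (g_{ij}(u))`, an endomorphism field by
its component matrix `J u = (J^c_a(u))` (upper index first, that is `J ∂_a = ∑ c, J^c_a ∂_c`), and a
covariant tensor field of rank `k` by its components `T u ![a₁, …, a_k] = T(∂_{a₁}, …, ∂_{a_k})`. -/

/-- The model space `ℝ⁴`. -/
abbrev E4 : Type := EuclideanSpace ℝ (Fin 4)

/-- Component functions of a covariant tensor field of rank `k`. -/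
abbrev Tensor (k : ℕ) : Type := E4 → (Fin k → Fin 4) → ℝ

/-- A field of `4 × 4` matrices. -/
abbrev MatrixField : Type := E4 → Matrix (Fin 4) (Fin 4) ℝ

/-- The coordinate vector `∂_i` of `ℝ⁴`. -/
def basisVec (i : Fin 4) : E4 := EuclideanSpace.single i 1

/-- The partial derivative `∂_i f`. -/
def pd (i : Fin 4) (f : E4 → ℝ) (u : E4) : ℝ := fderiv ℝ f u (basisVec i)

/-- Christoffel symbols of the Levi-Civita connection:
`christoffel G u k i j = Γ^k_{ij}`, where `∇_{∂_i} ∂_j = ∑ k, Γ^k_{ij} ∂_k`. -/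
def christoffel (G : MatrixField) (u : E4) (k i j : Fin 4) : ℝ :=
  (1 / 2) * ∑ l, (G u)⁻¹ k l *
    (pd i (fun v => G v j l) u + pd j (fun v => G v i l) u - pd l (fun v => G v i j) u)

/-- The covariant derivative of a covariant tensor field; the differentiation index comes first:
`covDeriv G T u ![i, a₁, …, a_k] = (∇_{∂_i} T)(∂_{a₁}, …, ∂_{a_k})`. -/
def covDeriv (G : MatrixField) {k : ℕ} (T : Tensor k) : Tensor (k + 1) := fun u a =>
  pd (a 0) (fun v => T v (Fin.tail a)) u
    - ∑ m : Fin k, ∑ l : Fin 4,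
        christoffel G u l (a 0) (a m.succ) * T u (Function.update (Fin.tail a) m l)

/-- `curvEndo G u m l i j` is the `m`-th component of `R(∂_i, ∂_j) ∂_l`, where
`R(X, Y) = [∇_X, ∇_Y] - ∇_{[X, Y]}`. -/
def curvEndo (G : MatrixField) (u : E4) (m l i j : Fin 4) : ℝ :=
  pd i (fun v => christoffel G v m j l) u - pd j (fun v => christoffel G v m i l) u
    + ∑ p, (christoffel G u m i p * christoffel G u p j l
        - christoffel G u m j p * christoffel G u p i l)

/-- The Riemann curvature tensor `R(X, Y, Z, T) = g(R(X, Y) T, Z)`; with this sign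
`R(X, Y, X, Y)` is the sectional curvature for orthonormal `X, Y`. -/
def riemann (G : MatrixField) : Tensor 4 := fun u a =>
  ∑ m, G u (a 2) m * curvEndo G u m (a 3) (a 0) (a 1)

/-- The Ricci tensor `Ric(Y, T) = ∑ R(e_i, Y, e_i, T)` over an orthonormal frame. -/
def ricci (G : MatrixField) : Tensor 2 := fun u a =>
  ∑ i, ∑ k, (G u)⁻¹ i k * riemann G u ![i, a 0, k, a 1]

/-- The scalar curvature. -/
def scalarCurv (G : MatrixField) (u : E4) : ℝ :=
  ∑ i, ∑ j, (G u)⁻¹ i j * ricci G u ![i, j]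

/-- The traceless Ricci tensor `Ric₀ = Ric - (s / 4) g`. -/
def ricci0 (G : MatrixField) : Tensor 2 := fun u a =>
  ricci G u a - scalarCurv G u / 4 * G u (a 0) (a 1)

/-- The normalized Ricci tensor `h = (Ric - (s / 6) g) / 2`. -/
def normRicci (G : MatrixField) : Tensor 2 := fun u a =>
  (1 / 2) * (ricci G u a - scalarCurv G u / 6 * G u (a 0) (a 1))

/-- The Weyl conformal tensor (of a 4-manifold): the curvature minus the Kulkarni-Nomizu product
of the metric with the normalized Ricci tensor. -/
def weyl (G : MatrixField) : Tensor 4 := fun u a =>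
  riemann G u a
    - (G u (a 0) (a 2) * normRicci G u ![a 1, a 3] + G u (a 1) (a 3) * normRicci G u ![a 0, a 2]
      - G u (a 0) (a 3) * normRicci G u ![a 1, a 2] - G u (a 1) (a 2) * normRicci G u ![a 0, a 3])

/-- The codifferential of the Weyl tensor,
`(δW)(X, Y, Z) = - ∑ (∇_{e_i} W)(e_i, X, Y, Z)` over an orthonormal frame. -/
def codiffWeyl (G : MatrixField) : Tensor 3 := fun u a =>
  - ∑ i, ∑ j, (G u)⁻¹ i j * covDeriv G (weyl G) u ![i, j, a 0, a 1, a 2]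

/-- The Bach tensor
`B(X, Y) = ∑ [(∇_{e_i} δW)(X, e_i, Y) + W(X, e_i, h(e_i), Y)]` over an orthonormal frame. -/
def bach (G : MatrixField) : Tensor 2 := fun u a =>
  (∑ i, ∑ j, (G u)⁻¹ i j * covDeriv G (codiffWeyl G) u ![i, a 0, j, a 1])
    + ∑ i, ∑ j, ∑ k, ∑ l, (G u)⁻¹ i j * (G u)⁻¹ k l * normRicci G u ![j, l]
        * weyl G u ![a 0, i, k, a 1]

/-- The symmetric tensor `∇df` of a function `f`. -/
def hess (G : MatrixField) (f : E4 → ℝ) : Tensor 2 :=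
  covDeriv G (covDeriv G (k := 0) (fun u _ => f u))

/-- The (nonnegative) Laplacian `Δf = δdf = - tr ∇df`. -/
def laplacian (G : MatrixField) (f : E4 → ℝ) (u : E4) : ℝ :=
  - ∑ i, ∑ j, (G u)⁻¹ i j * hess G f u ![i, j]

/-- The tensor `(X, Y) ↦ T(JX, JY)`. -/
def twist (J : MatrixField) (T : Tensor 2) : Tensor 2 := fun u a =>
  ∑ c, ∑ d, J u c (a 0) * J u d (a 1) * T u ![c, d]

/-- The `J`-invariant part of a bilinear form. -/
def invPart (J : MatrixField) (T : Tensor 2) : Tensor 2 := fun u a =>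
  (1 / 2) * (T u a + twist J T u a)

/-- The `J`-anti-invariant part of a bilinear form. -/
def antiPart (J : MatrixField) (T : Tensor 2) : Tensor 2 := fun u a =>
  (1 / 2) * (T u a - twist J T u a)

/-- The fundamental 2-form `Ω(X, Y) = g(JX, Y)`. -/
def fundForm (G J : MatrixField) : Tensor 2 := fun u a => ∑ c, J u c (a 0) * G u c (a 1)

/-- The traceless Ricci form `ρ₀(X, Y) = Ric₀(JX, Y)`. -/
def ricciForm0 (G J : MatrixField) : Tensor 2 := fun u a =>
  ∑ c, J u c (a 0) * ricci0 G u ![c, a 1]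

/-- The tensor `S = ∑ (∇_{e_i} ρ₀) ∘ (∇_{e_i} Ω)` over an orthonormal frame. Here a bilinear form
`φ` is identified with the endomorphism given by `g(φ(X), Y) = φ(X, Y)`, so that
`(φ ∘ ψ)_{ab} = ∑ ψ_{ac} g^{cd} φ_{db}`. -/
def tensorS (G J : MatrixField) : Tensor 2 := fun u a =>
  ∑ i, ∑ j, (G u)⁻¹ i j * ∑ c, ∑ d,
    covDeriv G (fundForm G J) u ![j, a 0, c] * (G u)⁻¹ c d
      * covDeriv G (ricciForm0 G J) u ![i, d, a 1]

/-! ### Almost Kähler 4-manifolds -/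

section Manifold

variable {M : Type*} [TopologicalSpace M] [ChartedSpace E4 M]

/-- The coordinate vector field `∂_i` of the chart `e`, at the point with coordinates `u`. -/
def frame (e : OpenPartialHomeomorph M E4) (u : E4) (i : Fin 4) :
    TangentSpace (𝓡 4) (e.symm u) :=
  mfderiv (𝓡 4) (𝓡 4) e.symm u (basisVec i)

/-- The component matrix, in the chart `e`, of a field `J` of endomorphisms of the tangent
spaces. -/
def endoInChart (J : ∀ x : M, TangentSpace (𝓡 4) x →L[ℝ] TangentSpace (𝓡 4) x)
    (e : OpenPartialHomeomorph M E4) : MatrixField := fun u =>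
  Matrix.of fun c a =>
    (show E4 from mfderiv (𝓡 4) (𝓡 4) e (e.symm u) (J (e.symm u) (frame e u a))) c

variable [IsManifold (𝓡 4) ∞ M]

/-- The component matrix, in the chart `e`, of a smooth Riemannian metric. -/
def metricInChart
    (g : Bundle.ContMDiffRiemannianMetric (𝓡 4) ∞ E4 (fun x : M => TangentSpace (𝓡 4) x))
    (e : OpenPartialHomeomorph M E4) : MatrixField := fun u =>
  Matrix.of fun i j => g.inner (e.symm u) (frame e u i) (frame e u j)

end Manifold

/-- An almost Kähler structure on a smooth 4-manifold `M`: a smooth Riemannian metric `g`, a smooth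
`g`-orthogonal almost complex structure `J`, such that `Ω(X, Y) = g(JX, Y)` is closed. -/
structure AlmostKahler (M : Type*) [TopologicalSpace M] [ChartedSpace E4 M]
    [IsManifold (𝓡 4) ∞ M] where
  /-- The Riemannian metric. -/
  g : Bundle.ContMDiffRiemannianMetric (𝓡 4) ∞ E4 (fun x : M => TangentSpace (𝓡 4) x)
  /-- The almost complex structure. -/
  J : ∀ x : M, TangentSpace (𝓡 4) x →L[ℝ] TangentSpace (𝓡 4) x
  smooth_J : ContMDiff (𝓡 4) ((𝓡 4).prod 𝓘(ℝ, E4 →L[ℝ] E4)) ∞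
    (fun x => Bundle.TotalSpace.mk' (E4 →L[ℝ] E4)
      (E := fun x : M => TangentSpace (𝓡 4) x →L[ℝ] TangentSpace (𝓡 4) x) x (J x))
  J_sq : ∀ (x : M) (X : TangentSpace (𝓡 4) x), J x (J x X) = -X
  orthogonal : ∀ (x : M) (X Y : TangentSpace (𝓡 4) x),
    g.inner x (J x X) (J x Y) = g.inner x X Y
  /-- `dΩ = 0`, in the coordinates of every chart. -/
  closed : ∀ e ∈ IsManifold.maximalAtlas (𝓡 4) ∞ M, ∀ u ∈ e.target, ∀ i j k : Fin 4,
    pd i (fun v => fundForm (metricInChart g e) (endoInChart J e) v ![j, k]) u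
      + pd j (fun v => fundForm (metricInChart g e) (endoInChart J e) v ![k, i]) u
      + pd k (fun v => fundForm (metricInChart g e) (endoInChart J e) v ![i, j]) u = 0

namespace AlmostKahler

variable {M : Type*} [TopologicalSpace M] [ChartedSpace E4 M] [IsManifold (𝓡 4) ∞ M]

/-- The components of the metric in a chart. -/
abbrev G (K : AlmostKahler M) (e : OpenPartialHomeomorph M E4) : MatrixField :=
  metricInChart K.g e

/-- The components of the almost complex structure in a chart. -/
abbrev Jc (K : AlmostKahler M) (e : OpenPartialHomeomorph M E4) : MatrixField :=
  endoInChart K.J e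

/-- The Ricci tensor is `J`-invariant: `Ric(JX, JY) = Ric(X, Y)`, on all of `M`. -/
def RicciInvariant (K : AlmostKahler M) : Prop :=
  ∀ e ∈ IsManifold.maximalAtlas (𝓡 4) ∞ M, ∀ u ∈ e.target, ∀ a b : Fin 4,
    twist (K.Jc e) (ricci (K.G e)) u ![a, b] = ricci (K.G e) u ![a, b]

/-- The scalar curvature is the constant `c`. -/
def ScalarCurvEq (K : AlmostKahler M) (c : ℝ) : Prop :=
  ∀ e ∈ IsManifold.maximalAtlas (𝓡 4) ∞ M, ∀ u ∈ e.target, scalarCurv (K.G e) u = c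

/-- The Bach tensor vanishes identically. -/
def BachFlat (K : AlmostKahler M) : Prop :=
  ∀ e ∈ IsManifold.maximalAtlas (𝓡 4) ∞ M, ∀ u ∈ e.target, ∀ a b : Fin 4,
    bach (K.G e) u ![a, b] = 0

/-- The metric is Einstein: the traceless Ricci tensor vanishes identically. -/
def Einstein (K : AlmostKahler M) : Prop :=
  ∀ e ∈ IsManifold.maximalAtlas (𝓡 4) ∞ M, ∀ u ∈ e.target, ∀ a b : Fin 4,
    ricci0 (K.G e) u ![a, b] = 0

end AlmostKahler

end BachFormula

end

open BachFormula

namespace BachFormula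

/-! ### Partial derivatives of functions and of matrix fields -/

/-! Everything is local, so the proof works in one chart with matrix-valued functions, and pointwise
identities are checked in an orthonormal frame adapted to `J`, where the metric is the identity
matrix and `Ω` is the constant matrix `om0`.

For any metric, `δW` is the antisymmetrised derivative of `h` (`IsMetricOn.codiffWeyl_apply`).
Commuting covariant derivatives and using `div h = ds/6` then expresses `B` through the Hessian of
`s`, the trace Laplacian `L = tr ∇²` of `Ric`, the action `R(Ric)` of the curvature on `Ric`, and
algebraic terms (`IsMetricOn.pull2_bach`). The only term that needs almost Kähler geometry is `L
Ric`.

To compute it, compare `Ric` with the Ricci form `ρ = Ω ∘ Ric`, a two-form because `Ric` is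
`J`-invariant. The form `Ω` is closed and coclosed. In dimension four the contracted Bianchi
identity makes `ρ` closed too, and `div ρ` is half of `ds ∘ Ω` (`IsNablaRic.rho`). Hence the
Weitzenböck formula `IsMetricOn.lap_closed` gives both `L Ω` and `L ρ`. On the other hand the
Leibniz rule reads `L ρ = (L Ω) Ric + 2 ∑ ∇Ω ∇Ric + Ω (L Ric)`, while `Ω² = -g` gives `(L Ω) Ω + 2 ∑
∇Ω ∇Ω + Ω (L Ω) = 0`. Solving for `L Ric` leaves terms quadratic in the curvature;
`IsAlgCurv.quadratic` reduces them to `R(Ric)`, `s Ric` and a multiple of `g`. The remaining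
first-order terms are exactly `S` (`IsAlgCurv.lap_ric_add`, `IsAlmostKahlerOn.matOf_bach_eq`).

In the frame, `S` is a sum of products of `∇Ω`, a self-dual form anticommuting with `J`, and `∇ρ₀`,
an anti-self-dual form. The two kinds of forms commute as matrices, so `S` is symmetric;
anti-self-dual forms also commute with `J`, so `S` is `J`-anti-invariant.

If `s` is constant and `B = 0`, the formula becomes `S = (s/6) Ric₀`. The left side is
anti-invariant and the right side invariant, so both vanish, and `s ≠ 0` forces `Ric₀ = 0`. -/

lemma pd_congr {U : Set E4} (hU : IsOpen U) {f g : E4 → ℝ} (h : ∀ v ∈ U, f v = g v)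
    {u : E4} (hu : u ∈ U) (i : Fin 4) : pd i f u = pd i g u := by
  have : f =ᶠ[nhds u] g := Filter.eventually_of_mem (hU.mem_nhds hu) h
  rw [pd, pd, this.fderiv_eq]

/-- Smoothness of a function on an open set. -/
def Smooth (U : Set E4) (f : E4 → ℝ) : Prop := ContDiffOn ℝ ∞ f U

lemma Smooth.congr {U : Set E4} {f g : E4 → ℝ} (hf : Smooth U f) (h : ∀ v ∈ U, g v = f v) :
    Smooth U g := ContDiffOn.congr hf h

lemma Smooth.diff {U : Set E4} (hU : IsOpen U) {f : E4 → ℝ} (hf : Smooth U f) {u : E4}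
    (hu : u ∈ U) : DifferentiableAt ℝ f u :=
  (ContDiffOn.contDiffAt hf (hU.mem_nhds hu)).differentiableAt (by simp)

lemma Smooth.const (U : Set E4) (c : ℝ) : Smooth U (fun _ => c) := contDiffOn_const

lemma Smooth.add {U : Set E4} {f g : E4 → ℝ} (hf : Smooth U f) (hg : Smooth U g) :
    Smooth U (fun v => f v + g v) := ContDiffOn.add hf hg

lemma Smooth.sub {U : Set E4} {f g : E4 → ℝ} (hf : Smooth U f) (hg : Smooth U g) :
    Smooth U (fun v => f v - g v) := ContDiffOn.sub hf hg

lemma Smooth.neg {U : Set E4} {f : E4 → ℝ} (hf : Smooth U f) :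
    Smooth U (fun v => - f v) := ContDiffOn.neg hf

lemma Smooth.mul {U : Set E4} {f g : E4 → ℝ} (hf : Smooth U f) (hg : Smooth U g) :
    Smooth U (fun v => f v * g v) := ContDiffOn.mul hf hg

lemma Smooth.sum {U : Set E4} {ι : Type*} {s : Finset ι} {f : ι → E4 → ℝ}
    (hf : ∀ i ∈ s, Smooth U (f i)) : Smooth U (fun v => ∑ i ∈ s, f i v) := ContDiffOn.sum hf

lemma Smooth.pd {U : Set E4} (hU : IsOpen U) {f : E4 → ℝ} (hf : Smooth U f) (i : Fin 4) :
    Smooth U (pd i f) := by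
  have h1 : ContDiffOn ℝ ∞ (fderiv ℝ f) U := ContDiffOn.fderiv_of_isOpen hf hU (by simp)
  exact h1.clm_apply contDiffOn_const

lemma pd_add {f g : E4 → ℝ} {u : E4} (hf : DifferentiableAt ℝ f u) (hg : DifferentiableAt ℝ g u)
    (i : Fin 4) : pd i (fun v => f v + g v) u = pd i f u + pd i g u := by
  simp [pd, fderiv_fun_add hf hg]

lemma pd_sub {f g : E4 → ℝ} {u : E4} (hf : DifferentiableAt ℝ f u) (hg : DifferentiableAt ℝ g u)
    (i : Fin 4) : pd i (fun v => f v - g v) u = pd i f u - pd i g u := by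
  simp [pd, fderiv_fun_sub hf hg]

lemma pd_neg (f : E4 → ℝ) (u : E4) (i : Fin 4) : pd i (fun v => - f v) u = - pd i f u := by
  simp [pd, fderiv_fun_neg]

lemma pd_const (c : ℝ) (u : E4) (i : Fin 4) : pd i (fun _ => c) u = 0 := by
  simp [pd]

lemma pd_mul {f g : E4 → ℝ} {u : E4} (hf : DifferentiableAt ℝ f u) (hg : DifferentiableAt ℝ g u)
    (i : Fin 4) : pd i (fun v => f v * g v) u = pd i f u * g u + f u * pd i g u := by
  simp [pd, fderiv_fun_mul hf hg]; ring

lemma pd_const_mul {f : E4 → ℝ} {u : E4} (hf : DifferentiableAt ℝ f u) (c : ℝ)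
    (i : Fin 4) : pd i (fun v => c * f v) u = c * pd i f u := by
  rw [pd_mul (differentiableAt_const c) hf, pd_const]; ring

lemma pd_sum {ι : Type*} {s : Finset ι} {f : ι → E4 → ℝ} {u : E4}
    (hf : ∀ j ∈ s, DifferentiableAt ℝ (f j) u) (i : Fin 4) :
    pd i (fun v => ∑ j ∈ s, f j v) u = ∑ j ∈ s, pd i (f j) u := by
  simp [pd, fderiv_fun_sum hf]

lemma pd_comm {U : Set E4} (hU : IsOpen U) {f : E4 → ℝ} (hf : Smooth U f) {u : E4} (hu : u ∈ U)
    (i j : Fin 4) : pd i (pd j f) u = pd j (pd i f) u := by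
  have hc : ContDiffAt ℝ ∞ f u := ContDiffOn.contDiffAt hf (hU.mem_nhds hu)
  have hs : IsSymmSndFDerivAt ℝ f u := hc.isSymmSndFDerivAt (by
    rw [minSmoothness_of_isRCLikeNormedField]; exact WithTop.coe_le_coe.2 le_top)
  have hd : DifferentiableAt ℝ (fderiv ℝ f) u :=
    (hc.fderiv_right (m := ∞) (by simp)).differentiableAt (by simp)
  have key : ∀ i j : Fin 4, pd i (pd j f) u = fderiv ℝ (fderiv ℝ f) u (basisVec i) (basisVec j) := by
    intro i j
    have : (pd j f) = fun v => fderiv ℝ f v (basisVec j) := rfl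
    rw [pd, this, fderiv_clm_apply hd (differentiableAt_const _)]
    simp
  rw [key, key, hs.eq]

/-- Entrywise smoothness of a matrix field on an open set. -/
def MSmooth (U : Set E4) (A : MatrixField) : Prop := ∀ a b, Smooth U (fun v => A v a b)

/-- Entrywise partial derivative of a matrix field. -/
noncomputable def mpd (i : Fin 4) (A : MatrixField) : MatrixField := fun u =>
  Matrix.of fun a b => pd i (fun v => A v a b) u

@[simp] lemma mpd_apply (i : Fin 4) (A : MatrixField) (u : E4) (a b : Fin 4) :
    mpd i A u a b = pd i (fun v => A v a b) u := rfl

/-! ### Calculus of matrix fields -/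

section MatrixRules

variable {U : Set E4} {A B : MatrixField}

lemma MSmooth.congr (hA : MSmooth U A) (h : ∀ v ∈ U, B v = A v) : MSmooth U B :=
  fun a b => (hA a b).congr fun v hv => by rw [h v hv]

lemma MSmooth.add (hA : MSmooth U A) (hB : MSmooth U B) : MSmooth U (fun v => A v + B v) :=
  fun a b => (hA a b).add (hB a b)

lemma MSmooth.sub (hA : MSmooth U A) (hB : MSmooth U B) : MSmooth U (fun v => A v - B v) :=
  fun a b => (hA a b).sub (hB a b)

lemma MSmooth.smul {f : E4 → ℝ} (hf : Smooth U f) (hA : MSmooth U A) :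
    MSmooth U (fun v => f v • A v) :=
  fun a b => hf.mul (hA a b)

lemma MSmooth.transpose (hA : MSmooth U A) : MSmooth U (fun v => (A v)ᵀ) :=
  fun a b => hA b a

lemma MSmooth.mul (hA : MSmooth U A) (hB : MSmooth U B) : MSmooth U (fun v => A v * B v) := by
  intro a b
  simp only [Matrix.mul_apply]
  exact Smooth.sum fun c _ => (hA a c).mul (hB c b)

lemma MSmooth.mpd (hU : IsOpen U) (hA : MSmooth U A) (i : Fin 4) : MSmooth U (mpd i A) :=
  fun a b => (hA a b).pd hU i

lemma MSmooth.det (hA : MSmooth U A) : Smooth U (fun v => (A v).det) := by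
  simp only [Matrix.det_apply']
  exact Smooth.sum fun σ _ => (Smooth.const U _).mul (contDiffOn_prod fun i _ => hA _ _)

/-- Cramer's rule: the entries of the inverse are cofactors divided by the determinant. -/
lemma MSmooth.inv (hA : MSmooth U A) (hdet : ∀ v ∈ U, IsUnit (A v).det) :
    MSmooth U (fun v => (A v)⁻¹) := by
  intro a b
  have h1 : Smooth U (fun v => ((A v).det)⁻¹) :=
    ContDiffOn.inv hA.det fun v hv => (hdet v hv).ne_zero
  have h2 : Smooth U (fun v => (A v).adjugate a b) := by
    simp only [Matrix.adjugate_apply]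
    refine MSmooth.det (A := fun v => (A v).updateRow b (Pi.single a 1)) fun c d => ?_
    by_cases h : c = b
    · subst h; simpa using Smooth.const U _
    · simpa [Matrix.updateRow_apply, h] using hA c d
  refine (h1.mul h2).congr fun v _ => ?_
  simp [Matrix.inv_def]

lemma mpd_congr (hU : IsOpen U) (h : ∀ v ∈ U, A v = B v) {u : E4} (hu : u ∈ U) (i : Fin 4) :
    mpd i A u = mpd i B u := by
  ext a b
  exact pd_congr hU (fun v hv => by rw [h v hv]) hu i

lemma mpd_transpose (A : MatrixField) (u : E4) (i : Fin 4) :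
    mpd i (fun v => (A v)ᵀ) u = (mpd i A u)ᵀ := rfl

lemma mpd_const (C : Matrix (Fin 4) (Fin 4) ℝ) (u : E4) (i : Fin 4) :
    mpd i (fun _ => C) u = 0 := by
  ext a b; simp [pd_const]

lemma mpd_neg (A : MatrixField) (u : E4) (i : Fin 4) :
    mpd i (fun v => - A v) u = - mpd i A u := by
  ext a b; simp [pd_neg]

lemma mpd_comm (hU : IsOpen U) (hA : MSmooth U A) {u : E4} (hu : u ∈ U)
    (i j : Fin 4) : mpd i (mpd j A) u = mpd j (mpd i A) u := by
  ext a b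
  exact pd_comm hU (hA a b) hu i j

lemma mpd_smul (hU : IsOpen U) (hA : MSmooth U A) {u : E4} (hu : u ∈ U)
    {f : E4 → ℝ} (hf : Smooth U f) (i : Fin 4) :
    mpd i (fun v => f v • A v) u = pd i f u • A u + f u • mpd i A u := by
  ext a b
  simpa using pd_mul (hf.diff hU hu) ((hA a b).diff hU hu) i

lemma mpd_add (hU : IsOpen U) (hA : MSmooth U A) (hB : MSmooth U B) {u : E4} (hu : u ∈ U)
    (i : Fin 4) : mpd i (fun v => A v + B v) u = mpd i A u + mpd i B u := by
  ext a b
  simpa using pd_add ((hA a b).diff hU hu) ((hB a b).diff hU hu) i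

lemma mpd_sub (hU : IsOpen U) (hA : MSmooth U A) (hB : MSmooth U B) {u : E4} (hu : u ∈ U)
    (i : Fin 4) : mpd i (fun v => A v - B v) u = mpd i A u - mpd i B u := by
  ext a b
  simpa using pd_sub ((hA a b).diff hU hu) ((hB a b).diff hU hu) i

lemma mpd_mul (hU : IsOpen U) (hA : MSmooth U A) (hB : MSmooth U B) {u : E4} (hu : u ∈ U)
    (i : Fin 4) :
    mpd i (fun v => A v * B v) u = mpd i A u * B u + A u * mpd i B u := by
  ext a b
  simp only [mpd_apply, Matrix.mul_apply, Matrix.add_apply]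
  rw [pd_sum (f := fun c v => A v a c * B v c b)
    fun c _ => ((hA a c).mul (hB c b)).diff hU hu, ← Finset.sum_add_distrib]
  exact Finset.sum_congr rfl fun c _ => pd_mul ((hA a c).diff hU hu) ((hB c b).diff hU hu) i

/-- Differentiate `A⁻¹ A = 1`. -/
lemma mpd_inv (hU : IsOpen U) (hA : MSmooth U A) {u : E4} (hu : u ∈ U)
    (hdet : ∀ v ∈ U, IsUnit (A v).det) (i : Fin 4) :
    mpd i (fun v => (A v)⁻¹) u = - ((A u)⁻¹ * mpd i A u * (A u)⁻¹) := by
  have h1 := mpd_mul hU (hA.inv hdet) hA hu i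
  rw [mpd_congr (B := fun _ => 1) hU (fun v hv => Matrix.nonsing_inv_mul _ (hdet v hv)) hu i,
    mpd_const] at h1
  have h2 : mpd i (fun v => (A v)⁻¹) u * A u = - ((A u)⁻¹ * mpd i A u) :=
    eq_neg_of_add_eq_zero_left h1.symm
  calc mpd i (fun v => (A v)⁻¹) u
      = mpd i (fun v => (A v)⁻¹) u * (A u * (A u)⁻¹) := by
        rw [Matrix.mul_nonsing_inv _ (hdet u hu), mul_one]
    _ = _ := by rw [← mul_assoc, h2, neg_mul]

end MatrixRules

/-! ### The Levi-Civita connection in coordinates -/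

/-- `G` is the component matrix of a (nondegenerate) smooth metric on the open set `U`. -/
structure IsMetricOn (U : Set E4) (G : MatrixField) : Prop where
  isOpen : IsOpen U
  smooth : MSmooth U G
  symm : ∀ v ∈ U, (G v)ᵀ = G v
  det : ∀ v ∈ U, IsUnit (G v).det

/-- The connection matrices `(Γ_i)^k_j`. -/
noncomputable def gam (G : MatrixField) (i : Fin 4) : MatrixField := fun u =>
  Matrix.of fun k j => christoffel G u k i j

@[simp] lemma gam_apply (G : MatrixField) (i : Fin 4) (u : E4) (k j : Fin 4) :
    gam G i u k j = christoffel G u k i j := rfl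

/-- The covariant derivative `∇_i A` of a field of bilinear forms. -/
noncomputable def nab (G : MatrixField) (i : Fin 4) (A : MatrixField) : MatrixField := fun u =>
  mpd i A u - (gam G i u)ᵀ * A u - A u * gam G i u

/-- The second covariant derivative `∇²_{i,j} A` of a field of bilinear forms. -/
noncomputable def nab2 (G : MatrixField) (i j : Fin 4) (A : MatrixField) : MatrixField := fun u =>
  nab G i (nab G j A) u - ∑ l, gam G i u l j • nab G l A u

/-- The curvature endomorphisms `R(∂_i, ∂_j)`. -/
noncomputable def curvM (G : MatrixField) (i j : Fin 4) : MatrixField := fun u =>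
  mpd i (gam G j) u - mpd j (gam G i) u + (gam G i u * gam G j u - gam G j u * gam G i u)

lemma curvM_apply (G : MatrixField) (i j : Fin 4) (u : E4) (m l : Fin 4) :
    curvM G i j u m l = curvEndo G u m l i j := by
  simp only [curvM, curvEndo, Matrix.add_apply, Matrix.sub_apply, mpd_apply, gam_apply,
    Matrix.mul_apply, Finset.sum_sub_distrib]

/-- The covariant derivative of the curvature endomorphisms. -/
noncomputable def nabCurv (G : MatrixField) (m i j : Fin 4) : MatrixField := fun u =>
  mpd m (curvM G i j) u + gam G m u * curvM G i j u - curvM G i j u * gam G m u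
    - ∑ l, gam G m u l i • curvM G l j u - ∑ l, gam G m u l j • curvM G i l u

section

variable {U : Set E4} {G : MatrixField}

lemma IsMetricOn.inv_mul (hG : IsMetricOn U G) {u : E4} (hu : u ∈ U) : (G u)⁻¹ * G u = 1 :=
  Matrix.nonsing_inv_mul _ (hG.det u hu)

lemma IsMetricOn.mul_inv (hG : IsMetricOn U G) {u : E4} (hu : u ∈ U) : G u * (G u)⁻¹ = 1 :=
  Matrix.mul_nonsing_inv _ (hG.det u hu)

lemma IsMetricOn.inv_symm (hG : IsMetricOn U G) {u : E4} (hu : u ∈ U) :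
    ((G u)⁻¹)ᵀ = (G u)⁻¹ := by
  rw [Matrix.transpose_nonsing_inv, hG.symm u hu]

lemma IsMetricOn.smooth_inv (hG : IsMetricOn U G) : MSmooth U (fun v => (G v)⁻¹) :=
  hG.smooth.inv hG.det

lemma IsMetricOn.symm_apply (hG : IsMetricOn U G) {u : E4} (hu : u ∈ U) (i j : Fin 4) :
    G u i j = G u j i := congrFun (congrFun (hG.symm u hu) j) i

lemma IsMetricOn.inv_symm_apply (hG : IsMetricOn U G) {u : E4} (hu : u ∈ U) (i j : Fin 4) :
    (G u)⁻¹ i j = (G u)⁻¹ j i := congrFun (congrFun (hG.inv_symm hu) j) i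

lemma IsMetricOn.pd_symm (hG : IsMetricOn U G) {u : E4} (hu : u ∈ U) (k i j : Fin 4) :
    pd k (fun v => G v i j) u = pd k (fun v => G v j i) u :=
  pd_congr hG.isOpen (fun _ hv => hG.symm_apply hv i j) hu k

/-- The Christoffel symbols of the first kind. -/
noncomputable def gamLow (G : MatrixField) (i : Fin 4) : MatrixField := fun u =>
  Matrix.of fun l j => (1 / 2) *
    (pd i (fun v => G v j l) u + pd j (fun v => G v i l) u - pd l (fun v => G v i j) u)

lemma gam_eq (G : MatrixField) (i : Fin 4) (u : E4) : gam G i u = (G u)⁻¹ * gamLow G i u := by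
  ext k j
  simp only [gam_apply, christoffel, gamLow, Matrix.mul_apply, Matrix.of_apply, Finset.mul_sum]
  exact Finset.sum_congr rfl fun l _ => by ring

lemma IsMetricOn.smooth_gam (hG : IsMetricOn U G) (i : Fin 4) : MSmooth U (gam G i) := by
  have h : MSmooth U (gamLow G i) := fun l j =>
    (Smooth.const U (1 / 2)).mul
      ((((hG.smooth j l).pd hG.isOpen i).add ((hG.smooth i l).pd hG.isOpen j)).sub
        ((hG.smooth i j).pd hG.isOpen l))
  exact (hG.smooth_inv.mul h).congr fun v _ => gam_eq G i v

/-- Metric compatibility of the connection: lowering the upper index of `Γ_i` gives the Christoffel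
symbols of the first kind, and symmetrising these leaves only `∂_i g`. -/
lemma IsMetricOn.mpd_metric (hG : IsMetricOn U G) {u : E4} (hu : u ∈ U) (i : Fin 4) :
    mpd i G u = (gam G i u)ᵀ * G u + G u * gam G i u := by
  have h1 : G u * gam G i u = gamLow G i u := by
    rw [gam_eq, ← mul_assoc, hG.mul_inv hu, one_mul]
  have h2 : (gam G i u)ᵀ * G u = (gamLow G i u)ᵀ := by
    rw [← h1, Matrix.transpose_mul, hG.symm u hu]
  rw [h1, h2]
  ext a b
  simp only [mpd_apply, gamLow, Matrix.add_apply, Matrix.transpose_apply, Matrix.of_apply]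
  rw [hG.pd_symm hu i b a]
  ring

lemma IsMetricOn.mpd_metric_inv (hG : IsMetricOn U G) {u : E4} (hu : u ∈ U) (i : Fin 4) :
    mpd i (fun v => (G v)⁻¹) u = - (gam G i u * (G u)⁻¹ + (G u)⁻¹ * (gam G i u)ᵀ) := by
  rw [mpd_inv hG.isOpen hG.smooth hu hG.det, hG.mpd_metric hu]
  have e : (G u)⁻¹ * ((gam G i u)ᵀ * G u + G u * gam G i u) * (G u)⁻¹
      = (G u)⁻¹ * (gam G i u)ᵀ * (G u * (G u)⁻¹) + ((G u)⁻¹ * G u) * gam G i u * (G u)⁻¹ := by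
    noncomm_ring
  rw [e, hG.mul_inv hu, hG.inv_mul hu]
  noncomm_ring

lemma IsMetricOn.christoffel_symm (hG : IsMetricOn U G) {u : E4} (hu : u ∈ U) (k i j : Fin 4) :
    christoffel G u k i j = christoffel G u k j i := by
  simp only [christoffel]
  congr 1
  refine Finset.sum_congr rfl fun l _ => ?_
  rw [hG.pd_symm hu l i j]
  ring

lemma IsMetricOn.smooth_nab (hG : IsMetricOn U G) {A : MatrixField} (hA : MSmooth U A)
    (i : Fin 4) : MSmooth U (nab G i A) :=
  ((hA.mpd hG.isOpen i).sub ((hG.smooth_gam i).transpose.mul hA)).sub (hA.mul (hG.smooth_gam i))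

lemma IsMetricOn.nab_metric (hG : IsMetricOn U G) {u : E4} (hu : u ∈ U) (i : Fin 4) :
    nab G i G u = 0 := by
  rw [nab, hG.mpd_metric hu]; noncomm_ring

lemma IsMetricOn.nab_congr (hG : IsMetricOn U G) {A B : MatrixField} (h : ∀ v ∈ U, A v = B v)
    {u : E4} (hu : u ∈ U) (i : Fin 4) : nab G i A u = nab G i B u := by
  rw [nab, nab, mpd_congr hG.isOpen h hu, h u hu]

lemma IsMetricOn.nab2_congr (hG : IsMetricOn U G) {A B : MatrixField} (h : ∀ v ∈ U, A v = B v)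
    {u : E4} (hu : u ∈ U) (i j : Fin 4) : nab2 G i j A u = nab2 G i j B u := by
  rw [nab2, nab2, hG.nab_congr (fun v hv => hG.nab_congr h hv j) hu]
  simp only [hG.nab_congr h hu]

lemma nab_zero (G : MatrixField) (i : Fin 4) (u : E4) : nab G i (fun _ => 0) u = 0 := by
  simp [nab, mpd_const]

lemma nab_transpose (G : MatrixField) (i : Fin 4) (A : MatrixField) (u : E4) :
    nab G i (fun v => (A v)ᵀ) u = (nab G i A u)ᵀ := by
  simp only [nab, mpd_transpose, Matrix.transpose_sub, Matrix.transpose_mul,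
    Matrix.transpose_transpose]
  abel

lemma IsMetricOn.nab_add (hG : IsMetricOn U G) {A B : MatrixField} (hA : MSmooth U A)
    (hB : MSmooth U B) {u : E4} (hu : u ∈ U) (i : Fin 4) :
    nab G i (fun v => A v + B v) u = nab G i A u + nab G i B u := by
  simp only [nab, mpd_add hG.isOpen hA hB hu]; noncomm_ring

lemma IsMetricOn.nab_sub (hG : IsMetricOn U G) {A B : MatrixField} (hA : MSmooth U A)
    (hB : MSmooth U B) {u : E4} (hu : u ∈ U) (i : Fin 4) :
    nab G i (fun v => A v - B v) u = nab G i A u - nab G i B u := by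
  simp only [nab, mpd_sub hG.isOpen hA hB hu]; noncomm_ring

lemma IsMetricOn.nab_smul (hG : IsMetricOn U G) {A : MatrixField} {f : E4 → ℝ}
    (hA : MSmooth U A) (hf : Smooth U f) {u : E4} (hu : u ∈ U) (i : Fin 4) :
    nab G i (fun v => f v • A v) u = pd i f u • A u + f u • nab G i A u := by
  simp only [nab, mpd_smul hG.isOpen hA hu hf, Matrix.mul_smul, Matrix.smul_mul, smul_sub]; abel

/-- Composition of bilinear forms, with the middle index raised. -/
noncomputable def comp (G A B : MatrixField) : MatrixField := fun u => A u * (G u)⁻¹ * B u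

lemma IsMetricOn.smooth_comp (hG : IsMetricOn U G) {A B : MatrixField} (hA : MSmooth U A)
    (hB : MSmooth U B) : MSmooth U (comp G A B) := (hA.mul hG.smooth_inv).mul hB

/-- The Leibniz rule has no extra term because `g⁻¹` is parallel: the connection terms on the two
contracted indices cancel against the derivative of `g⁻¹`. -/
lemma IsMetricOn.nab_comp (hG : IsMetricOn U G) {A B : MatrixField} (hA : MSmooth U A)
    (hB : MSmooth U B) {u : E4} (hu : u ∈ U) (i : Fin 4) :
    nab G i (comp G A B) u = comp G (nab G i A) B u + comp G A (nab G i B) u := by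
  have h := mpd_mul hG.isOpen (hA.mul hG.smooth_inv) hB hu i
  rw [mpd_mul hG.isOpen hA hG.smooth_inv hu i, hG.mpd_metric_inv hu] at h
  have h' : mpd i (comp G A B) u = _ := h
  rw [nab, h']
  simp only [comp, nab]
  noncomm_ring

lemma IsMetricOn.nab2_comp (hG : IsMetricOn U G) {A B : MatrixField} (hA : MSmooth U A)
    (hB : MSmooth U B) {u : E4} (hu : u ∈ U) (i j : Fin 4) :
    nab2 G i j (comp G A B) u = comp G (nab2 G i j A) B u + comp G (nab G j A) (nab G i B) u
      + comp G (nab G i A) (nab G j B) u + comp G A (nab2 G i j B) u := by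
  rw [nab2, hG.nab_congr (fun v hv => hG.nab_comp hA hB hv j) hu,
    hG.nab_add (hG.smooth_comp (hG.smooth_nab hA j) hB) (hG.smooth_comp hA (hG.smooth_nab hB j)) hu,
    hG.nab_comp (hG.smooth_nab hA j) hB hu, hG.nab_comp hA (hG.smooth_nab hB j) hu]
  simp only [hG.nab_comp hA hB hu]
  simp only [comp, nab2, sub_mul, mul_sub, Matrix.mul_sum, Matrix.sum_mul, Matrix.mul_smul,
    Matrix.smul_mul, smul_add, Finset.sum_add_distrib]
  abel

/-- The Ricci identity for bilinear forms. -/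
lemma IsMetricOn.nab2_comm (hG : IsMetricOn U G) {A : MatrixField} (hA : MSmooth U A)
    {u : E4} (hu : u ∈ U) (i j : Fin 4) :
    nab2 G i j A u - nab2 G j i A u = - ((curvM G i j u)ᵀ * A u + A u * curvM G i j u) := by
  have key : ∀ i j, nab G i (nab G j A) u = mpd i (mpd j A) u
      - ((mpd i (gam G j) u)ᵀ * A u + (gam G j u)ᵀ * mpd i A u)
      - (mpd i A u * gam G j u + A u * mpd i (gam G j) u)
      - (gam G i u)ᵀ * nab G j A u - nab G j A u * gam G i u := by
    intro i j
    have s1 := (hG.smooth_gam j).transpose.mul hA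
    have s2 := hA.mul (hG.smooth_gam j)
    have h : mpd i (nab G j A) u = mpd i (mpd j A) u
      - ((mpd i (gam G j) u)ᵀ * A u + (gam G j u)ᵀ * mpd i A u)
      - (mpd i A u * gam G j u + A u * mpd i (gam G j) u) := by
      have e1 := mpd_sub hG.isOpen ((hA.mpd hG.isOpen j).sub s1) s2 hu i
      rw [mpd_sub hG.isOpen (hA.mpd hG.isOpen j) s1 hu,
        mpd_mul hG.isOpen (hG.smooth_gam j).transpose hA hu,
        mpd_mul hG.isOpen hA (hG.smooth_gam j) hu, mpd_transpose] at e1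
      exact e1
    rw [nab, h]
  -- The connection is torsion-free, so the first-order correction in `nab2` is symmetric in `i, j`
  -- and drops out of the commutator.
  have hs : ∑ l, gam G i u l j • nab G l A u = ∑ l, gam G j u l i • nab G l A u :=
    Finset.sum_congr rfl fun l _ => by rw [gam_apply, gam_apply, hG.christoffel_symm hu]
  rw [nab2, nab2, hs, key i j, key j i, mpd_comm hG.isOpen hA hu j i]
  simp only [nab, curvM, Matrix.transpose_add, Matrix.transpose_sub, Matrix.transpose_mul]
  noncomm_ring

lemma IsMetricOn.smooth_curvM (hG : IsMetricOn U G) (i j : Fin 4) : MSmooth U (curvM G i j) :=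
  (((hG.smooth_gam j).mpd hG.isOpen i).sub ((hG.smooth_gam i).mpd hG.isOpen j)).add
    (((hG.smooth_gam i).mul (hG.smooth_gam j)).sub ((hG.smooth_gam j).mul (hG.smooth_gam i)))

lemma curvM_antisymm (G : MatrixField) (i j : Fin 4) (u : E4) : curvM G j i u = - curvM G i j u := by
  simp only [curvM]; noncomm_ring

/-- The Ricci identity applied to the metric itself, whose second covariant derivatives vanish. -/
lemma IsMetricOn.lower_curvM_antisymm (hG : IsMetricOn U G) {u : E4} (hu : u ∈ U) (i j : Fin 4) :
    (G u * curvM G i j u)ᵀ = - (G u * curvM G i j u) := by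
  have z : ∀ i j, nab2 G i j G u = 0 := by
    intro i j
    rw [nab2, hG.nab_congr (B := fun _ => 0) (fun v hv => hG.nab_metric hv j) hu, nab_zero]
    simp [hG.nab_metric hu]
  have h := hG.nab2_comm hG.smooth hu i j
  rw [z, z, sub_zero] at h
  rw [Matrix.transpose_mul, hG.symm u hu]
  exact eq_neg_of_add_eq_zero_left (neg_eq_zero.1 h.symm)

/-- The first Bianchi identity. -/
lemma IsMetricOn.curvM_cyclic (hG : IsMetricOn U G) {u : E4} (hu : u ∈ U) (m l i j : Fin 4) :
    curvM G i j u m l + curvM G j l u m i + curvM G l i u m j = 0 := by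
  have hp : ∀ a b c, pd a (fun v => christoffel G v m b c) u
      = pd a (fun v => christoffel G v m c b) u := fun a b c =>
    pd_congr hG.isOpen (fun v hv => hG.christoffel_symm hv m b c) hu a
  simp only [curvM, Matrix.add_apply, Matrix.sub_apply, mpd_apply, gam_apply, Matrix.mul_apply]
  rw [hp i l j, hp j l i, hp l i j]
  simp only [hG.christoffel_symm hu _ j l, hG.christoffel_symm hu _ i l,
    hG.christoffel_symm hu _ j i]
  ring

/-- The second Bianchi identity. -/
lemma IsMetricOn.nabCurv_cyclic (hG : IsMetricOn U G) {u : E4} (hu : u ∈ U) (m i j : Fin 4) :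
    nabCurv G m i j u + nabCurv G i j m u + nabCurv G j m i u = 0 := by
  have hs := hG.smooth_gam
  have key : ∀ m i j, mpd m (curvM G i j) u = mpd m (mpd i (gam G j)) u - mpd m (mpd j (gam G i)) u
      + (mpd m (gam G i) u * gam G j u + gam G i u * mpd m (gam G j) u
        - (mpd m (gam G j) u * gam G i u + gam G j u * mpd m (gam G i) u)) := by
    intro m i j
    have a1 := (hs j).mpd hG.isOpen i
    have a2 := (hs i).mpd hG.isOpen j
    have b1 := (hs i).mul (hs j)
    have b2 := (hs j).mul (hs i)
    have e := mpd_add hG.isOpen (a1.sub a2) (b1.sub b2) hu m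
    rw [mpd_sub hG.isOpen a1 a2 hu, mpd_sub hG.isOpen b1 b2 hu, mpd_mul hG.isOpen (hs i) (hs j) hu,
      mpd_mul hG.isOpen (hs j) (hs i) hu] at e
    exact e
  -- Torsion-freeness pairs the connection terms acting on the two form indices, so that they cancel
  -- in the cyclic sum.
  have hswap : ∀ a b c, ∑ l, gam G a u l b • curvM G c l u = - ∑ l, gam G b u l a • curvM G l c u := by
    intro a b c
    rw [← Finset.sum_neg_distrib]
    refine Finset.sum_congr rfl fun l _ => ?_
    rw [gam_apply, gam_apply, hG.christoffel_symm hu, curvM_antisymm G l c, smul_neg]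
  simp only [nabCurv, hswap, key]
  rw [mpd_comm hG.isOpen (hs j) hu m i, mpd_comm hG.isOpen (hs m) hu i j,
    mpd_comm hG.isOpen (hs i) hu j m]
  simp only [curvM]
  noncomm_ring

end

/-! ### Covariant derivatives of tensors of low rank -/

lemma covDeriv_zero (G : MatrixField) (T : Tensor 0) (u : E4) (i : Fin 4) :
    covDeriv G T u ![i] = pd i (fun v => T v ![]) u := by
  simp only [covDeriv, Finset.univ_eq_empty, Finset.sum_empty, sub_zero]
  rfl

lemma covDeriv_one (G : MatrixField) (T : Tensor 1) (u : E4) (i a : Fin 4) :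
    covDeriv G T u ![i, a] = pd i (fun v => T v ![a]) u
      - ∑ l, christoffel G u l i a * T u ![l] := by
  have h0 : ∀ l : Fin 4, Function.update ![a] 0 l = ![l] := fun l => by
    ext m; fin_cases m; rfl
  have ht : Fin.tail ![i, a] = ![a] := rfl
  simp only [covDeriv, ht]
  rw [Fin.sum_univ_one]
  simp only [h0]
  rfl

lemma covDeriv_two (G : MatrixField) (T : Tensor 2) (u : E4) (i a b : Fin 4) :
    covDeriv G T u ![i, a, b] = pd i (fun v => T v ![a, b]) u
      - (∑ l, christoffel G u l i a * T u ![l, b] + ∑ l, christoffel G u l i b * T u ![a, l]) := by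
  have h0 : ∀ l : Fin 4, Function.update ![a, b] 0 l = ![l, b] := fun l => by
    ext m; fin_cases m <;> rfl
  have h1 : ∀ l : Fin 4, Function.update ![a, b] 1 l = ![a, l] := fun l => by
    ext m; fin_cases m <;> rfl
  have ht : Fin.tail ![i, a, b] = ![a, b] := rfl
  simp only [covDeriv, ht]
  rw [Fin.sum_univ_two]
  simp only [h0, h1]
  rfl

lemma covDeriv_three (G : MatrixField) (T : Tensor 3) (u : E4) (i a b c : Fin 4) :
    covDeriv G T u ![i, a, b, c] = pd i (fun v => T v ![a, b, c]) u
      - (∑ l, christoffel G u l i a * T u ![l, b, c] + ∑ l, christoffel G u l i b * T u ![a, l, c]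
        + ∑ l, christoffel G u l i c * T u ![a, b, l]) := by
  have h0 : ∀ l : Fin 4, Function.update ![a, b, c] 0 l = ![l, b, c] := fun l => by
    ext m; fin_cases m <;> rfl
  have h1 : ∀ l : Fin 4, Function.update ![a, b, c] 1 l = ![a, l, c] := fun l => by
    ext m; fin_cases m <;> rfl
  have h2 : ∀ l : Fin 4, Function.update ![a, b, c] 2 l = ![a, b, l] := fun l => by
    ext m; fin_cases m <;> rfl
  have ht : Fin.tail ![i, a, b, c] = ![a, b, c] := rfl
  simp only [covDeriv, ht]
  rw [Fin.sum_univ_three]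
  simp only [h0, h1, h2]
  rfl

lemma covDeriv_four (G : MatrixField) (T : Tensor 4) (u : E4) (i a b c d : Fin 4) :
    covDeriv G T u ![i, a, b, c, d] = pd i (fun v => T v ![a, b, c, d]) u
      - (∑ l, christoffel G u l i a * T u ![l, b, c, d]
        + ∑ l, christoffel G u l i b * T u ![a, l, c, d]
        + ∑ l, christoffel G u l i c * T u ![a, b, l, d]
        + ∑ l, christoffel G u l i d * T u ![a, b, c, l]) := by
  have h0 : ∀ l : Fin 4, Function.update ![a, b, c, d] 0 l = ![l, b, c, d] := fun l => by
    ext m; fin_cases m <;> rfl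
  have h1 : ∀ l : Fin 4, Function.update ![a, b, c, d] 1 l = ![a, l, c, d] := fun l => by
    ext m; fin_cases m <;> rfl
  have h2 : ∀ l : Fin 4, Function.update ![a, b, c, d] 2 l = ![a, b, l, d] := fun l => by
    ext m; fin_cases m <;> rfl
  have h3 : ∀ l : Fin 4, Function.update ![a, b, c, d] 3 l = ![a, b, c, l] := fun l => by
    ext m; fin_cases m <;> rfl
  have ht : Fin.tail ![i, a, b, c, d] = ![a, b, c, d] := rfl
  simp only [covDeriv, ht]
  rw [Fin.sum_univ_four]
  simp only [h0, h1, h2, h3]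
  rfl

lemma nab_apply (G : MatrixField) (i : Fin 4) (A : MatrixField) (u : E4) (a b : Fin 4) :
    nab G i A u a b = pd i (fun v => A v a b) u
      - (∑ l, christoffel G u l i a * A u l b + ∑ l, christoffel G u l i b * A u a l) := by
  simp only [nab, Matrix.sub_apply, mpd_apply, Matrix.mul_apply, Matrix.transpose_apply, gam_apply,
    sub_sub]
  congr 2
  exact Finset.sum_congr rfl fun l _ => mul_comm _ _

lemma nab2_apply (G : MatrixField) (i j : Fin 4) (A : MatrixField) (u : E4) (a b : Fin 4) :
    nab2 G i j A u a b = nab G i (nab G j A) u a b - ∑ l, christoffel G u l i j * nab G l A u a b := by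
  simp only [nab2, Matrix.sub_apply, Matrix.sum_apply, Matrix.smul_apply, gam_apply, smul_eq_mul]

/-- The matrix of components of a covariant tensor of rank two. -/
def matOf (T : Tensor 2) : MatrixField := fun u => Matrix.of fun a b => T u ![a, b]

@[simp] lemma matOf_apply (T : Tensor 2) (u : E4) (a b : Fin 4) : matOf T u a b = T u ![a, b] := rfl

/-- The bridge from the index notation of the statement to the matrix calculus used in the proof. -/
lemma covDeriv_matOf (G : MatrixField) (T : Tensor 2) (u : E4) (i a b : Fin 4) :
    covDeriv G T u ![i, a, b] = nab G i (matOf T) u a b := by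
  rw [covDeriv_two, nab_apply]; rfl

/-- The matrix of the Hessian of a function. -/
noncomputable def hessM (G : MatrixField) (f : E4 → ℝ) : MatrixField := fun u =>
  Matrix.of fun i j => pd i (pd j f) u - ∑ l, christoffel G u l i j * pd l f u

lemma hess_apply (G : MatrixField) (f : E4 → ℝ) (u : E4) (i j : Fin 4) :
    hess G f u ![i, j] = hessM G f u i j := by
  have h : ∀ v k, covDeriv G (k := 0) (fun u _ => f u) v ![k] = pd k f v :=
    fun v k => covDeriv_zero G _ v k
  simp only [hess, covDeriv_one, h, hessM, Matrix.of_apply]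

/-! ### Contractions -/

/-- The trace of a bilinear form with respect to the metric. -/
noncomputable def tr (G A : MatrixField) (u : E4) : ℝ := ∑ i, ∑ j, (G u)⁻¹ i j * A u i j

lemma tr_eq_trace (G A : MatrixField) (u : E4) : tr G A u = ((G u)⁻¹ * (A u)ᵀ).trace := by
  simp [tr, Matrix.trace, Matrix.mul_apply]

section

variable {U : Set E4} {G : MatrixField}

lemma pd_trace (hU : IsOpen U) {A : MatrixField} (hA : MSmooth U A) {u : E4} (hu : u ∈ U)
    (k : Fin 4) : pd k (fun v => (A v).trace) u = (mpd k A u).trace := by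
  simp only [Matrix.trace, Matrix.diag]
  exact pd_sum (fun j _ => (hA j j).diff hU hu) k

lemma IsMetricOn.smooth_tr (hG : IsMetricOn U G) {A : MatrixField} (hA : MSmooth U A) :
    Smooth U (tr G A) :=
  Smooth.sum fun i _ => Smooth.sum fun j _ => (hG.smooth_inv i j).mul (hA i j)

/-- Metric traces commute with covariant differentiation, because `g⁻¹` is parallel and the trace is
cyclic. -/
lemma IsMetricOn.pd_tr (hG : IsMetricOn U G) {A : MatrixField} (hA : MSmooth U A) {u : E4}
    (hu : u ∈ U) (k : Fin 4) : pd k (tr G A) u = tr G (nab G k A) u := by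
  have h : pd k (tr G A) u = pd k (fun v => ((G v)⁻¹ * (A v)ᵀ).trace) u :=
    congrArg (fun f => pd k f u) (funext fun v => tr_eq_trace G A v)
  rw [h, pd_trace hG.isOpen (hG.smooth_inv.mul hA.transpose) hu,
    mpd_mul hG.isOpen hG.smooth_inv hA.transpose hu, hG.mpd_metric_inv hu, tr_eq_trace,
    mpd_transpose]
  simp only [nab, Matrix.transpose_sub, Matrix.transpose_mul, Matrix.transpose_transpose, mul_sub,
    neg_mul, add_mul, Matrix.trace_add, Matrix.trace_sub, Matrix.trace_neg]
  rw [show gam G k u * (G u)⁻¹ * (A u)ᵀ = gam G k u * ((G u)⁻¹ * (A u)ᵀ) from mul_assoc _ _ _,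
    Matrix.trace_mul_comm (gam G k u)]
  simp only [mul_assoc]
  ring

/-- The divergence of a bilinear form. -/
noncomputable def dv (G A : MatrixField) (u : E4) (x : Fin 4) : ℝ :=
  ∑ i, ∑ j, (G u)⁻¹ i j * nab G i A u j x

/-- Again a trace passing through `∇`. With the free index `x` frozen, `∇_i A_{jx}` is a bilinear
form in `i, j` to which `pd_tr` applies; the connection term on `x`, which that ignores, is what is
subtracted on the left. -/
lemma IsMetricOn.pd_dv (hG : IsMetricOn U G) {A : MatrixField} (hA : MSmooth U A) {u : E4}
    (hu : u ∈ U) (k x : Fin 4) :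
    pd k (fun v => dv G A v x) u - ∑ l, christoffel G u l k x * dv G A u l
      = ∑ i, ∑ j, (G u)⁻¹ i j * nab2 G k i A u j x := by
  have hX : MSmooth U (fun v => Matrix.of fun i j => nab G i A v j x) :=
    fun i j => hG.smooth_nab hA i j x
  have h := hG.pd_tr hX hu k
  have h' : pd k (fun v => dv G A v x) u = _ := h
  have e : ∑ l, christoffel G u l k x * dv G A u l
      = ∑ i, ∑ j, (G u)⁻¹ i j * ∑ l, christoffel G u l k x * nab G i A u j l := by
    simp only [dv, Finset.mul_sum]
    rw [Finset.sum_comm]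
    refine Finset.sum_congr rfl fun i _ => ?_
    rw [Finset.sum_comm]
    exact Finset.sum_congr rfl fun j _ => Finset.sum_congr rfl fun l _ => by ring
  rw [h', tr, e, ← Finset.sum_sub_distrib]
  refine Finset.sum_congr rfl fun i _ => ?_
  rw [← Finset.sum_sub_distrib]
  refine Finset.sum_congr rfl fun j _ => ?_
  rw [nab2_apply, nab_apply, nab_apply]
  simp only [Matrix.of_apply]
  ring

/-- Contraction of an index with the metric. -/
lemma IsMetricOn.sum_inv_metric (hG : IsMetricOn U G) {u : E4} (hu : u ∈ U) (F : Fin 4 → ℝ)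
    (i : Fin 4) : ∑ j, (G u)⁻¹ i j * ∑ p, G u j p * F p = F i := by
  have h : (G u)⁻¹ *ᵥ (G u *ᵥ F) = F := by
    rw [Matrix.mulVec_mulVec, hG.inv_mul hu, Matrix.one_mulVec]
  exact congrFun h i

lemma IsMetricOn.sum_inv_mul_metric (hG : IsMetricOn U G) {u : E4} (hu : u ∈ U) (i p : Fin 4) :
    ∑ j, (G u)⁻¹ i j * G u j p = if i = p then 1 else 0 := by
  rw [← Matrix.mul_apply, hG.inv_mul hu, Matrix.one_apply]

/-- The lowered curvature, `R_{ijkl}` as a matrix in `k, l`. -/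
noncomputable def rm (G : MatrixField) (i j : Fin 4) : MatrixField := fun u =>
  G u * curvM G i j u

/-- The lowered covariant derivative of the curvature. -/
noncomputable def nabRm (G : MatrixField) (m i j : Fin 4) : MatrixField := fun u =>
  G u * nabCurv G m i j u

lemma riemann_apply (G : MatrixField) (u : E4) (i j k l : Fin 4) :
    riemann G u ![i, j, k, l] = rm G i j u k l := by
  simp only [rm, Matrix.mul_apply, curvM_apply]; rfl

lemma IsMetricOn.smooth_rm (hG : IsMetricOn U G) (i j : Fin 4) : MSmooth U (rm G i j) :=
  hG.smooth.mul (hG.smooth_curvM i j)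

lemma rm_antisymm_left (G : MatrixField) (u : E4) (i j k l : Fin 4) :
    rm G j i u k l = - rm G i j u k l := by
  simp only [rm, curvM_antisymm G i j u, mul_neg, Matrix.neg_apply]

lemma IsMetricOn.rm_antisymm_right (hG : IsMetricOn U G) {u : E4} (hu : u ∈ U)
    (i j k l : Fin 4) : rm G i j u l k = - rm G i j u k l :=
  congrFun (congrFun (hG.lower_curvM_antisymm hu i j) k) l

lemma IsMetricOn.rm_cyclic (hG : IsMetricOn U G) {u : E4} (hu : u ∈ U) (i j k l : Fin 4) :
    rm G i j u k l + rm G j l u k i + rm G l i u k j = 0 := by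
  simp only [rm, Matrix.mul_apply, ← Finset.sum_add_distrib, ← mul_add, hG.curvM_cyclic hu, mul_zero,
    Finset.sum_const_zero]

/-- The classical octahedron argument: four instances of the first Bianchi identity, combined using
the antisymmetries in each pair. -/
lemma IsMetricOn.rm_pair (hG : IsMetricOn U G) {u : E4} (hu : u ∈ U) (i j k l : Fin 4) :
    rm G i j u k l = rm G k l u i j := by
  have c := hG.rm_cyclic hu
  have a := rm_antisymm_left G u
  have b := hG.rm_antisymm_right hu
  linarith [c i j k l, c j k l i, c k l i j, c l i j k, a i j k l, a i k j l, a i l j k, a j k i l,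
    a j l i k, a k l i j, b i j k l, b i k j l, b i l j k, b j k i l, b j l i k, b k l i j,
    a l i k j, b l i k j, a j i k l, b k i l j, a k i j l, a l j i k, b l j i k]

/-- The Ricci tensor as a matrix field. -/
noncomputable def ric (G : MatrixField) : MatrixField := matOf (ricci G)

lemma ric_apply (G : MatrixField) (u : E4) (a b : Fin 4) :
    ric G u a b = ∑ i, ∑ k, (G u)⁻¹ i k * rm G i a u k b := by
  simp only [← riemann_apply]; rfl

lemma IsMetricOn.ric_eq (hG : IsMetricOn U G) {u : E4} (hu : u ∈ U) (a b : Fin 4) :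
    ric G u a b = ∑ i, curvM G i a u i b := by
  rw [ric_apply]
  refine Finset.sum_congr rfl fun i _ => ?_
  simp only [rm, Matrix.mul_apply]
  exact hG.sum_inv_metric hu (fun p => curvM G i a u p b) i

lemma IsMetricOn.smooth_ric (hG : IsMetricOn U G) : MSmooth U (ric G) := fun a b =>
  Smooth.congr (f := fun v => ∑ i, curvM G i a v i b)
    (Smooth.sum fun i _ => hG.smooth_curvM i a i b) fun _ hv => hG.ric_eq hv a b

lemma IsMetricOn.ric_symm_apply (hG : IsMetricOn U G) {u : E4} (hu : u ∈ U) (a b : Fin 4) :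
    ric G u a b = ric G u b a := by
  rw [ric_apply, ric_apply, Finset.sum_comm]
  refine Finset.sum_congr rfl fun i _ => Finset.sum_congr rfl fun k _ => ?_
  rw [hG.inv_symm_apply hu, hG.rm_pair hu k a i b]

lemma IsMetricOn.ric_symm (hG : IsMetricOn U G) {u : E4} (hu : u ∈ U) : (ric G u)ᵀ = ric G u := by
  ext a b; exact hG.ric_symm_apply hu b a

lemma scalarCurv_eq (G : MatrixField) : scalarCurv G = tr G (ric G) := rfl

lemma IsMetricOn.smooth_scalar (hG : IsMetricOn U G) : Smooth U (scalarCurv G) :=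
  hG.smooth_tr hG.smooth_ric

/-! ### Contracted Bianchi identities -/

lemma nabCurv_antisymm (G : MatrixField) (m i j : Fin 4) (u : E4) :
    nabCurv G m j i u = - nabCurv G m i j u := by
  have h : mpd m (curvM G j i) u = - mpd m (curvM G i j) u := by
    rw [← mpd_neg]; congr 1; funext v; exact curvM_antisymm G i j v
  have h1 : ∀ a b, ∑ l, gam G m u l a • curvM G b l u = - ∑ l, gam G m u l a • curvM G l b u := by
    intro a b
    rw [← Finset.sum_neg_distrib]
    exact Finset.sum_congr rfl fun l _ => by rw [curvM_antisymm G l b, smul_neg]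
  simp only [nabCurv, h, h1, curvM_antisymm G i j u]
  noncomm_ring

/-- `Ric` is the contraction of an upper with a lower index of the curvature, and the connection
terms on these two indices cancel each other (`e1` below). -/
lemma IsMetricOn.nab_ric (hG : IsMetricOn U G) {u : E4} (hu : u ∈ U) (m y t : Fin 4) :
    nab G m (ric G) u y t = ∑ i, nabCurv G m i y u i t := by
  have h : pd m (fun v => ric G v y t) u = ∑ i, pd m (fun v => curvM G i y v i t) u := by
    rw [pd_congr hG.isOpen (fun v hv => hG.ric_eq hv y t) hu]
    exact pd_sum (fun i _ => (hG.smooth_curvM i y i t).diff hG.isOpen hu) m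
  rw [nab_apply, h]
  simp only [hG.ric_eq hu, nabCurv, Matrix.sub_apply, Matrix.add_apply, mpd_apply, Matrix.mul_apply,
    Matrix.sum_apply, Matrix.smul_apply, smul_eq_mul, gam_apply, Finset.sum_sub_distrib,
    Finset.sum_add_distrib, Finset.mul_sum]
  have e1 : ∑ i, ∑ l, christoffel G u l m i * curvM G l y u i t
      = ∑ i, ∑ l, christoffel G u i m l * curvM G i y u l t := Finset.sum_comm
  have e2 : ∑ l, ∑ i, christoffel G u l m y * curvM G i l u i t
      = ∑ i, ∑ l, christoffel G u l m y * curvM G i l u i t := Finset.sum_comm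
  have e3 : ∑ l, ∑ i, christoffel G u l m t * curvM G i y u i l
      = ∑ i, ∑ l, curvM G i y u i l * christoffel G u l m t := by
    rw [Finset.sum_comm]
    exact Finset.sum_congr rfl fun _ _ => Finset.sum_congr rfl fun _ _ => mul_comm _ _
  rw [e1, e2, e3]
  ring

/-- The second Bianchi identity, contracted once. -/
lemma IsMetricOn.div_curv (hG : IsMetricOn U G) {u : E4} (hu : u ∈ U) (y z x : Fin 4) :
    ∑ i, nabCurv G i y z u i x = nab G y (ric G) u z x - nab G z (ric G) u y x := by
  rw [hG.nab_ric hu, hG.nab_ric hu, ← Finset.sum_sub_distrib]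
  refine Finset.sum_congr rfl fun i _ => ?_
  have h := congrFun (congrFun (hG.nabCurv_cyclic hu i y z) i) x
  have h2 := congrFun (congrFun (nabCurv_antisymm G y i z u) i) x
  simp only [Matrix.add_apply, Matrix.zero_apply, Matrix.neg_apply] at h h2
  linarith

lemma IsMetricOn.covDeriv_riemann (hG : IsMetricOn U G) {u : E4} (hu : u ∈ U)
    (m i j k l : Fin 4) : covDeriv G (riemann G) u ![m, i, j, k, l] = nabRm G m i j u k l := by
  have h : mpd m (rm G i j) u = ((gam G m u)ᵀ * G u + G u * gam G m u) * curvM G i j u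
      + G u * mpd m (curvM G i j) u := by
    rw [← hG.mpd_metric hu]
    exact mpd_mul hG.isOpen hG.smooth (hG.smooth_curvM i j) hu m
  have h2 : nabRm G m i j u = mpd m (rm G i j) u - (gam G m u)ᵀ * rm G i j u
      - rm G i j u * gam G m u - ∑ l, gam G m u l i • rm G l j u - ∑ l, gam G m u l j • rm G i l u := by
    rw [h]
    simp only [nabRm, nabCurv, rm, mul_sub, mul_add, Matrix.mul_sum, Matrix.mul_smul]
    noncomm_ring
  rw [h2, covDeriv_four]
  simp only [riemann_apply, Matrix.sub_apply, mpd_apply, Matrix.mul_apply, Matrix.transpose_apply,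
    Matrix.sum_apply, Matrix.smul_apply, smul_eq_mul, gam_apply]
  simp only [mul_comm (rm G i j u _ _)]
  ring

lemma IsMetricOn.nabRm_pair (hG : IsMetricOn U G) {u : E4} (hu : u ∈ U) (m i j k l : Fin 4) :
    nabRm G m i j u k l = nabRm G m k l u i j := by
  rw [← hG.covDeriv_riemann hu, ← hG.covDeriv_riemann hu, covDeriv_four, covDeriv_four]
  simp only [riemann_apply]
  rw [pd_congr hG.isOpen (fun v hv => hG.rm_pair hv i j k l) hu]
  simp only [hG.rm_pair hu _ _ k l, hG.rm_pair hu i j]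
  ring

lemma IsMetricOn.sum_inv_nabRm (hG : IsMetricOn U G) {u : E4} (hu : u ∈ U) (m i j k l : Fin 4) :
    ∑ p, (G u)⁻¹ k p * nabRm G m i j u p l = nabCurv G m i j u k l := by
  simp only [nabRm, Matrix.mul_apply]
  exact hG.sum_inv_metric hu (fun p => nabCurv G m i j u p l) k

/-- Pair symmetry carries the index of the divergence into the second pair, where the
once-contracted Bianchi identity applies. -/
lemma IsMetricOn.div_rm (hG : IsMetricOn U G) {u : E4} (hu : u ∈ U) (x y z : Fin 4) :
    ∑ i, ∑ j, (G u)⁻¹ i j * nabRm G i j x u y z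
      = nab G y (ric G) u z x - nab G z (ric G) u y x := by
  rw [← hG.div_curv hu]
  refine Finset.sum_congr rfl fun i _ => ?_
  rw [← hG.sum_inv_nabRm hu]
  exact Finset.sum_congr rfl fun j _ => by rw [hG.nabRm_pair hu i j x y z]

lemma nabRm_antisymm_left (G : MatrixField) (u : E4) (m i j k l : Fin 4) :
    nabRm G m j i u k l = - nabRm G m i j u k l := by
  simp only [nabRm, nabCurv_antisymm G m i j u, mul_neg, Matrix.neg_apply]

lemma IsMetricOn.nabRm_antisymm_right (hG : IsMetricOn U G) {u : E4} (hu : u ∈ U)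
    (m i j k l : Fin 4) : nabRm G m i j u l k = - nabRm G m i j u k l := by
  rw [hG.nabRm_pair hu, nabRm_antisymm_left, hG.nabRm_pair hu]

lemma IsMetricOn.nab_symm (hG : IsMetricOn U G) {A : MatrixField} (h : ∀ v ∈ U, (A v)ᵀ = A v)
    {u : E4} (hu : u ∈ U) (m a b : Fin 4) : nab G m A u a b = nab G m A u b a := by
  rw [← hG.nab_congr h hu, nab_transpose]
  exact (congrFun (congrFun (hG.nab_congr h hu m) b) a).symm.trans
    (by rw [nab_transpose])

lemma IsMetricOn.nab_ric_eq_contract (hG : IsMetricOn U G) {u : E4} (hu : u ∈ U) (i y p : Fin 4) :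
    nab G i (ric G) u y p = ∑ m, ∑ t, (G u)⁻¹ m t * nabRm G i m y u t p := by
  rw [hG.nab_ric hu]
  exact Finset.sum_congr rfl fun m _ => (hG.sum_inv_nabRm hu i m y m p).symm

/-- Prepares the second contraction of the Bianchi identity: the divergence of `Ric` becomes a trace
of the divergence of the curvature, and `div_curv` can be inserted. -/
lemma IsMetricOn.dv_ric_eq_contract (hG : IsMetricOn U G) {u : E4} (hu : u ∈ U) (y : Fin 4) :
    dv G (ric G) u y
      = ∑ m, ∑ t, (G u)⁻¹ m t * ∑ i, nabCurv G i y m u i t := by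
  have e : ∀ m t, (G u)⁻¹ m t * ∑ i, nabCurv G i y m u i t
      = ∑ i, ∑ p, (G u)⁻¹ i p * ((G u)⁻¹ m t * nabRm G i m y u t p) := by
    intro m t
    rw [Finset.mul_sum]
    refine Finset.sum_congr rfl fun i _ => ?_
    rw [← hG.sum_inv_nabRm hu, Finset.mul_sum]
    refine Finset.sum_congr rfl fun p _ => ?_
    rw [nabRm_antisymm_left G u i m y, hG.nabRm_antisymm_right hu i m y t p]
    ring
  simp only [e]
  have c1 : ∀ m, ∑ t, ∑ i, ∑ p, (G u)⁻¹ i p * ((G u)⁻¹ m t * nabRm G i m y u t p)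
      = ∑ i, ∑ p, ∑ t, (G u)⁻¹ i p * ((G u)⁻¹ m t * nabRm G i m y u t p) := fun m => by
    rw [Finset.sum_comm]
    exact Finset.sum_congr rfl fun i _ => Finset.sum_comm
  simp only [c1]
  rw [Finset.sum_comm, dv]
  refine Finset.sum_congr rfl fun i _ => ?_
  rw [Finset.sum_comm]
  refine Finset.sum_congr rfl fun p _ => ?_
  rw [hG.nab_symm (fun v hv => hG.ric_symm hv) hu, hG.nab_ric_eq_contract hu]
  simp only [Finset.mul_sum]

/-- `div Ric = ds / 2`. -/
lemma IsMetricOn.dv_ric (hG : IsMetricOn U G) {u : E4} (hu : u ∈ U) (y : Fin 4) :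
    dv G (ric G) u y = (1 / 2) * pd y (scalarCurv G) u := by
  have h1 : pd y (scalarCurv G) u = tr G (nab G y (ric G)) u := hG.pd_tr hG.smooth_ric hu y
  have h2 := hG.dv_ric_eq_contract hu y
  -- So `div Ric = tr ∇_y Ric - div Ric`, which produces the factor `1/2`.
  have h3 : ∑ m, ∑ t, (G u)⁻¹ m t * ∑ i, nabCurv G i y m u i t
      = tr G (nab G y (ric G)) u - dv G (ric G) u y := by
    simp only [tr, dv, ← Finset.sum_sub_distrib, ← mul_sub]
    refine Finset.sum_congr rfl fun m _ => Finset.sum_congr rfl fun t _ => ?_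
    rw [hG.div_curv hu, hG.nab_symm (fun v hv => hG.ric_symm hv) hu m y t]
  linarith

/-! ### The Weyl tensor and the Bach tensor -/

/-- The normalized Ricci tensor as a matrix field. -/
noncomputable def hM (G : MatrixField) : MatrixField := fun u =>
  (1 / 2 : ℝ) • (ric G u - (scalarCurv G u / 6) • G u)

lemma IsMetricOn.smooth_hM (hG : IsMetricOn U G) : MSmooth U (hM G) := fun a b =>
  (Smooth.const U (1 / 2)).mul ((hG.smooth_ric a b).sub
    ((hG.smooth_scalar.mul (Smooth.const U 6⁻¹)).mul (hG.smooth a b)))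

lemma IsMetricOn.hM_symm (hG : IsMetricOn U G) {u : E4} (hu : u ∈ U) : (hM G u)ᵀ = hM G u := by
  simp [hM, Matrix.transpose_smul, Matrix.transpose_sub, hG.symm u hu, hG.ric_symm hu]

lemma IsMetricOn.nab_hM (hG : IsMetricOn U G) {u : E4} (hu : u ∈ U) (i : Fin 4) :
    nab G i (hM G) u = (1 / 2 : ℝ) • (nab G i (ric G) u - (pd i (scalarCurv G) u / 6) • G u) := by
  have hs : Smooth U (fun v => scalarCurv G v / 6) := by
    simpa [div_eq_mul_inv] using hG.smooth_scalar.mul (Smooth.const U 6⁻¹)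
  have h1 : MSmooth U (fun v => (scalarCurv G v / 6) • G v) := MSmooth.smul hs hG.smooth
  have h2 := hG.nab_smul (hG.smooth_ric.sub h1) (Smooth.const U (1 / 2 : ℝ)) hu i
  have h3 : pd i (fun v => scalarCurv G v / 6) u = pd i (scalarCurv G) u / 6 := by
    have := pd_const_mul (hG.smooth_scalar.diff hG.isOpen hu) 6⁻¹ i
    simpa [div_eq_inv_mul] using this
  rw [hG.nab_sub hG.smooth_ric h1 hu, hG.nab_smul hG.smooth hs hu, h3, hG.nab_metric hu, pd_const,
    smul_zero, zero_smul, zero_add, add_zero] at h2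
  exact h2

lemma weyl_apply (G : MatrixField) (u : E4) (a b c d : Fin 4) :
    weyl G u ![a, b, c, d] = rm G a b u c d
      - (G u a c * hM G u b d + G u b d * hM G u a c - G u a d * hM G u b c - G u b c * hM G u a d) := by
  rw [← riemann_apply]; rfl

/-- Metric compatibility replaces `∂g` by Christoffel terms, so that in the derivative of the Weyl
tensor these can cancel against the connection terms of `covDeriv`. -/
lemma IsMetricOn.pd_metric_mul (hG : IsMetricOn U G) {A : MatrixField} (hA : MSmooth U A) {u : E4}
    (hu : u ∈ U) (m a b c d : Fin 4) :
    pd m (fun v => G v a b * A v c d) u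
      = (∑ l, christoffel G u l m a * G u l b + ∑ l, christoffel G u l m b * G u a l) * A u c d
        + G u a b * (nab G m A u c d + (∑ l, christoffel G u l m c * A u l d
          + ∑ l, christoffel G u l m d * A u c l)) := by
  have h := congrFun (congrFun (hG.nab_metric hu m) a) b
  rw [nab_apply, Matrix.zero_apply, sub_eq_zero] at h
  rw [pd_mul ((hG.smooth a b).diff hG.isOpen hu) ((hA c d).diff hG.isOpen hu), h, nab_apply]
  ring

/-- Since `g` is parallel, differentiating the Kulkarni-Nomizu product only differentiates `h`. -/
lemma IsMetricOn.covDeriv_weyl (hG : IsMetricOn U G) {u : E4} (hu : u ∈ U) (m a b c d : Fin 4) :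
    covDeriv G (weyl G) u ![m, a, b, c, d] = nabRm G m a b u c d
      - (G u a c * nab G m (hM G) u b d + G u b d * nab G m (hM G) u a c
        - G u a d * nab G m (hM G) u b c - G u b c * nab G m (hM G) u a d) := by
  have hp : ∀ a b c d, Smooth U (fun v => G v a b * hM G v c d) := fun a b c d =>
    (hG.smooth a b).mul (hG.smooth_hM c d)
  have hr := (hG.smooth_rm a b c d).diff hG.isOpen hu
  have q1 := (hp a c b d).add (hp b d a c)
  have q2 := q1.sub (hp a d b c)
  have q3 := q2.sub (hp b c a d)
  have o := hG.isOpen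
  have e : pd m (fun v => weyl G v ![a, b, c, d]) u = pd m (fun v => rm G a b v c d) u
      - (pd m (fun v => G v a c * hM G v b d) u + pd m (fun v => G v b d * hM G v a c) u
        - pd m (fun v => G v a d * hM G v b c) u - pd m (fun v => G v b c * hM G v a d) u) := by
    simp only [weyl_apply]
    rw [pd_sub hr (q3.diff o hu), pd_sub (q2.diff o hu) ((hp b c a d).diff o hu),
      pd_sub (q1.diff o hu) ((hp a d b c).diff o hu),
      pd_add ((hp a c b d).diff o hu) ((hp b d a c).diff o hu)]
  have hR := hG.covDeriv_riemann hu m a b c d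
  rw [covDeriv_four] at hR
  simp only [riemann_apply] at hR
  rw [covDeriv_four, e, ← hR]
  simp only [hG.pd_metric_mul hG.smooth_hM hu, weyl_apply, mul_sub, mul_add, Finset.sum_sub_distrib,
    Finset.sum_add_distrib]
  have f1 : ∀ (F : Fin 4 → ℝ) (H : Fin 4 → ℝ) (c : ℝ), ∑ l, F l * (H l * c) = (∑ l, F l * H l) * c :=
    fun F H c => by rw [Finset.sum_mul]; exact Finset.sum_congr rfl fun _ _ => by ring
  have f2 : ∀ (F : Fin 4 → ℝ) (H : Fin 4 → ℝ) (c : ℝ), ∑ l, F l * (c * H l) = c * (∑ l, F l * H l) :=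
    fun F H c => by rw [Finset.mul_sum]; exact Finset.sum_congr rfl fun _ _ => by ring
  simp only [f1, f2]
  ring

/-- `δW` is minus the Cotton tensor. -/
lemma IsMetricOn.dv_hM (hG : IsMetricOn U G) {u : E4} (hu : u ∈ U) (y : Fin 4) :
    dv G (hM G) u y = (1 / 6) * pd y (scalarCurv G) u := by
  have e : dv G (hM G) u y = (1 / 2) * (dv G (ric G) u y
      - (1 / 6) * ∑ i, ∑ j, (G u)⁻¹ i j * (pd i (scalarCurv G) u * G u j y)) := by
    simp only [dv, hG.nab_hM hu, Matrix.smul_apply, Matrix.sub_apply, smul_eq_mul, Finset.mul_sum,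
      ← Finset.sum_sub_distrib]
    exact Finset.sum_congr rfl fun i _ => Finset.sum_congr rfl fun j _ => by ring
  have e2 : ∑ i, ∑ j, (G u)⁻¹ i j * (pd i (scalarCurv G) u * G u j y) = pd y (scalarCurv G) u := by
    have : ∀ i, ∑ j, (G u)⁻¹ i j * (pd i (scalarCurv G) u * G u j y)
        = pd i (scalarCurv G) u * if i = y then 1 else 0 := fun i => by
      rw [← hG.sum_inv_mul_metric hu, Finset.mul_sum]
      exact Finset.sum_congr rfl fun j _ => by ring
    simp [this]
  rw [e, e2, hG.dv_ric hu]; ring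

/-- Because `Ric = 2h + (s/6) g`, the divergence of the curvature contains the antisymmetrised `∇h`
twice, together with terms in `ds`. The Kulkarni-Nomizu part removes one copy, and `div h = ds/6`
cancels the terms in `ds`. -/
lemma IsMetricOn.codiffWeyl_apply (hG : IsMetricOn U G) {u : E4} (hu : u ∈ U) (x y z : Fin 4) :
    codiffWeyl G u ![x, y, z] = nab G z (hM G) u x y - nab G y (hM G) u x z := by
  have c1 : ∀ (F : Fin 4 → ℝ) (y : Fin 4),
      ∑ i, ∑ j, (G u)⁻¹ i j * (G u j y * F i) = F y := fun F y => by
    have : ∀ i, ∑ j, (G u)⁻¹ i j * (G u j y * F i) = F i * (if i = y then 1 else 0) := fun i => by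
      rw [← hG.sum_inv_mul_metric hu, Finset.mul_sum]
      exact Finset.sum_congr rfl fun j _ => by ring
    simp [this]
  have c2 : ∀ (c : ℝ) (y : Fin 4),
      ∑ i, ∑ j, (G u)⁻¹ i j * (c * nab G i (hM G) u j y) = c * dv G (hM G) u y := fun c y => by
    simp only [dv, Finset.mul_sum]
    exact Finset.sum_congr rfl fun i _ => Finset.sum_congr rfl fun j _ => by ring
  have hW : codiffWeyl G u ![x, y, z]
      = - ∑ i, ∑ j, (G u)⁻¹ i j * covDeriv G (weyl G) u ![i, j, x, y, z] := rfl
  rw [hW]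
  simp only [hG.covDeriv_weyl hu, mul_sub, mul_add, Finset.sum_sub_distrib, Finset.sum_add_distrib,
    c1 (fun i => nab G i (hM G) u _ _), c2, hG.dv_hM hu, hG.div_rm hu]
  have s1 := hG.nab_symm (fun v hv => hG.hM_symm hv) hu y x z
  have s2 := hG.nab_symm (fun v hv => hG.hM_symm hv) hu z x y
  rw [s1, s2]
  simp only [hG.nab_hM hu, Matrix.smul_apply, Matrix.sub_apply, smul_eq_mul]
  rw [hG.symm_apply hu x z, hG.symm_apply hu x y, hG.nab_symm (fun v hv => hG.ric_symm hv) hu]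
  ring

lemma IsMetricOn.covDeriv_codiffWeyl (hG : IsMetricOn U G) {u : E4} (hu : u ∈ U)
    (i x y z : Fin 4) : covDeriv G (codiffWeyl G) u ![i, x, y, z]
      = nab2 G i z (hM G) u x y - nab2 G i y (hM G) u x z := by
  have hd : ∀ y a b, DifferentiableAt ℝ (fun v => nab G y (hM G) v a b) u := fun y a b =>
    (hG.smooth_nab hG.smooth_hM y a b).diff hG.isOpen hu
  rw [covDeriv_three, pd_congr hG.isOpen (fun v hv => hG.codiffWeyl_apply hv x y z) hu,
    pd_sub (hd z x y) (hd y x z)]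
  simp only [hG.codiffWeyl_apply hu, nab2_apply, nab_apply G i, mul_sub, Finset.sum_sub_distrib]
  ring

lemma IsMetricOn.bach_apply (hG : IsMetricOn U G) {u : E4} (hu : u ∈ U) (x y : Fin 4) :
    bach G u ![x, y] = (∑ i, ∑ j, (G u)⁻¹ i j
        * (nab2 G i y (hM G) u x j - nab2 G i j (hM G) u x y))
      + ∑ i, ∑ j, ∑ k, ∑ l, (G u)⁻¹ i j * (G u)⁻¹ k l * hM G u j l * weyl G u ![x, i, k, y] := by
  simp only [← hG.covDeriv_codiffWeyl hu]
  rfl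

end

/-! ### Rough Laplacians, closed two-forms -/

/-- The trace `∑ g^{ij} ∇²_{i,j} A` of the second covariant derivative. -/
noncomputable def lap (G A : MatrixField) : MatrixField := fun u =>
  ∑ i, ∑ j, (G u)⁻¹ i j • nab2 G i j A u

lemma lap_apply (G A : MatrixField) (u : E4) (a b : Fin 4) :
    lap G A u a b = ∑ i, ∑ j, (G u)⁻¹ i j * nab2 G i j A u a b := by
  simp only [lap, Matrix.sum_apply, Matrix.smul_apply, smul_eq_mul]

/-- The action `T ↦ ∑ R(X, e_i, Y, e_k) T(e_i, e_k)` of the curvature on bilinear forms. -/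
noncomputable def curvAct (G A : MatrixField) : MatrixField := fun u =>
  Matrix.of fun x y => ∑ i, ∑ k, rm G x i u y k * ((G u)⁻¹ * A u * (G u)⁻¹) i k

/-- The commutator term `∑ g^{im} ([∇²_{y,i} - ∇²_{i,y}] A)_{m x}`. -/
noncomputable def commTerm (G A : MatrixField) : MatrixField := fun u =>
  Matrix.of fun y x => ∑ i, ∑ m, (G u)⁻¹ i m *
    ((curvM G i y u)ᵀ * A u + A u * curvM G i y u) m x

/-- The covariant derivative of the divergence. -/
noncomputable def nabDv (G A : MatrixField) : MatrixField := fun u =>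
  Matrix.of fun k x => pd k (fun v => dv G A v x) u - ∑ l, christoffel G u l k x * dv G A u l

section

variable {U : Set E4} {G : MatrixField}

lemma IsMetricOn.curvM_eq (hG : IsMetricOn U G) {u : E4} (hu : u ∈ U) (i j : Fin 4) :
    curvM G i j u = (G u)⁻¹ * rm G i j u := by
  rw [rm, ← mul_assoc, hG.inv_mul hu, one_mul]

lemma IsMetricOn.curvM_transpose (hG : IsMetricOn U G) {u : E4} (hu : u ∈ U) (i j : Fin 4) :
    (curvM G i j u)ᵀ = - (rm G i j u * (G u)⁻¹) := by
  have h : (rm G i j u)ᵀ = - rm G i j u := hG.lower_curvM_antisymm hu i j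
  rw [hG.curvM_eq hu, Matrix.transpose_mul, hG.inv_symm hu, h, neg_mul]

/-- The curvature acts on each of the two indices of `A`: on the contracted index this produces
`Ric`, on the free one the full curvature action. -/
lemma IsMetricOn.commTerm_eq (hG : IsMetricOn U G) (A : MatrixField) {u : E4} (hu : u ∈ U) :
    commTerm G A u = curvAct G A u - comp G (ric G) A u := by
  ext y x
  have h1 : ∑ i, ∑ m, (G u)⁻¹ i m * (A u * curvM G i y u) m x = curvAct G A u y x := by
    simp only [curvAct, Matrix.of_apply]
    refine Finset.sum_congr rfl fun i _ => ?_
    have e : ∑ m, (G u)⁻¹ i m * (A u * curvM G i y u) m x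
        = ((G u)⁻¹ * A u * (G u)⁻¹ * rm G i y u) i x := by
      rw [hG.curvM_eq hu, ← Matrix.mul_apply]; simp only [mul_assoc]
    rw [e, Matrix.mul_apply]
    refine Finset.sum_congr rfl fun k _ => ?_
    rw [rm_antisymm_left G u y i, hG.rm_antisymm_right hu y i x k]
    ring
  have h2 : ∑ i, ∑ m, (G u)⁻¹ i m * ((curvM G i y u)ᵀ * A u) m x = - comp G (ric G) A u y x := by
    have e : ∀ i, ∑ m, (G u)⁻¹ i m * ((curvM G i y u)ᵀ * A u) m x
        = - ∑ k, (∑ m, (G u)⁻¹ i m * rm G i y u m k) * ((G u)⁻¹ * A u) k x := by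
      intro i
      have : (G u)⁻¹ * ((curvM G i y u)ᵀ * A u) = - ((G u)⁻¹ * rm G i y u * ((G u)⁻¹ * A u)) := by
        rw [hG.curvM_transpose hu]; noncomm_ring
      rw [← Matrix.mul_apply, this]
      simp only [Matrix.neg_apply, Matrix.mul_apply]
    simp only [e, Finset.sum_neg_distrib]
    rw [comp, mul_assoc, Matrix.mul_apply, Finset.sum_comm]
    simp only [ric_apply, Finset.sum_mul]
  simp only [commTerm, Matrix.of_apply, Matrix.add_apply, mul_add, Finset.sum_add_distrib, h1, h2,
    Matrix.sub_apply]
  ring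

/-- In an orthonormal frame this makes the Ricci tensor equal to `actAlg R 1`, so that all curvature
terms become expressions in one algebraic curvature tensor. -/
lemma IsMetricOn.curvAct_metric (hG : IsMetricOn U G) {u : E4} (hu : u ∈ U) :
    curvAct G G u = ric G u := by
  ext x y
  rw [ric_apply]
  simp only [curvAct, Matrix.of_apply, hG.inv_mul hu, one_mul]
  refine Finset.sum_congr rfl fun i _ => Finset.sum_congr rfl fun k _ => ?_
  rw [rm_antisymm_left G u i x, hG.rm_antisymm_right hu i x k y]
  ring

/-- Moving `∇_y` outside the divergence costs one curvature commutator, by the Ricci identity. -/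
lemma IsMetricOn.sum_nab2_swap (hG : IsMetricOn U G) {A : MatrixField} (hA : MSmooth U A)
    {u : E4} (hu : u ∈ U) (y x : Fin 4) :
    ∑ i, ∑ j, (G u)⁻¹ i j * nab2 G i y A u j x = nabDv G A u y x - commTerm G A u y x := by
  have h1 : nabDv G A u y x = _ := hG.pd_dv hA hu y x
  rw [h1]
  simp only [commTerm, Matrix.of_apply, ← Finset.sum_sub_distrib, ← mul_sub]
  refine Finset.sum_congr rfl fun i _ => Finset.sum_congr rfl fun j _ => ?_
  have h := congrFun (congrFun (hG.nab2_comm hA hu i y) j) x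
  simp only [Matrix.sub_apply, Matrix.neg_apply] at h
  rw [← sub_eq_zero]
  linear_combination (G u)⁻¹ i j * h

/-- The cyclic sum of the covariant derivative of a two-form is its exterior derivative. -/
lemma IsMetricOn.cyclic_nab (hG : IsMetricOn U G) {A : MatrixField} {u : E4} (hu : u ∈ U)
    (hA : (A u)ᵀ = - A u) (i j k : Fin 4) :
    nab G i A u j k + nab G j A u k i + nab G k A u i j
      = pd i (fun v => A v j k) u + pd j (fun v => A v k i) u + pd k (fun v => A v i j) u := by
  have ha : ∀ a b, A u a b = - A u b a := fun a b => congrFun (congrFun hA b) a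
  have e : ∀ a b c, ∑ l, christoffel G u l a b * A u l c = - ∑ l, christoffel G u l b a * A u c l := by
    intro a b c
    rw [← Finset.sum_neg_distrib]
    exact Finset.sum_congr rfl fun l _ => by rw [hG.christoffel_symm hu l a b, ha l c]; ring
  simp only [nab_apply, e]
  ring

/-- Weitzenböck formula for a closed two-form. -/
lemma IsMetricOn.lap_closed (hG : IsMetricOn U G) {A : MatrixField} (hA : MSmooth U A)
    (hanti : ∀ v ∈ U, (A v)ᵀ = - A v)
    (hcl : ∀ v ∈ U, ∀ i j k, nab G i A v j k + nab G j A v k i + nab G k A v i j = 0)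
    {u : E4} (hu : u ∈ U) :
    lap G A u = nabDv G A u - (nabDv G A u)ᵀ - commTerm G A u + (commTerm G A u)ᵀ := by
  have hd : ∀ i a b, DifferentiableAt ℝ (fun v => nab G i A v a b) u := fun i a b =>
    (hG.smooth_nab hA i a b).diff hG.isOpen hu
  -- Closedness is a tensor equation on the open set `U`, so it may be differentiated covariantly.
  have h2 : ∀ m i j k, nab2 G m i A u j k + nab2 G m j A u k i + nab2 G m k A u i j = 0 := by
    intro m i j k
    have hp := pd_congr hG.isOpen (fun v hv => hcl v hv i j k) hu m
    have q := ((hG.smooth_nab hA i j k).add (hG.smooth_nab hA j k i)).diff hG.isOpen hu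
    rw [pd_const, pd_add q (hd k i j), pd_add (hd i j k) (hd j k i)] at hp
    have e : ∀ i k (F : Fin 4 → ℝ), ∑ l, F l * nab G i A u l k + (∑ l, F l * nab G l A u k i
        + ∑ l, F l * nab G k A u i l) = 0 := by
      intro i k F
      simp only [← Finset.sum_add_distrib, ← mul_add]
      exact Finset.sum_eq_zero fun l _ => by linear_combination F l * hcl u hu i l k
    have e1 := e i k (fun l => christoffel G u l m j)
    have e2 := e j i (fun l => christoffel G u l m k)
    have e3 := e k j (fun l => christoffel G u l m i)
    simp only [nab2_apply, nab_apply G m]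
    linarith
  have ha1 : ∀ v ∈ U, ∀ i a b, nab G i A v a b = - nab G i A v b a := by
    intro v hv i a b
    have h1 := hG.nab_congr hanti hv i
    rw [nab_transpose] at h1
    have h3 : nab G i (fun v => - A v) v = - nab G i A v := by
      simp only [nab, mpd_neg]; noncomm_ring
    rw [h3] at h1
    exact congrFun (congrFun h1 b) a
  have ha2 : ∀ i j a b, nab2 G i j A u a b = - nab2 G i j A u b a := by
    intro i j a b
    have hp := pd_congr hG.isOpen (fun v hv => ha1 v hv j a b) hu i
    rw [pd_neg] at hp
    simp only [nab2_apply, nab_apply G i]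
    rw [hp]
    have e1 : ∀ (F : Fin 4 → ℝ) a, ∑ l, F l * nab G j A u l a = - ∑ l, F l * nab G j A u a l := by
      intro F a
      rw [← Finset.sum_neg_distrib]
      exact Finset.sum_congr rfl fun l _ => by rw [ha1 u hu j l a]; ring
    have e2 : ∑ l, christoffel G u l i j * nab G l A u a b
        = - ∑ l, christoffel G u l i j * nab G l A u b a := by
      rw [← Finset.sum_neg_distrib]
      exact Finset.sum_congr rfl fun l _ => by rw [ha1 u hu l a b]; ring
    rw [e1, e1, e2]
    ring
  ext j k
  have s1 := hG.sum_nab2_swap hA hu j k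
  have s2 := hG.sum_nab2_swap hA hu k j
  simp only [Matrix.add_apply, Matrix.sub_apply, Matrix.transpose_apply]
  -- Closedness gives `∇_m A_{jk} = ∇_j A_{mk} - ∇_k A_{mj}`. Inside the trace over `i, m` the
  -- Laplacian thus becomes a difference of two terms in which a derivative has to be moved past a
  -- divergence.
  have : lap G A u j k = ∑ i, ∑ m, (G u)⁻¹ i m * nab2 G i j A u m k
      - ∑ i, ∑ m, (G u)⁻¹ i m * nab2 G i k A u m j := by
    simp only [lap_apply, ← Finset.sum_sub_distrib, ← mul_sub]
    refine Finset.sum_congr rfl fun i _ => Finset.sum_congr rfl fun m _ => ?_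
    have := h2 i m j k
    rw [ha2 i j k m] at this
    congr 1
    linarith
  rw [this, s1, s2]
  ring

lemma pd_div_const {f : E4 → ℝ} {u : E4} (hf : DifferentiableAt ℝ f u) (c : ℝ) (i : Fin 4) :
    pd i (fun v => f v / c) u = pd i f u / c := by
  simpa [div_eq_inv_mul] using pd_const_mul hf c⁻¹ i

lemma IsMetricOn.nab2_smul_metric (hG : IsMetricOn U G) {f : E4 → ℝ} (hf : Smooth U f) {u : E4}
    (hu : u ∈ U) (i j : Fin 4) :
    nab2 G i j (fun v => f v • G v) u = hessM G f u i j • G u := by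
  have h1 : ∀ v ∈ U, ∀ j, nab G j (fun v => f v • G v) v = pd j f v • G v := fun v hv j => by
    rw [hG.nab_smul hG.smooth hf hv, hG.nab_metric hv, smul_zero, add_zero]
  rw [nab2, hG.nab_congr (fun v hv => h1 v hv j) hu,
    hG.nab_smul hG.smooth (hf.pd hG.isOpen j) hu, hG.nab_metric hu, smul_zero, add_zero]
  simp only [h1 u hu, hessM, Matrix.of_apply, sub_smul, Finset.sum_smul, smul_smul, gam_apply]

lemma IsMetricOn.nab2_add (hG : IsMetricOn U G) {A B : MatrixField} (hA : MSmooth U A)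
    (hB : MSmooth U B) {u : E4} (hu : u ∈ U) (i j : Fin 4) :
    nab2 G i j (fun v => A v + B v) u = nab2 G i j A u + nab2 G i j B u := by
  rw [nab2, hG.nab_congr (fun v hv => hG.nab_add hA hB hv j) hu,
    hG.nab_add (hG.smooth_nab hA j) (hG.smooth_nab hB j) hu]
  simp only [hG.nab_add hA hB hu, nab2, smul_add, Finset.sum_add_distrib]
  abel

lemma IsMetricOn.nab2_const_smul (hG : IsMetricOn U G) {A : MatrixField} (hA : MSmooth U A)
    (c : ℝ) {u : E4} (hu : u ∈ U) (i j : Fin 4) :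
    nab2 G i j (fun v => c • A v) u = c • nab2 G i j A u := by
  have h : ∀ {B : MatrixField}, MSmooth U B → ∀ v ∈ U, ∀ k, nab G k (fun v => c • B v) v
      = c • nab G k B v := fun hB v hv k => by
    rw [hG.nab_smul hB (Smooth.const U c) hv, pd_const, zero_smul, zero_add]
  rw [nab2, hG.nab_congr (fun v hv => h hA v hv j) hu, h (hG.smooth_nab hA j) u hu]
  simp only [h hA u hu, nab2, smul_sub, Finset.smul_sum]
  congr 1
  exact Finset.sum_congr rfl fun l _ => smul_comm _ _ _

/-- Here `h = Ric/2 - (s/12) g` with `g` parallel; the sign in front of the scalar Laplacian changes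
because `Δ` is minus the trace of the Hessian. -/
lemma IsMetricOn.lap_hM (hG : IsMetricOn U G) {u : E4} (hu : u ∈ U) :
    lap G (hM G) u = (1 / 2 : ℝ) • lap G (ric G) u
      + (laplacian G (scalarCurv G) u / 12) • G u := by
  have hs : Smooth U (fun v => -scalarCurv G v / 12) := by
    simpa [div_eq_mul_inv] using hG.smooth_scalar.neg.mul (Smooth.const U 12⁻¹)
  have e : ∀ v ∈ U, hM G v = (1 / 2 : ℝ) • ric G v + (-scalarCurv G v / 12) • G v := by
    intro v _
    rw [hM, smul_sub, smul_smul, sub_eq_add_neg, ← neg_smul]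
    congr 2; ring
  have hh : ∀ i j, hessM G (fun v => -scalarCurv G v / 12) u i j
      = - hessM G (scalarCurv G) u i j / 12 := by
    intro i j
    have h1 : ∀ v ∈ U, ∀ k, pd k (fun v => -scalarCurv G v / 12) v = -pd k (scalarCurv G) v / 12 :=
      fun v hv k => by
        rw [pd_div_const (hG.smooth_scalar.neg.diff hG.isOpen hv), pd_neg]
    have h2 : pd i (fun v => -pd j (scalarCurv G) v / 12) u = - pd i (pd j (scalarCurv G)) u / 12 := by
      rw [pd_div_const ((hG.smooth_scalar.pd hG.isOpen j).neg.diff hG.isOpen hu), pd_neg]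
    simp only [hessM, Matrix.of_apply]
    rw [pd_congr hG.isOpen (fun v hv => h1 v hv j) hu, h2]
    simp only [h1 u hu]
    have : ∑ l, christoffel G u l i j * (-pd l (scalarCurv G) u / 12)
        = - (∑ l, christoffel G u l i j * pd l (scalarCurv G) u) / 12 := by
      rw [neg_div, Finset.sum_div, ← Finset.sum_neg_distrib]
      exact Finset.sum_congr rfl fun l _ => by ring
    rw [this]; ring
  have e2 : ∀ i j, nab2 G i j (hM G) u = (1 / 2 : ℝ) • nab2 G i j (ric G) u
      + (- hessM G (scalarCurv G) u i j / 12) • G u := by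
    intro i j
    rw [hG.nab2_congr e hu,
      hG.nab2_add (MSmooth.smul (Smooth.const U _) hG.smooth_ric) (MSmooth.smul hs hG.smooth) hu,
      hG.nab2_const_smul hG.smooth_ric _ hu, hG.nab2_smul_metric hs hu, hh]
  have e3 : laplacian G (scalarCurv G) u
      = - ∑ i, ∑ j, (G u)⁻¹ i j * hessM G (scalarCurv G) u i j := by
    simp only [laplacian, hess_apply]
  rw [e3]
  simp only [lap, e2, smul_add, smul_smul, Finset.sum_add_distrib, Finset.smul_sum]
  congr 1
  · exact Finset.sum_congr rfl fun i _ => Finset.sum_congr rfl fun j _ => by rw [mul_comm]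
  · simp only [← Finset.sum_smul]
    congr 1
    rw [neg_div, Finset.sum_div, ← Finset.sum_neg_distrib]
    refine Finset.sum_congr rfl fun i _ => ?_
    rw [Finset.sum_div, ← Finset.sum_neg_distrib]
    exact Finset.sum_congr rfl fun j _ => by ring

end

/-! ### Frames at a point -/

/-- The components `Ω_{ab}` of the fundamental form in an adapted orthonormal frame. -/
def om0 : Matrix (Fin 4) (Fin 4) ℝ := !![0, 1, 0, 0; -1, 0, 0, 0; 0, 0, 0, 1; 0, 0, -1, 0]

/-- An adapted orthonormal frame: the columns `P_k` satisfy `J P_0 = P_1`, `J P_2 = P_3`. -/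
lemma exists_adapted_frame (g J : Matrix (Fin 4) (Fin 4) ℝ) (hs : gᵀ = g)
    (hpos : ∀ x : Fin 4 → ℝ, x ≠ 0 → 0 < x ⬝ᵥ g *ᵥ x)
    (hJ : J * J = -1) (ho : Jᵀ * g * J = g) :
    ∃ P : Matrix (Fin 4) (Fin 4) ℝ, Pᵀ * g * P = 1 ∧ J * P = P * om0ᵀ := by
  have bsymm : ∀ x y : Fin 4 → ℝ, x ⬝ᵥ g *ᵥ y = y ⬝ᵥ g *ᵥ x := fun x y => by
    rw [Matrix.dotProduct_mulVec, ← Matrix.mulVec_transpose, hs, dotProduct_comm]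
  have bJ : ∀ x y : Fin 4 → ℝ, (J *ᵥ x) ⬝ᵥ g *ᵥ (J *ᵥ y) = x ⬝ᵥ g *ᵥ y := fun x y => by
    conv_rhs => rw [← ho]
    rw [← Matrix.mulVec_mulVec, ← Matrix.mulVec_mulVec, Matrix.dotProduct_mulVec x,
      Matrix.vecMul_transpose]
  have hJJ : ∀ x : Fin 4 → ℝ, J *ᵥ (J *ᵥ x) = -x := fun x => by
    rw [Matrix.mulVec_mulVec, hJ, Matrix.neg_mulVec, Matrix.one_mulVec]
  have bJ0 : ∀ x : Fin 4 → ℝ, x ⬝ᵥ g *ᵥ (J *ᵥ x) = 0 := fun x => by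
    have h := bJ x (J *ᵥ x)
    rw [hJJ, Matrix.mulVec_neg, dotProduct_neg, bsymm] at h
    linarith
  have bJ1 : ∀ x y : Fin 4 → ℝ, (J *ᵥ x) ⬝ᵥ g *ᵥ y = - (x ⬝ᵥ g *ᵥ (J *ᵥ y)) := fun x y => by
    have h := bJ x (J *ᵥ y)
    rw [hJJ, Matrix.mulVec_neg, dotProduct_neg] at h
    linarith
  have norm1 : ∀ x : Fin 4 → ℝ, x ≠ 0 → ∃ c : ℝ, (c • x) ⬝ᵥ g *ᵥ (c • x) = 1 := fun x hx => by
    refine ⟨(Real.sqrt (x ⬝ᵥ g *ᵥ x))⁻¹, ?_⟩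
    have h := hpos x hx
    rw [Matrix.mulVec_smul, smul_dotProduct, dotProduct_smul, smul_eq_mul, smul_eq_mul, ← mul_assoc,
      ← mul_inv, Real.mul_self_sqrt h.le, inv_mul_cancel₀ h.ne']
  obtain ⟨v, hc⟩ : ∃ v : Fin 4 → ℝ, v ⬝ᵥ g *ᵥ v = 1 := by
    obtain ⟨c, hc⟩ := norm1 (Pi.single 0 1) (by simp)
    exact ⟨_, hc⟩
  obtain ⟨w, hw0, hw1, hw2⟩ : ∃ w : Fin 4 → ℝ, w ≠ 0 ∧ v ⬝ᵥ g *ᵥ w = 0 ∧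
      (J *ᵥ v) ⬝ᵥ g *ᵥ w = 0 := by
    -- Orthogonality to `v` and `J v` is two linear conditions on a four-dimensional space.
    let f : (Fin 4 → ℝ) →ₗ[ℝ] (Fin 2 → ℝ) :=
      (Matrix.of ![v ᵥ* g, (J *ᵥ v) ᵥ* g]).mulVecLin
    have hf : LinearMap.ker f ≠ ⊥ := LinearMap.ker_ne_bot_of_finrank_lt (by simp)
    obtain ⟨w, hw, hw0⟩ := (Submodule.ne_bot_iff _).1 hf
    refine ⟨w, hw0, ?_, ?_⟩
    · rw [Matrix.dotProduct_mulVec]; exact congrFun hw 0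
    · rw [Matrix.dotProduct_mulVec]; exact congrFun hw 1
  obtain ⟨z, hd, vz, jvz⟩ : ∃ z : Fin 4 → ℝ, z ⬝ᵥ g *ᵥ z = 1 ∧ v ⬝ᵥ g *ᵥ z = 0 ∧
      (J *ᵥ v) ⬝ᵥ g *ᵥ z = 0 := by
    obtain ⟨d, hd⟩ := norm1 w hw0
    refine ⟨d • w, hd, ?_, ?_⟩
    · rw [Matrix.mulVec_smul, dotProduct_smul, hw1, smul_zero]
    · rw [Matrix.mulVec_smul, dotProduct_smul, hw2, smul_zero]
  -- The orthogonal complement of the `J`-invariant plane spanned by `v, J v` is itself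
  -- `J`-invariant, so `J z` completes the frame.
  have vjz : v ⬝ᵥ g *ᵥ (J *ᵥ z) = 0 := by have := bJ1 v z; linarith
  have zjv : z ⬝ᵥ g *ᵥ (J *ᵥ v) = 0 := by rw [bsymm]; exact jvz
  have zv : z ⬝ᵥ g *ᵥ v = 0 := by rw [bsymm]; exact vz
  let F : Fin 4 → Fin 4 → ℝ := ![v, J *ᵥ v, z, J *ᵥ z]
  refine ⟨(Matrix.of F)ᵀ, ?_, ?_⟩
  · have key : ∀ k l, ((Matrix.of F)ᵀᵀ * g * (Matrix.of F)ᵀ) k l = F k ⬝ᵥ g *ᵥ F l := by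
      intro k l
      rw [Matrix.transpose_transpose, Matrix.mul_assoc, Matrix.mul_apply]
      simp only [dotProduct, Matrix.mul_apply, Matrix.mulVec]
      rfl
    ext k l
    rw [key]
    fin_cases k <;> fin_cases l <;>
      simp [F, -Matrix.mulVec_mulVec, hc, hd, bJ, bJ0, bJ1, vz, zv, zjv, vjz]
  · have key : ∀ a k, (J * (Matrix.of F)ᵀ) a k = (J *ᵥ F k) a := fun a k => rfl
    ext a k
    rw [key, Matrix.mul_apply, Fin.sum_univ_four]
    fin_cases k <;> simp [F, om0, hJJ]

/-- Frame components of a bilinear form. -/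
def pull2 (P A : Matrix (Fin 4) (Fin 4) ℝ) : Matrix (Fin 4) (Fin 4) ℝ := Pᵀ * A * P

/-- Frame components of a tensor of rank three. -/
noncomputable def pull3 (P : Matrix (Fin 4) (Fin 4) ℝ) (N : Fin 4 → Matrix (Fin 4) (Fin 4) ℝ) :
    Fin 4 → Matrix (Fin 4) (Fin 4) ℝ := fun i => ∑ a, P a i • pull2 P (N a)

/-- Frame components of a tensor of rank four. -/
noncomputable def pull4 (P : Matrix (Fin 4) (Fin 4) ℝ) (R : Fin 4 → Fin 4 → Fin 4 → Fin 4 → ℝ) :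
    Fin 4 → Fin 4 → Fin 4 → Fin 4 → ℝ := fun i j k l =>
  ∑ a, ∑ b, ∑ c, ∑ d, P a i * P b j * P c k * P d l * R a b c d

/-! ### Passing to frame components and back -/

section

variable {P : Matrix (Fin 4) (Fin 4) ℝ}

lemma pull2_apply (A : Matrix (Fin 4) (Fin 4) ℝ) (i j : Fin 4) :
    pull2 P A i j = ∑ a, ∑ b, P a i * P b j * A a b := by
  simp only [pull2, Matrix.mul_apply, Matrix.transpose_apply, Finset.sum_mul]
  rw [Finset.sum_comm]
  exact Finset.sum_congr rfl fun a _ => Finset.sum_congr rfl fun b _ => by ring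

lemma pull2_add (A B : Matrix (Fin 4) (Fin 4) ℝ) : pull2 P (A + B) = pull2 P A + pull2 P B := by
  simp only [pull2, mul_add, add_mul]

lemma pull2_sub (A B : Matrix (Fin 4) (Fin 4) ℝ) : pull2 P (A - B) = pull2 P A - pull2 P B := by
  simp only [pull2, mul_sub, sub_mul]

lemma pull2_neg (A : Matrix (Fin 4) (Fin 4) ℝ) : pull2 P (-A) = - pull2 P A := by
  simp only [pull2, mul_neg, neg_mul]

lemma pull2_zero : pull2 P 0 = 0 := by simp [pull2]

lemma pull2_smul (c : ℝ) (A : Matrix (Fin 4) (Fin 4) ℝ) : pull2 P (c • A) = c • pull2 P A := by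
  simp only [pull2, Matrix.mul_smul, Matrix.smul_mul]

lemma pull2_sum {ι : Type*} (s : Finset ι) (A : ι → Matrix (Fin 4) (Fin 4) ℝ) :
    pull2 P (∑ i ∈ s, A i) = ∑ i ∈ s, pull2 P (A i) := by
  simp only [pull2, Matrix.mul_sum, Matrix.sum_mul]

lemma pull2_transpose (A : Matrix (Fin 4) (Fin 4) ℝ) : pull2 P Aᵀ = (pull2 P A)ᵀ := by
  simp only [pull2, Matrix.transpose_mul, Matrix.transpose_transpose, mul_assoc]

/-- This is what allows tensor identities to be verified in a single frame at the point. -/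
lemma pull2_injective (hP : IsUnit P.det) {A B : Matrix (Fin 4) (Fin 4) ℝ}
    (h : pull2 P A = pull2 P B) : A = B := by
  have hP' : IsUnit Pᵀ.det := by rwa [Matrix.det_transpose]
  have key : ∀ A, (Pᵀ)⁻¹ * pull2 P A * P⁻¹ = A := fun A => by
    rw [pull2, mul_assoc, mul_assoc, Matrix.mul_nonsing_inv _ hP, mul_one, ← mul_assoc,
      Matrix.nonsing_inv_mul _ hP', one_mul]
  rw [← key A, h, key]

lemma pull3_apply (N : Fin 4 → Matrix (Fin 4) (Fin 4) ℝ) (i j k : Fin 4) :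
    pull3 P N i j k = ∑ a, ∑ b, ∑ c, P a i * P b j * P c k * N a b c := by
  simp only [pull3, Matrix.sum_apply, Matrix.smul_apply, smul_eq_mul, pull2_apply, Finset.mul_sum]
  exact Finset.sum_congr rfl fun a _ => Finset.sum_congr rfl fun b _ =>
    Finset.sum_congr rfl fun c _ => by ring

lemma pull3_rotate (N : Fin 4 → Matrix (Fin 4) (Fin 4) ℝ) (i j k : Fin 4) :
    pull3 P (fun a => Matrix.of fun b c => N b c a) i j k = pull3 P N j k i := by
  simp only [pull3_apply, Matrix.of_apply]
  rw [Finset.sum_comm]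
  refine Finset.sum_congr rfl fun b _ => ?_
  rw [Finset.sum_comm]
  exact Finset.sum_congr rfl fun c _ => Finset.sum_congr rfl fun a _ => by ring

lemma pull3_add (N N' : Fin 4 → Matrix (Fin 4) (Fin 4) ℝ) (i : Fin 4) :
    pull3 P (fun a => N a + N' a) i = pull3 P N i + pull3 P N' i := by
  simp only [pull3, pull2_add, smul_add, Finset.sum_add_distrib]

/-- The values lie in an arbitrary module, so that the same statement serves for covector components
and for families of matrices. -/
lemma sum_mul_injective (hP : IsUnit P.det) {M : Type*} [AddCommGroup M] [Module ℝ M]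
    {F : Fin 4 → M} (h : ∀ i, ∑ a, P a i • F a = 0) (b : Fin 4) : F b = 0 := by
  have h1 : ∑ i, P⁻¹ i b • ∑ a, P a i • F a = F b := by
    simp only [Finset.smul_sum, smul_smul]
    rw [Finset.sum_comm]
    have : ∀ a, ∑ i, (P⁻¹ i b * P a i) • F a = (if a = b then (1 : ℝ) else 0) • F a := fun a => by
      rw [← Finset.sum_smul, ← Matrix.one_apply, ← Matrix.mul_nonsing_inv _ hP, Matrix.mul_apply]
      congr 1
      exact Finset.sum_congr rfl fun i _ => mul_comm _ _
    simp [this]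
  rw [← h1]
  simp [h]

lemma pull3_eq_zero (hP : IsUnit P.det) {N : Fin 4 → Matrix (Fin 4) (Fin 4) ℝ}
    (h : ∀ i j k, pull3 P N i j k = 0) (a : Fin 4) : N a = 0 := by
  have h1 : ∀ i, ∑ a, P a i • pull2 P (N a) = 0 := fun i => by ext j k; exact h i j k
  have h2 := sum_mul_injective hP h1 a
  exact pull2_injective hP (by rw [h2, pull2_zero])

lemma pull3_cyclic (N : Fin 4 → Matrix (Fin 4) (Fin 4) ℝ) (i j k : Fin 4) :
    pull3 P (fun a => N a + (Matrix.of fun b c => N b c a) + (Matrix.of fun b c => N c a b)) i j k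
      = pull3 P N i j k + pull3 P N j k i + pull3 P N k i j := by
  rw [pull3_add (fun a => N a + (Matrix.of fun b c => N b c a)),
    pull3_add N (fun a => Matrix.of fun b c => N b c a)]
  simp only [Matrix.add_apply]
  have h3 : pull3 P (fun a => Matrix.of fun b c => N c a b) i j k = pull3 P N k i j :=
    (pull3_rotate (fun a => Matrix.of fun b c => N b c a) i j k).trans (pull3_rotate N j k i)
  rw [pull3_rotate, h3]

lemma cyclic_pull3 {N : Fin 4 → Matrix (Fin 4) (Fin 4) ℝ}
    (h : ∀ i j k, N i j k + N j k i + N k i j = 0) (i j k : Fin 4) :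
    pull3 P N i j k + pull3 P N j k i + pull3 P N k i j = 0 := by
  rw [← pull3_cyclic]
  have : (fun a => N a + (Matrix.of fun b c => N b c a) + (Matrix.of fun b c => N c a b))
      = fun _ => 0 := by
    funext a; ext b c; exact h a b c
  rw [this]
  simp [pull3, pull2_zero]

lemma cyclic_of_pull3 (hP : IsUnit P.det) {N : Fin 4 → Matrix (Fin 4) (Fin 4) ℝ}
    (h : ∀ i j k, pull3 P N i j k + pull3 P N j k i + pull3 P N k i j = 0) (i j k : Fin 4) :
    N i j k + N j k i + N k i j = 0 := by
  have h1 := pull3_eq_zero (N := fun a => N a + (Matrix.of fun b c => N b c a)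
    + (Matrix.of fun b c => N c a b)) hP (fun i j k => (pull3_cyclic N i j k).trans (h i j k)) i
  exact congrFun (congrFun h1 j) k

lemma pull4_neg (R : Fin 4 → Fin 4 → Fin 4 → Fin 4 → ℝ) (i j k l : Fin 4) :
    pull4 P (fun a b c d => - R a b c d) i j k l = - pull4 P R i j k l := by
  simp only [pull4, mul_neg, Finset.sum_neg_distrib]

lemma pull4_add (R S : Fin 4 → Fin 4 → Fin 4 → Fin 4 → ℝ) (i j k l : Fin 4) :
    pull4 P (fun a b c d => R a b c d + S a b c d) i j k l = pull4 P R i j k l + pull4 P S i j k l := by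
  simp only [pull4, mul_add, Finset.sum_add_distrib]

lemma pull4_swap12 (R : Fin 4 → Fin 4 → Fin 4 → Fin 4 → ℝ) (i j k l : Fin 4) :
    pull4 P (fun a b c d => R b a c d) i j k l = pull4 P R j i k l := by
  simp only [pull4]
  rw [Finset.sum_comm]
  exact Finset.sum_congr rfl fun b _ => Finset.sum_congr rfl fun a _ =>
    Finset.sum_congr rfl fun c _ => Finset.sum_congr rfl fun d _ => by ring

lemma pull4_swap23 (R : Fin 4 → Fin 4 → Fin 4 → Fin 4 → ℝ) (i j k l : Fin 4) :
    pull4 P (fun a b c d => R a c b d) i j k l = pull4 P R i k j l := by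
  simp only [pull4]
  refine Finset.sum_congr rfl fun a _ => ?_
  rw [Finset.sum_comm]
  exact Finset.sum_congr rfl fun b _ =>
    Finset.sum_congr rfl fun c _ => Finset.sum_congr rfl fun d _ => by ring

lemma pull4_swap34 (R : Fin 4 → Fin 4 → Fin 4 → Fin 4 → ℝ) (i j k l : Fin 4) :
    pull4 P (fun a b c d => R a b d c) i j k l = pull4 P R i j l k := by
  simp only [pull4]
  refine Finset.sum_congr rfl fun a _ => Finset.sum_congr rfl fun b _ => ?_
  rw [Finset.sum_comm]
  exact Finset.sum_congr rfl fun c _ => Finset.sum_congr rfl fun d _ => by ring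

/-- The algebraic symmetries of a curvature tensor. -/
structure IsAlgCurv (R : Fin 4 → Fin 4 → Fin 4 → Fin 4 → ℝ) : Prop where
  left : ∀ i j k l, R j i k l = - R i j k l
  right : ∀ i j k l, R i j l k = - R i j k l
  pair : ∀ i j k l, R k l i j = R i j k l
  cyclic : ∀ i j k l, R i j k l + R i k l j + R i l j k = 0

lemma IsAlgCurv.pull4 {R : Fin 4 → Fin 4 → Fin 4 → Fin 4 → ℝ} (hR : IsAlgCurv R) :
    IsAlgCurv (pull4 P R) where
  left i j k l := by
    rw [← pull4_swap12, ← pull4_neg]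
    congr 1; funext a b c d; exact hR.left a b c d
  right i j k l := by
    rw [← pull4_swap34, ← pull4_neg]
    congr 1; funext a b c d; exact hR.right a b c d
  pair i j k l := by
    -- The permutation exchanging the two pairs is written as four adjacent transpositions.
    rw [← pull4_swap23, ← pull4_swap12, ← pull4_swap34, ← pull4_swap23]
    congr 1; funext a b c d; exact hR.pair a b c d
  cyclic i j k l := by
    have e1 : BachFormula.pull4 P R i k l j
        = BachFormula.pull4 P (fun a b c d => R a c d b) i j k l := by
      rw [pull4_swap23 (fun a b c d => R a b d c), pull4_swap34]
    have e2 : BachFormula.pull4 P R i l j k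
        = BachFormula.pull4 P (fun a b c d => R a d b c) i j k l := by
      rw [pull4_swap34 (fun a b c d => R a c b d), pull4_swap23]
    rw [e1, e2, ← pull4_add, ← pull4_add]
    simp only [hR.cyclic]
    simp [BachFormula.pull4]

/-- `P` is a `g`-orthonormal frame. -/
structure IsFrame (g P : Matrix (Fin 4) (Fin 4) ℝ) : Prop where
  orth : Pᵀ * g * P = 1

lemma IsFrame.isUnit_det {g P : Matrix (Fin 4) (Fin 4) ℝ} (h : IsFrame g P) : IsUnit P.det := by
  have := congrArg Matrix.det h.orth
  rw [Matrix.det_mul, Matrix.det_one] at this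
  exact IsUnit.of_mul_eq_one_right _ this

/-- Raising an index is summation over the frame vectors; hence compositions of bilinear forms
become plain matrix products in the frame. -/
lemma IsFrame.inv_eq {g P : Matrix (Fin 4) (Fin 4) ℝ} (h : IsFrame g P) : g⁻¹ = P * Pᵀ := by
  have hu := h.isUnit_det
  have h1 : P * (Pᵀ * g) = 1 := by
    have : P * (Pᵀ * g * P) * P⁻¹ = 1 := by
      rw [h.orth, mul_one, Matrix.mul_nonsing_inv _ hu]
    rw [← mul_assoc, mul_assoc, Matrix.mul_nonsing_inv _ hu, mul_one] at this
    exact this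
  exact Matrix.inv_eq_left_inv (by rw [mul_assoc]; exact h1)

lemma IsFrame.pull2_comp {g P : Matrix (Fin 4) (Fin 4) ℝ} (h : IsFrame g P)
    (A B : Matrix (Fin 4) (Fin 4) ℝ) : pull2 P (A * g⁻¹ * B) = pull2 P A * pull2 P B := by
  rw [h.inv_eq]; simp only [pull2, mul_assoc]

lemma IsFrame.sum_pull2 {g P : Matrix (Fin 4) (Fin 4) ℝ} (h : IsFrame g P)
    (N D : Fin 4 → Matrix (Fin 4) (Fin 4) ℝ) :
    pull2 P (∑ i, ∑ j, g⁻¹ i j • (N i * g⁻¹ * D j)) = ∑ e, pull3 P N e * pull3 P D e := by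
  simp only [pull2_sum, pull2_smul, h.pull2_comp, pull3]
  simp only [h.inv_eq, Matrix.mul_apply, Matrix.transpose_apply, Finset.sum_smul, Finset.sum_mul_sum,
    Matrix.smul_mul, Matrix.mul_smul, smul_smul]
  have c1 : ∀ i, ∑ j, ∑ e, (P i e * P j e) • (pull2 P (N i) * pull2 P (D j))
      = ∑ e, ∑ j, (P i e * P j e) • (pull2 P (N i) * pull2 P (D j)) := fun i => Finset.sum_comm
  simp only [c1]
  rw [Finset.sum_comm]
  exact Finset.sum_congr rfl fun e _ => Finset.sum_congr rfl fun j _ =>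
    Finset.sum_congr rfl fun i _ => by rw [mul_comm (P j e)]

lemma IsFrame.contract_pull3 {g P : Matrix (Fin 4) (Fin 4) ℝ} (h : IsFrame g P)
    (N : Fin 4 → Matrix (Fin 4) (Fin 4) ℝ) (z : Fin 4) :
    ∑ k, P k z * ∑ i, ∑ j, g⁻¹ i j * N i j k = ∑ e, pull3 P N e e z := by
  have h1 : ∀ i, ∑ k, P k z * ∑ j, g⁻¹ i j * N i j k = ∑ e, P i e * pull2 P (N i) e z := fun i => by
    have : g⁻¹ * N i * P = P * pull2 P (N i) := by rw [h.inv_eq, pull2]; simp only [mul_assoc]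
    have := congrFun (congrFun this i) z
    rw [Matrix.mul_apply, Matrix.mul_apply] at this
    rw [← this]
    exact Finset.sum_congr rfl fun k _ => by rw [Matrix.mul_apply, mul_comm]
  have h2 : ∑ k, P k z * ∑ i, ∑ j, g⁻¹ i j * N i j k = ∑ i, ∑ k, P k z * ∑ j, g⁻¹ i j * N i j k := by
    rw [Finset.sum_comm]
    exact Finset.sum_congr rfl fun k _ => by rw [Finset.mul_sum]
  rw [h2]
  simp only [h1, pull3, Matrix.sum_apply, Matrix.smul_apply, smul_eq_mul]
  rw [Finset.sum_comm]

/-- The frame components of the curvature tensor. -/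
noncomputable def frameRm (G : MatrixField) (u : E4) (P : Matrix (Fin 4) (Fin 4) ℝ) :
    Fin 4 → Fin 4 → Fin 4 → Fin 4 → ℝ := pull4 P (fun a b c d => rm G a b u c d)

lemma IsMetricOn.isAlgCurv {U : Set E4} {G : MatrixField} (hG : IsMetricOn U G) {u : E4}
    (hu : u ∈ U) (P : Matrix (Fin 4) (Fin 4) ℝ) : IsAlgCurv (frameRm G u P) := by
  refine IsAlgCurv.pull4 ⟨fun i j k l => rm_antisymm_left G u i j k l,
    fun i j k l => hG.rm_antisymm_right hu i j k l, fun i j k l => hG.rm_pair hu k l i j,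
    fun i j k l => ?_⟩
  -- The Bianchi identity proved earlier fixes the third index; pair symmetry turns it into the
  -- version that fixes the first.
  have := hG.rm_cyclic hu k l i j
  have h1 := hG.rm_pair hu i j k l
  have h2 := hG.rm_pair hu i k l j
  have h3 := hG.rm_pair hu i l j k
  have h4 := rm_antisymm_left G u l j i k
  linarith [hG.rm_pair hu i k l j, hG.rm_antisymm_right hu l j k i, hG.rm_antisymm_right hu k l i j,
    rm_antisymm_left G u k i l j, hG.rm_pair hu l j i k, hG.rm_pair hu j k i l,
    rm_antisymm_left G u j k i l]

lemma IsFrame.pull2_curvAct {G : MatrixField} {u : E4} {P : Matrix (Fin 4) (Fin 4) ℝ}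
    (h : IsFrame (G u) P) (A : MatrixField) (x y : Fin 4) :
    pull2 P (curvAct G A u) x y = ∑ e, ∑ f, frameRm G u P x e y f * pull2 P (A u) e f := by
  have e1 : (G u)⁻¹ * A u * (G u)⁻¹ = P * pull2 P (A u) * Pᵀ := by
    rw [h.inv_eq, pull2]; simp only [mul_assoc]
  have e2 : ∀ i k, ((G u)⁻¹ * A u * (G u)⁻¹) i k
      = ∑ e, ∑ f, P i e * P k f * pull2 P (A u) e f := fun i k => by
    rw [e1]
    simp only [Matrix.mul_apply, Matrix.transpose_apply, Finset.sum_mul]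
    rw [Finset.sum_comm]
    exact Finset.sum_congr rfl fun e _ => Finset.sum_congr rfl fun f _ => by ring
  have mv : ∀ X : Fin 4 → Fin 4 → Fin 4 → ℝ, ∑ d, ∑ e, ∑ f, X d e f = ∑ e, ∑ f, ∑ d, X d e f :=
    fun X => by
      rw [Finset.sum_comm]
      exact Finset.sum_congr rfl fun e _ => Finset.sum_comm
  have e3 : pull2 P (curvAct G A u) x y = ∑ a, ∑ i, ∑ b, ∑ k, ∑ e, ∑ f,
      P a x * P i e * P b y * P k f * rm G a i u b k * pull2 P (A u) e f := by
    rw [pull2_apply]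
    simp only [curvAct, Matrix.of_apply, e2, Finset.mul_sum]
    refine Finset.sum_congr rfl fun a _ => ?_
    rw [Finset.sum_comm]
    exact Finset.sum_congr rfl fun i _ => Finset.sum_congr rfl fun b _ =>
      Finset.sum_congr rfl fun k _ => Finset.sum_congr rfl fun e _ =>
        Finset.sum_congr rfl fun f _ => by ring
  rw [e3]
  simp only [frameRm, pull4, Finset.sum_mul]
  refine (Finset.sum_congr rfl fun a _ => Finset.sum_congr rfl fun i _ =>
    Finset.sum_congr rfl fun b _ => mv _).trans ?_
  refine (Finset.sum_congr rfl fun a _ => Finset.sum_congr rfl fun i _ => mv _).trans ?_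
  exact (Finset.sum_congr rfl fun a _ => mv _).trans (mv _)

end

/-! ### Algebra in an adapted orthonormal frame -/

lemma om0_sq : om0 * om0 = -1 := by
  ext i j
  fin_cases i <;> fin_cases j <;> simp [om0, Matrix.mul_apply, Fin.sum_univ_four]

lemma om0_transpose : om0ᵀ = -om0 := by
  ext i j
  fin_cases i <;> fin_cases j <;> simp [om0]

lemma om0_mul_apply (A : Matrix (Fin 4) (Fin 4) ℝ) (i j : Fin 4) :
    (om0 * A) i j = ![A 1 j, -A 0 j, A 3 j, -A 2 j] i := by
  rw [Matrix.mul_apply, Fin.sum_univ_four]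
  fin_cases i <;> simp [om0]

lemma mul_om0_apply (A : Matrix (Fin 4) (Fin 4) ℝ) (i j : Fin 4) :
    (A * om0) i j = ![-A i 1, A i 0, -A i 3, A i 2] j := by
  rw [Matrix.mul_apply, Fin.sum_univ_four]
  fin_cases j <;> simp [om0]

/-- Bilinear forms anti-commuting with `om0`: the form of `∇_X Ω`. -/
def selfDual (a b : ℝ) : Matrix (Fin 4) (Fin 4) ℝ :=
  !![0, 0, a, b; 0, 0, b, -a; -a, -b, 0, 0; -b, a, 0, 0]

/-- Symmetric bilinear forms commuting with `om0`. -/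
def symInv (p q x y : ℝ) : Matrix (Fin 4) (Fin 4) ℝ :=
  !![p, 0, x, y; 0, p, -y, x; x, -y, q, 0; y, x, 0, q]

/-- Anti-self-dual two-forms. -/
def antiSelfDual (p x y : ℝ) : Matrix (Fin 4) (Fin 4) ℝ :=
  !![0, p, x, y; -p, 0, -y, x; -x, y, 0, -p; -y, -x, p, 0]

/-- These are the real parts of forms of type `(2,0)`, a real plane. With `om0` they span the
self-dual forms. -/
lemma eq_selfDual {N : Matrix (Fin 4) (Fin 4) ℝ} (h1 : Nᵀ = -N) (h2 : N * om0 + om0 * N = 0) :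
    N = selfDual (N 0 2) (N 0 3) := by
  have a : ∀ i j, N j i = - N i j := fun i j => congrFun (congrFun h1 i) j
  have b : ∀ i j, (N * om0 + om0 * N) i j = 0 := fun i j => by rw [h2]; rfl
  have b00 := b 0 0
  have b22 := b 2 2
  have b02 := b 0 2
  have b03 := b 0 3
  simp [om0_mul_apply, mul_om0_apply] at b00 b22 b02 b03
  ext i j
  fin_cases i <;> fin_cases j <;> simp [selfDual] <;>
    linarith [a 0 0, a 1 1, a 2 2, a 3 3, a 0 1, a 0 2, a 0 3, a 1 2, a 1 3, a 2 3]

/-- A symmetric form commuting with the complex structure is a Hermitian `2 × 2` matrix, which has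
four real parameters. -/
lemma eq_symInv {r : Matrix (Fin 4) (Fin 4) ℝ} (h1 : rᵀ = r) (h2 : om0 * r = r * om0) :
    r = symInv (r 0 0) (r 2 2) (r 0 2) (r 0 3) := by
  have a : ∀ i j, r j i = r i j := fun i j => congrFun (congrFun h1 i) j
  have b : ∀ i j, (om0 * r) i j = (r * om0) i j := fun i j => by rw [h2]
  have b00 := b 0 0
  have b01 := b 0 1
  have b02 := b 0 2
  have b03 := b 0 3
  have b22 := b 2 2
  have b23 := b 2 3
  simp [om0_mul_apply, mul_om0_apply] at b00 b01 b02 b03 b22 b23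
  ext i j
  fin_cases i <;> fin_cases j <;> simp [symInv] <;>
    linarith [a 0 1, a 0 2, a 0 3, a 1 2, a 1 3, a 2 3]

/-- The first-order data of an almost Kähler structure in an adapted frame: `N = ∇Ω`. -/
structure IsNablaOm (N : Fin 4 → Matrix (Fin 4) (Fin 4) ℝ) : Prop where
  anti : ∀ i, (N i)ᵀ = - N i
  anticomm : ∀ i, N i * om0 + om0 * N i = 0
  cyclic : ∀ i j k, N i j k + N j k i + N k i j = 0

/-- Four forms of the shape `selfDual` have eight parameters. The four components of `dΩ = 0`
determine `∇_{JX} Ω` from `∇_X Ω`, which leaves four. -/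
lemma IsNablaOm.exists_eq {N : Fin 4 → Matrix (Fin 4) (Fin 4) ℝ} (h : IsNablaOm N) :
    ∃ a b c d : ℝ, N 0 = selfDual a b ∧ N 1 = selfDual b (-a) ∧ N 2 = selfDual c d
      ∧ N 3 = selfDual d (-c) := by
  have e : ∀ i, N i = selfDual (N i 0 2) (N i 0 3) := fun i => eq_selfDual (h.anti i) (h.anticomm i)
  have c1 := h.cyclic 0 1 2
  have c2 := h.cyclic 0 1 3
  have c3 := h.cyclic 0 2 3
  have c4 := h.cyclic 1 2 3
  rw [e 0, e 1, e 2] at c1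
  rw [e 0, e 1, e 3] at c2
  rw [e 0, e 2, e 3] at c3
  rw [e 1, e 2, e 3] at c4
  simp [selfDual] at c1 c2 c3 c4
  refine ⟨N 0 0 2, N 0 0 3, N 2 0 2, N 2 0 3, e 0, ?_, e 2, ?_⟩
  · rw [e 1]; congr 1 <;> linarith
  · rw [e 3]; congr 1 <;> linarith

/-- `Ω` is self-dual, so closed implies coclosed; here this is read off from the normal form. -/
lemma IsNablaOm.div_eq_zero {N : Fin 4 → Matrix (Fin 4) (Fin 4) ℝ} (h : IsNablaOm N) (k : Fin 4) :
    ∑ e, N e e k = 0 := by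
  obtain ⟨a, b, c, d, h0, h1, h2, h3⟩ := h.exists_eq
  rw [Fin.sum_univ_four, h0, h1, h2, h3]
  fin_cases k <;> simp [selfDual]

/-- The first-order data of a `J`-invariant Ricci tensor in an adapted frame: `D = ∇ Ric`. -/
structure IsNablaRic (N : Fin 4 → Matrix (Fin 4) (Fin 4) ℝ) (r : Matrix (Fin 4) (Fin 4) ℝ)
    (D : Fin 4 → Matrix (Fin 4) (Fin 4) ℝ) : Prop where
  nabla : IsNablaOm N
  symm : rᵀ = r
  comm : om0 * r = r * om0
  symmD : ∀ i, (D i)ᵀ = D i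
  commD : ∀ i, N i * r + om0 * D i = D i * om0 + r * N i
  div : ∀ k, ∑ e, D e e k = (1 / 2) * (D k).trace

/-- The cyclic sum is totally alternating, so only its four components with distinct indices matter.
-/
lemma cyclic_of_antisymm {Q : Fin 4 → Matrix (Fin 4) (Fin 4) ℝ} (h : ∀ i, (Q i)ᵀ = - Q i)
    (h1 : Q 0 1 2 + Q 1 2 0 + Q 2 0 1 = 0) (h2 : Q 0 1 3 + Q 1 3 0 + Q 3 0 1 = 0)
    (h3 : Q 0 2 3 + Q 2 3 0 + Q 3 0 2 = 0) (h4 : Q 1 2 3 + Q 2 3 1 + Q 3 1 2 = 0)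
    (i j k : Fin 4) : Q i j k + Q j k i + Q k i j = 0 := by
  have a : ∀ i j k, Q i k j = - Q i j k := fun i j k => congrFun (congrFun (h i) j) k
  have a0 : ∀ i j, Q i j j = 0 := fun i j => by have := a i j j; linarith
  fin_cases i <;> fin_cases j <;> fin_cases k <;> simp [a0] <;>
    linarith [a 0 1 2, a 0 1 3, a 0 2 3, a 1 0 2, a 1 0 3, a 1 2 3, a 2 0 1, a 2 0 3, a 2 1 3,
      a 3 0 1, a 3 0 2, a 3 1 2, a 0 0 1, a 0 0 2, a 0 0 3, a 1 0 1, a 1 1 2, a 1 1 3, a 2 0 2,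
      a 2 1 2, a 2 2 3, a 3 0 3, a 3 1 3, a 3 2 3]

section NablaRic

variable {N D : Fin 4 → Matrix (Fin 4) (Fin 4) ℝ} {r : Matrix (Fin 4) (Fin 4) ℝ}

/-- The derivative of the relation `Ω Ric = Ric Ω` says that `∇ρ` is again a two-form. -/
lemma IsNablaRic.anti_rho (h : IsNablaRic N r D) (i : Fin 4) :
    (N i * r + om0 * D i)ᵀ = - (N i * r + om0 * D i) := by
  rw [Matrix.transpose_add, Matrix.transpose_mul, Matrix.transpose_mul, h.symm, h.symmD,
    om0_transpose, h.nabla.anti, h.commD]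
  noncomm_ring

end NablaRic

/-- The general solution `D` of `N r + Ω D = D Ω + r N` for `N = selfDual α β` and
`r = symInv p q x y`. -/
def nablaSymInv (p q x y α β d e z w : ℝ) : Matrix (Fin 4) (Fin 4) ℝ :=
  !![d, -(x * α + y * β), z, w;
    -(x * α + y * β), d - 2 * (x * β - y * α), -w + (p - q) * α, z + (p - q) * β;
    z, -w + (p - q) * α, e, x * α - y * β;
    w, z + (p - q) * β, x * α - y * β, e + 2 * (x * β + y * α)]

/-- The differentiated commutation relation is six independent linear conditions on the ten entries
of `D`. They fix its `J`-anti-invariant part through `∇Ω` and `Ric`; the invariant part stays free.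
-/
lemma eq_nablaSymInv {p q x y α β : ℝ} {D : Matrix (Fin 4) (Fin 4) ℝ} (hs : Dᵀ = D)
    (h : selfDual α β * symInv p q x y + om0 * D = D * om0 + symInv p q x y * selfDual α β) :
    D = nablaSymInv p q x y α β (D 0 0) (D 2 2) (D 0 2) (D 0 3) := by
  have a : ∀ i j, D j i = D i j := fun i j => congrFun (congrFun hs i) j
  have b : ∀ i j, (selfDual α β * symInv p q x y) i j + (om0 * D) i j
      = (D * om0) i j + (symInv p q x y * selfDual α β) i j := fun i j =>
    congrFun (congrFun h i) j
  have b00 := b 0 0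
  have b01 := b 0 1
  have b02 := b 0 2
  have b03 := b 0 3
  have b22 := b 2 2
  have b23 := b 2 3
  simp only [om0_mul_apply, mul_om0_apply] at b00 b01 b02 b03 b22 b23
  simp [selfDual, symInv] at b00 b01 b02 b03 b22 b23
  have a10 := a 0 1
  have a20 := a 0 2
  have a30 := a 0 3
  have a21 := a 1 2
  have a31 := a 1 3
  have a32 := a 2 3
  ext i j
  fin_cases i <;> fin_cases j <;> simp [nablaSymInv] <;> linarith

section NablaRic

variable {N D : Fin 4 → Matrix (Fin 4) (Fin 4) ℝ} {r : Matrix (Fin 4) (Fin 4) ℝ}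

lemma IsNablaRic.exists_eq (h : IsNablaRic N r D) :
    ∃ (a b c d p q x y : ℝ) (s t z w : Fin 4 → ℝ), r = symInv p q x y
      ∧ (N 0 = selfDual a b ∧ N 1 = selfDual b (-a) ∧ N 2 = selfDual c d ∧ N 3 = selfDual d (-c))
      ∧ D 0 = nablaSymInv p q x y a b (s 0) (t 0) (z 0) (w 0)
      ∧ D 1 = nablaSymInv p q x y b (-a) (s 1) (t 1) (z 1) (w 1)
      ∧ D 2 = nablaSymInv p q x y c d (s 2) (t 2) (z 2) (w 2)
      ∧ D 3 = nablaSymInv p q x y d (-c) (s 3) (t 3) (z 3) (w 3) := by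
  obtain ⟨a, b, c, d, n0, n1, n2, n3⟩ := h.nabla.exists_eq
  obtain ⟨p, q, x, y, hr⟩ : ∃ p q x y, r = symInv p q x y := ⟨_, _, _, _, eq_symInv h.symm h.comm⟩
  have hc := h.commD
  rw [hr] at hc
  refine ⟨a, b, c, d, p, q, x, y, fun i => D i 0 0, fun i => D i 2 2, fun i => D i 0 2,
    fun i => D i 0 3, hr, ⟨n0, n1, n2, n3⟩, ?_, ?_, ?_, ?_⟩
  · exact eq_nablaSymInv (h.symmD 0) (n0 ▸ hc 0)
  · exact eq_nablaSymInv (h.symmD 1) (n1 ▸ hc 1)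
  · exact eq_nablaSymInv (h.symmD 2) (n2 ▸ hc 2)
  · exact eq_nablaSymInv (h.symmD 3) (n3 ▸ hc 3)

/-- In dimension four, the Ricci form is closed, and its divergence is `ds ∘ Ω / 2`. -/
lemma IsNablaRic.rho (h : IsNablaRic N r D) :
    (∀ i j k, (N i * r + om0 * D i) j k + (N j * r + om0 * D j) k i
      + (N k * r + om0 * D k) i j = 0)
    ∧ ∀ k, ∑ e, (N e * r + om0 * D e) e k = (1 / 2) * ∑ c, (D c).trace * om0 c k := by
  have han := h.anti_rho
  have dv := h.div
  obtain ⟨a, b, c, d, p, q, x, y, s, t, z, w, hr, ⟨n0, n1, n2, n3⟩, m0, m1, m2, m3⟩ := h.exists_eq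
  -- The four components of the contracted Bianchi identity are linear in the remaining unknowns.
  -- They give all four components of `dρ = 0` and the divergence of `ρ`.
  have d0 := dv 0
  have d1 := dv 1
  have d2 := dv 2
  have d3 := dv 3
  simp only [Fin.sum_univ_four, Matrix.trace, Matrix.diag, m0, m1, m2, m3] at d0 d1 d2 d3
  simp [nablaSymInv] at d0 d1 d2 d3
  constructor
  · refine cyclic_of_antisymm han ?_ ?_ ?_ ?_ <;>
      simp only [Matrix.add_apply, om0_mul_apply, hr, n0, n1, n2, n3, m0, m1, m2, m3] <;>
      simp [selfDual, symInv, nablaSymInv] <;> linarith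
  · intro k
    simp only [Fin.sum_univ_four, Matrix.trace, Matrix.diag]
    fin_cases k <;>
      simp only [Matrix.add_apply, om0_mul_apply, hr, n0, n1, n2, n3, m0, m1, m2, m3] <;>
      simp [selfDual, symInv, nablaSymInv, om0] <;> linarith

/-- The derivative of the traceless Ricci form is anti-self-dual. -/
lemma IsNablaRic.exists_antiSelfDual (h : IsNablaRic N r D) (i : Fin 4) :
    ∃ p x y, N i * (r - (r.trace / 4) • 1) + om0 * (D i - ((D i).trace / 4) • 1)
      = antiSelfDual p x y := by
  obtain ⟨p, q, x, y, hr⟩ : ∃ p q x y, r = symInv p q x y := ⟨_, _, _, _, eq_symInv h.symm h.comm⟩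
  obtain ⟨a, b, hN⟩ : ∃ a b, N i = selfDual a b :=
    ⟨_, _, eq_selfDual (h.nabla.anti i) (h.nabla.anticomm i)⟩
  have hc := h.commD i
  rw [hr, hN] at hc
  have hD := eq_nablaSymInv (h.symmD i) hc
  rw [hN, hr, hD]
  generalize D i 0 0 = s
  generalize D i 2 2 = t
  generalize D i 0 2 = z
  generalize D i 0 3 = w
  -- The witnesses are the entries of the left side in row `0`, columns `1`, `2`, `3`.
  refine ⟨(s - t) / 2 - x * b, -w + (p - q) / 2 * a, z + (p - q) / 2 * b, ?_⟩
  ext i j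
  simp only [Matrix.add_apply, Matrix.mul_apply, Fin.sum_univ_four, Matrix.trace,
    Matrix.diag, Matrix.sub_apply, Matrix.smul_apply, Matrix.one_apply]
  fin_cases i <;> fin_cases j <;>
    simp [selfDual, symInv, nablaSymInv, antiSelfDual, om0] <;> ring

end NablaRic

/-- Self-dual and anti-self-dual forms are the two commuting ideals of `so(4)`. This makes `S`
symmetric. -/
lemma selfDual_comm_antiSelfDual (a b p x y : ℝ) :
    selfDual a b * antiSelfDual p x y = antiSelfDual p x y * selfDual a b := by
  ext i j
  fin_cases i <;> fin_cases j <;> simp [selfDual, antiSelfDual] <;> ring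

/-- The same reason: `om0` is itself self-dual. This makes `S` anti-invariant. -/
lemma om0_comm_antiSelfDual (p x y : ℝ) :
    om0 * antiSelfDual p x y = antiSelfDual p x y * om0 := by
  ext i j
  rw [om0_mul_apply, mul_om0_apply]
  fin_cases i <;> fin_cases j <;> simp [antiSelfDual]

lemma antiSelfDual_transpose (p x y : ℝ) : (antiSelfDual p x y)ᵀ = - antiSelfDual p x y := by
  ext i j
  fin_cases i <;> fin_cases j <;> simp [antiSelfDual]

/-! ### The quadratic curvature identity -/

/-- The action of an algebraic curvature tensor on bilinear forms. -/
noncomputable def actAlg (R : Fin 4 → Fin 4 → Fin 4 → Fin 4 → ℝ) (T : Matrix (Fin 4) (Fin 4) ℝ) :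
    Matrix (Fin 4) (Fin 4) ℝ := Matrix.of fun x y => ∑ e, ∑ f, R x e y f * T e f

lemma IsAlgCurv.actAlg_transpose {R : Fin 4 → Fin 4 → Fin 4 → Fin 4 → ℝ} (hR : IsAlgCurv R)
    (T : Matrix (Fin 4) (Fin 4) ℝ) : actAlg R Tᵀ = (actAlg R T)ᵀ := by
  ext x y
  simp only [actAlg, Matrix.of_apply, Matrix.transpose_apply]
  rw [Finset.sum_comm]
  exact Finset.sum_congr rfl fun e _ => Finset.sum_congr rfl fun f _ => by rw [hR.pair]

lemma actAlg_add (R : Fin 4 → Fin 4 → Fin 4 → Fin 4 → ℝ) (A B : Matrix (Fin 4) (Fin 4) ℝ) :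
    actAlg R (A + B) = actAlg R A + actAlg R B := by
  ext x y; simp [actAlg, mul_add, Finset.sum_add_distrib]

lemma actAlg_smul (R : Fin 4 → Fin 4 → Fin 4 → Fin 4 → ℝ) (c : ℝ) (A : Matrix (Fin 4) (Fin 4) ℝ) :
    actAlg R (c • A) = c • actAlg R A := by
  ext x y
  simp only [actAlg, Matrix.of_apply, Matrix.smul_apply, smul_eq_mul, Finset.mul_sum]
  exact Finset.sum_congr rfl fun e _ => Finset.sum_congr rfl fun f _ => by ring

set_option linter.unusedSimpArgs false in
set_option maxHeartbeats 4000000 in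
/-- For a curvature tensor with `J`-invariant Ricci tensor, the Ricci form and the
fundamental form satisfy a quadratic identity. -/
lemma IsAlgCurv.quadratic {R : Fin 4 → Fin 4 → Fin 4 → Fin 4 → ℝ} (hR : IsAlgCurv R)
    (hJ : om0 * actAlg R 1 = actAlg R 1 * om0) :
    (om0 * actAlg R (om0 * actAlg R 1) - om0 * actAlg R om0 * actAlg R 1)
      + ((2 : ℝ) • actAlg R 1 + actAlg R om0 * om0 + om0 * actAlg R om0)
        * (actAlg R 1 - ((actAlg R 1).trace / 4) • 1)
      = - actAlg R (actAlg R 1) + ((actAlg R 1).trace / 2) • actAlg R 1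
        + ((actAlg R 1 * actAlg R 1).trace / 4 - (actAlg R 1).trace ^ 2 / 8) • 1 := by
  have z : ∀ i k l, R i i k l = 0 := fun i k l => by have := hR.left i i k l; linarith
  have z' : ∀ i k l, R k l i i = 0 := fun i k l => by have := hR.right k l i i; linarith
  have l10 := fun k l => hR.left 0 1 k l
  have l20 := fun k l => hR.left 0 2 k l
  have l30 := fun k l => hR.left 0 3 k l
  have l21 := fun k l => hR.left 1 2 k l
  have l31 := fun k l => hR.left 1 3 k l
  have l32 := fun k l => hR.left 2 3 k l
  have r10 := fun k l => hR.right k l 0 1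
  have r20 := fun k l => hR.right k l 0 2
  have r30 := fun k l => hR.right k l 0 3
  have r21 := fun k l => hR.right k l 1 2
  have r31 := fun k l => hR.right k l 1 3
  have r32 := fun k l => hR.right k l 2 3
  have p1 := hR.pair 0 1 0 2
  have p2 := hR.pair 0 1 0 3
  have p3 := hR.pair 0 1 1 2
  have p4 := hR.pair 0 1 1 3
  have p5 := hR.pair 0 1 2 3
  have p6 := hR.pair 0 2 0 3
  have p7 := hR.pair 0 2 1 2
  have p8 := hR.pair 0 2 1 3
  have p9 := hR.pair 0 2 2 3
  have p10 := hR.pair 0 3 1 2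
  have p11 := hR.pair 0 3 1 3
  have p12 := hR.pair 0 3 2 3
  have p13 := hR.pair 1 2 1 3
  have p14 := hR.pair 1 2 2 3
  have p15 := hR.pair 1 3 2 3
  -- Once antisymmetry and pair symmetry are used, the first Bianchi identity leaves this single
  -- relation, and twenty independent components.
  have b : R 0 3 1 2 = R 0 2 1 3 - R 0 1 2 3 := by
    have := hR.cyclic 0 1 2 3
    rw [hR.right 0 2 1 3] at this
    linarith
  have hr : ∀ x y, actAlg R 1 x y = R x 0 y 0 + R x 1 y 1 + R x 2 y 2 + R x 3 y 3 := fun x y => by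
    simp [actAlg, Matrix.one_apply, Fin.sum_univ_four]
  have hsym : (actAlg R 1)ᵀ = actAlg R 1 := by rw [← hR.actAlg_transpose, Matrix.transpose_one]
  -- `J`-invariance of the Ricci tensor amounts to six scalar equations on its entries.
  have hS := eq_symInv hsym hJ
  have c01 : actAlg R 1 0 1 = 0 := by rw [hS]; rfl
  have c23 : actAlg R 1 2 3 = 0 := by rw [hS]; rfl
  have c11 : actAlg R 1 1 1 = actAlg R 1 0 0 := by rw [hS]; rfl
  have c33 : actAlg R 1 3 3 = actAlg R 1 2 2 := by rw [hS]; rfl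
  have c13 : actAlg R 1 1 3 = actAlg R 1 0 2 := by rw [hS]; rfl
  have c12 : actAlg R 1 1 2 = - actAlg R 1 0 3 := by rw [hS]; rfl
  simp only [hr, z, z', l10, l20, l30, l21, l31, l32, r10, r20, r30, r21, r31, r32, p1, p2, p3, p4, p5,
    p6, p7, p8, p9, p10, p11, p12, p13, p14, p15, b] at c01 c23 c11 c33 c13 c12
  -- The six equations are solved for six components, so fourteen stay free. They are given names
  -- below, which turns the claim into polynomial identities.
  have q1 : R 0 3 1 3 = - R 0 2 1 2 := by linarith
  have q2 : R 1 2 1 3 = - R 0 2 0 3 := by linarith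
  have q3 : R 1 3 1 3 = R 0 2 0 2 := by linarith
  have q4 : R 1 2 1 2 = R 0 3 0 3 := by linarith
  have q5 : R 1 2 2 3 = R 0 1 0 3 + R 0 1 1 2 - R 0 3 2 3 := by linarith
  have q6 : R 1 3 2 3 = - R 0 1 0 2 + R 0 1 1 3 + R 0 2 2 3 := by linarith
  obtain ⟨k1, h_k1⟩ : ∃ t, R 0 1 0 1 = t := ⟨_, rfl⟩
  obtain ⟨k2, h_k2⟩ : ∃ t, R 2 3 2 3 = t := ⟨_, rfl⟩
  obtain ⟨m, h_m⟩ : ∃ t, R 0 2 0 2 = t := ⟨_, rfl⟩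
  obtain ⟨n, h_n⟩ : ∃ t, R 0 3 0 3 = t := ⟨_, rfl⟩
  obtain ⟨a1, h_a1⟩ : ∃ t, R 0 1 0 2 = t := ⟨_, rfl⟩
  obtain ⟨a2, h_a2⟩ : ∃ t, R 0 1 0 3 = t := ⟨_, rfl⟩
  obtain ⟨a3, h_a3⟩ : ∃ t, R 0 1 1 2 = t := ⟨_, rfl⟩
  obtain ⟨a4, h_a4⟩ : ∃ t, R 0 1 1 3 = t := ⟨_, rfl⟩
  obtain ⟨b1, h_b1⟩ : ∃ t, R 0 1 2 3 = t := ⟨_, rfl⟩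
  obtain ⟨b2, h_b2⟩ : ∃ t, R 0 2 1 3 = t := ⟨_, rfl⟩
  obtain ⟨c, h_c⟩ : ∃ t, R 0 2 0 3 = t := ⟨_, rfl⟩
  obtain ⟨d, h_d⟩ : ∃ t, R 0 2 1 2 = t := ⟨_, rfl⟩
  obtain ⟨e1, h_e1⟩ : ∃ t, R 0 2 2 3 = t := ⟨_, rfl⟩
  obtain ⟨e2, h_e2⟩ : ∃ t, R 0 3 2 3 = t := ⟨_, rfl⟩
  have hp := hr 0 0
  have hq := hr 2 2
  have hx := hr 0 2
  have hy := hr 0 3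
  generalize actAlg R 1 0 0 = p at hS hp
  generalize actAlg R 1 2 2 = q at hS hq
  generalize actAlg R 1 0 2 = x at hS hx
  generalize actAlg R 1 0 3 = y at hS hy
  simp only [z, z', l10, l20, l30, l21, l31, l32, r10, r20, r30, r21, r31, r32,
    p1, p2, p3, p4, p5, p6, p7, p8, p9, p10, p11, p12, p13, p14, p15, b, q1, q2, q3, q4, q5, q6,
    h_k1, h_k2, h_m, h_n, h_a1, h_a2, h_a3, h_a4, h_b1, h_b2, h_c, h_d, h_e1, h_e2] at hp hq hx hy
  have hA : ∀ T i j, actAlg R T i j = ∑ e, ∑ f, R i e j f * T e f := fun _ _ _ => rfl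
  have hom : actAlg R om0 = !![0, k1 + b1, a1 + e1, a2 + e2;
      -k1 - b1, 0, 2 * a3 + a2 - e2, 2 * a4 - a1 + e1;
      -a1 - e1, -2 * a3 - a2 + e2, 0, b1 + k2;
      -a2 - e2, -2 * a4 + a1 - e1, -b1 - k2, 0] := by
    ext i j
    rw [hA]
    fin_cases i <;> fin_cases j <;>
      simp [Fin.sum_univ_four, om0, z, z', l10, l20, l30, l21, l31, l32, r10, r20, r30, r21, r31, r32,
    p1, p2, p3, p4, p5, p6, p7, p8, p9, p10, p11, p12, p13, p14, p15, b, q1, q2, q3, q4, q5, q6,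
    h_k1, h_k2, h_m, h_n, h_a1, h_a2, h_a3, h_a4, h_b1, h_b2, h_c, h_d, h_e1, h_e2] <;> ring
  have hrho : om0 * symInv p q x y = !![0, p, -y, x; -p, 0, -x, -y; y, x, 0, q; -x, y, -q, 0] := by
    ext i j
    rw [om0_mul_apply]
    fin_cases i <;> fin_cases j <;> simp [symInv]
  have h1 : actAlg R (om0 * symInv p q x y) = !![0, k1 * p - a3 * x - a4 * y - a1 * y + a2 * x + b1 * q, a1 * p - m * y - d * x + e1 * q + c * x - b2 * y, a2 * p + b1 * x - c * y - b2 * x + n * x + d * y + e2 * q;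
      -k1 * p + a1 * y - a2 * x + a3 * x - b1 * q + a4 * y, 0, a3 * p - b1 * x - d * y - n * x + a2 * q + a3 * q - e2 * q + b2 * x + c * y, a4 * p - b2 * y + c * x - d * x - m * y - a1 * q + a4 * q + e1 * q;
      -a1 * p + m * y - c * x + d * x + b2 * y - e1 * q, d * y - b2 * x - a3 * p + n * x - c * y + b1 * x - a2 * q - a3 * q + e2 * q, 0, -2 * e1 * y + b1 * p - a2 * x - a3 * x + 2 * e2 * x + a1 * y - a4 * y + k2 * q;
      -a2 * p + c * y - n * x + b2 * x - d * y - b1 * x - e2 * q, b2 * y + d * x - a4 * p - c * x + m * y + a1 * q - a4 * q - e1 * q, -b1 * p - 2 * e2 * x - a1 * y + a4 * y + 2 * e1 * y + a2 * x + a3 * x - k2 * q, 0] := by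
    rw [hrho]
    ext i j
    rw [hA]
    fin_cases i <;> fin_cases j <;>
      simp [Fin.sum_univ_four, z, z', l10, l20, l30, l21, l31, l32, r10, r20, r30, r21, r31, r32,
    p1, p2, p3, p4, p5, p6, p7, p8, p9, p10, p11, p12, p13, p14, p15, b, q1, q2, q3, q4, q5, q6,
    h_k1, h_k2, h_m, h_n, h_a1, h_a2, h_a3, h_a4, h_b1, h_b2, h_c, h_d, h_e1, h_e2] <;> ring
  have h2 : actAlg R (symInv p q x y) = !![k1 * p - 2 * a1 * y + 2 * a2 * x + m * q + n * q, -a3 * y + a4 * x - a1 * x - a2 * y, -a3 * p + 2 * b1 * x - m * x + d * y - c * y - b2 * x + e2 * q, -a4 * p + b1 * y - c * x + b2 * y - e1 * q - n * y + d * x;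
      -a1 * x - a2 * y - a3 * y + a4 * x, k1 * p - 2 * a3 * x - 2 * a4 * y + n * q + m * q, a1 * p - b1 * y - d * x + n * y - b2 * y + c * x - a1 * q + a4 * q + e1 * q, a2 * p + 2 * b1 * x - b2 * x - c * y - a2 * q - a3 * q + e2 * q + d * y - m * x;
      -m * x - c * y - a3 * p + d * y - b2 * x + 2 * b1 * x + e2 * q, a1 * p - d * x - b2 * y + n * y + c * x - b1 * y - a1 * q + a4 * q + e1 * q, m * p - 2 * e1 * y + n * p - 2 * a2 * x - 2 * a3 * x + 2 * e2 * x + k2 * q, -a2 * y - a3 * y + a1 * x - a4 * x;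
      -c * x - n * y - a4 * p + b2 * y + d * x + b1 * y - e1 * q, a2 * p - b2 * x + 2 * b1 * x + d * y - c * y - m * x - a2 * q - a3 * q + e2 * q, a1 * x - a4 * x - a2 * y - a3 * y, n * p + 2 * e2 * x + m * p + 2 * a1 * y - 2 * a4 * y - 2 * e1 * y + k2 * q] := by
    ext i j
    rw [hA]
    fin_cases i <;> fin_cases j <;>
      simp [Fin.sum_univ_four, symInv, z, z', l10, l20, l30, l21, l31, l32, r10, r20, r30, r21, r31, r32,
    p1, p2, p3, p4, p5, p6, p7, p8, p9, p10, p11, p12, p13, p14, p15, b, q1, q2, q3, q4, q5, q6,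
    h_k1, h_k2, h_m, h_n, h_a1, h_a2, h_a3, h_a4, h_b1, h_b2, h_c, h_d, h_e1, h_e2] <;> ring
  have htr : (symInv p q x y).trace = 2 * p + 2 * q := by
    simp [Matrix.trace, Fin.sum_univ_four, symInv]; ring
  have htr2 : (symInv p q x y * symInv p q x y).trace
      = 2 * p ^ 2 + 2 * q ^ 2 + 4 * x ^ 2 + 4 * y ^ 2 := by
    simp [Matrix.trace, Fin.sum_univ_four, symInv]; ring
  rw [hS, h1, h2, htr, htr2, hom]
  clear hom h1 h2 hS hr hA hsym hJ hR
  -- Sixteen polynomial identities; the Ricci entries `p, q, x, y`, kept abstract so far, are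
  -- expanded in the curvature components at the very end.
  ext i j
  simp only [Matrix.add_apply, Matrix.sub_apply, Matrix.neg_apply, Matrix.smul_apply,
    Matrix.mul_apply, Fin.sum_univ_four, smul_eq_mul]
  fin_cases i <;> fin_cases j <;>
    simp only [symInv, om0, Fin.zero_eta, Fin.mk_one, Fin.reduceFinMk, Fin.isValue, Matrix.of_apply,
      Matrix.cons_val', Matrix.cons_val, Matrix.one_apply, Fin.reduceEq, if_true, if_false,
      one_ne_zero, zero_ne_one] <;>
    rw [hp, hq, hx, hy] <;> ring

/-! ### Almost Kähler structures on open sets of `ℝ⁴` -/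

/-- The components of an almost Kähler structure with `J`-invariant Ricci tensor on `U`. -/
structure IsAlmostKahlerOn (U : Set E4) (G J : MatrixField) : Prop extends IsMetricOn U G where
  pos : ∀ v ∈ U, ∀ x : Fin 4 → ℝ, x ≠ 0 → 0 < x ⬝ᵥ G v *ᵥ x
  smoothJ : MSmooth U J
  J_sq : ∀ v ∈ U, J v * J v = -1
  orth : ∀ v ∈ U, (J v)ᵀ * G v * J v = G v
  closed : ∀ v ∈ U, ∀ i j k : Fin 4, pd i (fun w => fundForm G J w ![j, k]) v
    + pd j (fun w => fundForm G J w ![k, i]) v + pd k (fun w => fundForm G J w ![i, j]) v = 0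
  ricInv : ∀ v ∈ U, (J v)ᵀ * ric G v * J v = ric G v

/-- The matrix field of the fundamental form. -/
noncomputable def om (G J : MatrixField) : MatrixField := fun u => (J u)ᵀ * G u

lemma matOf_fundForm (G J : MatrixField) : matOf (fundForm G J) = om G J := by
  funext u; ext a b
  simp [fundForm, om, Matrix.mul_apply]

/-- The traceless Ricci tensor as a matrix field. -/
noncomputable def ric0 (G : MatrixField) : MatrixField := fun u =>
  ric G u - (scalarCurv G u / 4) • G u

lemma ricci0_apply (G : MatrixField) (u : E4) (a b : Fin 4) :
    ricci0 G u ![a, b] = ric0 G u a b := rfl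

lemma matOf_ricciForm0 (G J : MatrixField) :
    matOf (ricciForm0 G J) = fun u => (J u)ᵀ * ric0 G u := by
  funext u; ext a b
  simp [ricciForm0, ricci0_apply, Matrix.mul_apply]

lemma twist_apply (J : MatrixField) (T : Tensor 2) (u : E4) (a b : Fin 4) :
    twist J T u ![a, b] = ((J u)ᵀ * matOf T u * J u) a b := by
  simp only [twist, Matrix.mul_apply, Matrix.transpose_apply, matOf_apply, Finset.sum_mul,
    Matrix.cons_val_zero, Matrix.cons_val_one]
  rw [Finset.sum_comm]
  exact Finset.sum_congr rfl fun d _ => Finset.sum_congr rfl fun c _ => by ring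

/-- An adapted orthonormal frame at `u`. -/
structure IsAdapted (G J : MatrixField) (u : E4) (P : Matrix (Fin 4) (Fin 4) ℝ) : Prop extends
    IsFrame (G u) P where
  frameJ : J u * P = P * om0ᵀ

section

variable {U : Set E4} {G J : MatrixField} {u : E4} {P : Matrix (Fin 4) (Fin 4) ℝ}

lemma IsAlmostKahlerOn.exists_adapted (h : IsAlmostKahlerOn U G J) (hu : u ∈ U) :
    ∃ P, IsAdapted G J u P := by
  obtain ⟨P, h1, h2⟩ := exists_adapted_frame (G u) (J u) (h.symm u hu) (h.pos u hu) (h.J_sq u hu)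
    (h.orth u hu)
  exact ⟨P, ⟨⟨h1⟩, h2⟩⟩

lemma IsAlmostKahlerOn.smooth_om (h : IsAlmostKahlerOn U G J) : MSmooth U (om G J) :=
  h.smoothJ.transpose.mul h.smooth

lemma IsAlmostKahlerOn.om_eq (h : IsAlmostKahlerOn U G J) (hu : u ∈ U) :
    om G J u = - (G u * J u) := by
  have h1 := congrArg (fun A => A * J u) (h.orth u hu)
  simp only [mul_assoc, h.J_sq u hu] at h1
  rw [← h1, om]; noncomm_ring

lemma IsAlmostKahlerOn.om_transpose (h : IsAlmostKahlerOn U G J) {v : E4} (hv : v ∈ U) :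
    (om G J v)ᵀ = - om G J v := by
  rw [h.om_eq hv, Matrix.transpose_neg, Matrix.transpose_mul, h.symm v hv, ← om, h.om_eq hv]

/-- The lowered form of `J² = -1`. Differentiated once, it makes `∇Ω` anticommute with `Ω`; twice,
it relates `L Ω` to `∑ ∇Ω ∇Ω`. -/
lemma IsAlmostKahlerOn.comp_om_om (h : IsAlmostKahlerOn U G J) {v : E4} (hv : v ∈ U) :
    comp G (om G J) (om G J) v = - G v := by
  have h1 : (J v)ᵀ * (J v)ᵀ = -1 := by
    rw [← Matrix.transpose_mul, h.J_sq v hv, Matrix.transpose_neg, Matrix.transpose_one]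
  have h2 : comp G (om G J) (om G J) v = (J v)ᵀ * (G v * (G v)⁻¹) * (J v)ᵀ * G v := by
    simp only [comp, om, mul_assoc]
  rw [h2, h.mul_inv hv, mul_one, h1, neg_mul, one_mul]

/-- The Ricci form. -/
noncomputable def rho (G J : MatrixField) : MatrixField := fun u => comp G (om G J) (ric G) u

lemma IsAlmostKahlerOn.comp_om (h : IsAlmostKahlerOn U G J) (A : MatrixField) {v : E4} (hv : v ∈ U) :
    comp G (om G J) A v = (J v)ᵀ * A v := by
  have h2 : comp G (om G J) A v = (J v)ᵀ * (G v * (G v)⁻¹) * A v := by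
    simp only [comp, om, mul_assoc]
  rw [h2, h.mul_inv hv, mul_one]

/-- `J`-invariance of `Ric` is the same as commutation with `Ω`; this is why `ρ` is antisymmetric.
-/
lemma IsAlmostKahlerOn.rho_eq (h : IsAlmostKahlerOn U G J) {v : E4} (hv : v ∈ U) :
    rho G J v = comp G (ric G) (om G J) v := by
  have h2 : comp G (ric G) (om G J) v = - (ric G v * ((G v)⁻¹ * G v) * J v) := by
    simp only [comp, h.om_eq hv]; noncomm_ring
  have h1 := congrArg (fun A => A * J v) (h.ricInv v hv)
  simp only [mul_assoc, h.J_sq v hv] at h1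
  rw [show rho G J v = (J v)ᵀ * ric G v from h.comp_om _ hv, h2, h.inv_mul hv, mul_one, ← h1]
  noncomm_ring

lemma IsAlmostKahlerOn.smooth_rho (h : IsAlmostKahlerOn U G J) : MSmooth U (rho G J) :=
  h.smooth_comp h.smooth_om h.smooth_ric

lemma IsAlmostKahlerOn.rho_transpose (h : IsAlmostKahlerOn U G J) {v : E4} (hv : v ∈ U) :
    (rho G J v)ᵀ = - rho G J v := by
  rw [show rho G J v = om G J v * (G v)⁻¹ * ric G v from rfl, Matrix.transpose_mul,
    Matrix.transpose_mul, h.inv_symm hv, h.ric_symm hv, h.om_transpose hv]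
  have e : om G J v * (G v)⁻¹ * ric G v = ric G v * (G v)⁻¹ * om G J v := h.rho_eq hv
  rw [e]; noncomm_ring

lemma IsAlmostKahlerOn.closed_om (h : IsAlmostKahlerOn U G J) {v : E4} (hv : v ∈ U)
    (i j k : Fin 4) : nab G i (om G J) v j k + nab G j (om G J) v k i + nab G k (om G J) v i j = 0 := by
  rw [h.cyclic_nab hv (h.om_transpose hv), ← matOf_fundForm]
  exact h.closed v hv i j k

lemma IsFrame.pull3_mul_right {g : Matrix (Fin 4) (Fin 4) ℝ} (hf : IsFrame g P)
    (F : Fin 4 → Matrix (Fin 4) (Fin 4) ℝ) (B : Matrix (Fin 4) (Fin 4) ℝ) (i : Fin 4) :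
    pull3 P (fun a => F a * g⁻¹ * B) i = pull3 P F i * pull2 P B := by
  simp only [pull3, hf.pull2_comp, Finset.sum_mul, Matrix.smul_mul]

lemma IsFrame.pull3_mul_left {g : Matrix (Fin 4) (Fin 4) ℝ} (hf : IsFrame g P)
    (F : Fin 4 → Matrix (Fin 4) (Fin 4) ℝ) (B : Matrix (Fin 4) (Fin 4) ℝ) (i : Fin 4) :
    pull3 P (fun a => B * g⁻¹ * F a) i = pull2 P B * pull3 P F i := by
  simp only [pull3, hf.pull2_comp, Finset.mul_sum, Matrix.mul_smul]

lemma pull3_zero (i : Fin 4) : pull3 P (fun _ => 0) i = 0 := by simp [pull3, pull2_zero]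

lemma IsFrame.tr_eq (hf : IsFrame (G u) P) (A : MatrixField) :
    tr G A u = (pull2 P (A u)).trace := by
  rw [tr_eq_trace, hf.inv_eq, ← Matrix.trace_transpose (pull2 P (A u)), ← pull2_transpose, pull2,
    mul_assoc, mul_assoc, Matrix.trace_mul_comm P, mul_assoc]

lemma IsFrame.pull2_metric (hf : IsFrame (G u) P) : pull2 P (G u) = 1 := hf.orth

lemma IsAdapted.pull2_om (hf : IsAdapted G J u P) : pull2 P (om G J u) = om0 := by
  have e : pull2 P (om G J u) = (J u * P)ᵀ * (G u * P) := by
    rw [pull2, om, Matrix.transpose_mul]; simp only [mul_assoc]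
  rw [e, hf.frameJ, Matrix.transpose_mul, Matrix.transpose_transpose, mul_assoc, ← mul_assoc Pᵀ,
    hf.orth, mul_one]

lemma IsAdapted.pull2_twist (hf : IsAdapted G J u P) (A : Matrix (Fin 4) (Fin 4) ℝ) :
    pull2 P ((J u)ᵀ * A * J u) = - (om0 * pull2 P A * om0) := by
  have e : pull2 P ((J u)ᵀ * A * J u) = (J u * P)ᵀ * A * (J u * P) := by
    rw [pull2, Matrix.transpose_mul]; simp only [mul_assoc]
  rw [e, hf.frameJ, Matrix.transpose_mul, Matrix.transpose_transpose, om0_transpose, pull2]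
  noncomm_ring

/-- The covariant derivative of the fundamental form in a frame. -/
noncomputable def frameN (G J : MatrixField) (u : E4) (P : Matrix (Fin 4) (Fin 4) ℝ) :
    Fin 4 → Matrix (Fin 4) (Fin 4) ℝ := pull3 P fun a => nab G a (om G J) u

/-- The covariant derivative of the Ricci tensor in a frame. -/
noncomputable def frameD (G : MatrixField) (u : E4) (P : Matrix (Fin 4) (Fin 4) ℝ) :
    Fin 4 → Matrix (Fin 4) (Fin 4) ℝ := pull3 P fun a => nab G a (ric G) u

/-- The three properties are the covariant derivatives of antisymmetry and of `Ω² = -g`, and the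
equation `dΩ = 0`. -/
lemma IsAlmostKahlerOn.isNablaOm (h : IsAlmostKahlerOn U G J) (hu : u ∈ U)
    (hf : IsAdapted G J u P) : IsNablaOm (frameN G J u P) where
  anti i := by
    have h1 : ∀ a, (nab G a (om G J) u)ᵀ = - nab G a (om G J) u := fun a => by
      rw [← nab_transpose, h.nab_congr (fun v hv => h.om_transpose hv) hu]
      simp only [nab, mpd_neg]; noncomm_ring
    simp only [frameN, pull3, Matrix.transpose_sum, Matrix.transpose_smul, ← pull2_transpose, h1,
      pull2_neg, smul_neg, Finset.sum_neg_distrib]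
  anticomm i := by
    have h1 : ∀ a, nab G a (om G J) u * (G u)⁻¹ * om G J u
        + om G J u * (G u)⁻¹ * nab G a (om G J) u = 0 := fun a => by
      have e := h.nab_comp h.smooth_om h.smooth_om hu a
      rw [h.nab_congr (fun v hv => h.comp_om_om hv) hu] at e
      have e0 : nab G a (fun v => - G v) u = 0 := by
        have := h.nab_metric hu a
        simp only [nab, mpd_neg] at this ⊢
        rw [← neg_eq_zero, ← this]; noncomm_ring
      rw [e0] at e
      exact e.symm
    have e := pull3_add (P := P) (fun a => nab G a (om G J) u * (G u)⁻¹ * om G J u)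
      (fun a => om G J u * (G u)⁻¹ * nab G a (om G J) u) i
    rw [hf.pull3_mul_right, hf.pull3_mul_left, hf.pull2_om] at e
    simp only [h1] at e
    rw [pull3_zero] at e
    exact e.symm
  cyclic := cyclic_pull3 fun i j k => h.closed_om hu i j k

lemma IsAlmostKahlerOn.trace_frameD (h : IsAlmostKahlerOn U G J) (hu : u ∈ U)
    (hf : IsAdapted G J u P) (i : Fin 4) :
    (frameD G u P i).trace = ∑ a, P a i * pd a (scalarCurv G) u := by
  have e : ∀ a, pd a (scalarCurv G) u = (pull2 P (nab G a (ric G) u)).trace := fun a => by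
    rw [← hf.tr_eq (nab G a (ric G))]; exact h.pd_tr h.smooth_ric hu a
  simp only [frameD, pull3, Matrix.trace_sum, Matrix.trace_smul, e, smul_eq_mul]

lemma IsAlmostKahlerOn.pull3_nab_rho (h : IsAlmostKahlerOn U G J) (hu : u ∈ U)
    (hf : IsAdapted G J u P) (i : Fin 4) :
    pull3 P (fun a => nab G a (rho G J) u) i
      = frameN G J u P i * pull2 P (ric G u) + om0 * frameD G u P i := by
  have e : ∀ a, nab G a (rho G J) u = nab G a (om G J) u * (G u)⁻¹ * ric G u
      + om G J u * (G u)⁻¹ * nab G a (ric G) u := fun a => h.nab_comp h.smooth_om h.smooth_ric hu a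
  simp only [e]
  rw [pull3_add (fun a => nab G a (om G J) u * (G u)⁻¹ * ric G u), hf.pull3_mul_right,
    hf.pull3_mul_left, hf.pull2_om]
  rfl

/-- The conditions on `∇Ric` are the differentiated symmetry, the differentiated relation `Ω Ric =
Ric Ω`, and the contracted Bianchi identity. -/
lemma IsAlmostKahlerOn.isNablaRic (h : IsAlmostKahlerOn U G J) (hu : u ∈ U)
    (hf : IsAdapted G J u P) :
    IsNablaRic (frameN G J u P) (pull2 P (ric G u)) (frameD G u P) where
  nabla := h.isNablaOm hu hf
  symm := by rw [← pull2_transpose, h.ric_symm hu]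
  comm := by
    have := h.rho_eq hu
    simp only [rho, comp] at this
    have := congrArg (pull2 P) this
    rwa [hf.pull2_comp, hf.pull2_comp, hf.pull2_om] at this
  symmD i := by
    have h1 : ∀ a, (nab G a (ric G) u)ᵀ = nab G a (ric G) u := fun a => by
      rw [← nab_transpose, h.nab_congr (fun v hv => h.ric_symm hv) hu]
    simp only [frameD, pull3, Matrix.transpose_sum, Matrix.transpose_smul, ← pull2_transpose, h1]
  commD i := by
    have e : ∀ a, nab G a (rho G J) u = nab G a (ric G) u * (G u)⁻¹ * om G J u
      + ric G u * (G u)⁻¹ * nab G a (om G J) u := fun a => by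
        rw [h.nab_congr (fun v hv => h.rho_eq hv) hu]
        exact h.nab_comp h.smooth_ric h.smooth_om hu a
    rw [← h.pull3_nab_rho hu hf]
    simp only [e]
    rw [pull3_add (fun a => nab G a (ric G) u * (G u)⁻¹ * om G J u), hf.pull3_mul_right,
      hf.pull3_mul_left, hf.pull2_om]
    rfl
  div k := by
    rw [h.trace_frameD hu hf]
    have e := hf.contract_pull3 (fun a => nab G a (ric G) u) k
    have e2 : ∀ x, ∑ i, ∑ j, (G u)⁻¹ i j * nab G i (ric G) u j x = (1 / 2) * pd x (scalarCurv G) u :=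
      fun x => h.dv_ric hu x
    simp only [e2] at e
    rw [frameD, ← e, Finset.mul_sum]
    exact Finset.sum_congr rfl fun a _ => by ring

lemma IsAlmostKahlerOn.dv_om (h : IsAlmostKahlerOn U G J) {v : E4} (hv : v ∈ U) (k : Fin 4) :
    dv G (om G J) v k = 0 := by
  obtain ⟨P, hf⟩ := h.exists_adapted hv
  refine sum_mul_injective hf.isUnit_det (F := fun k => dv G (om G J) v k) (fun z => ?_) k
  have e := hf.contract_pull3 (fun a => nab G a (om G J) v) z
  exact e.trans ((h.isNablaOm hv hf).div_eq_zero z)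

lemma IsAlmostKahlerOn.closed_rho (h : IsAlmostKahlerOn U G J) {v : E4} (hv : v ∈ U)
    (i j k : Fin 4) :
    nab G i (rho G J) v j k + nab G j (rho G J) v k i + nab G k (rho G J) v i j = 0 := by
  obtain ⟨P, hf⟩ := h.exists_adapted hv
  refine cyclic_of_pull3 (N := fun a => nab G a (rho G J) v) hf.isUnit_det (fun i j k => ?_) i j k
  simp only [h.pull3_nab_rho hv hf]
  exact (h.isNablaRic hv hf).rho.1 i j k

/-- Stated with coordinate components on all of `U`, not only in a frame at one point, because it is
differentiated once more. -/
lemma IsAlmostKahlerOn.dv_rho (h : IsAlmostKahlerOn U G J) {v : E4} (hv : v ∈ U) (k : Fin 4) :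
    dv G (rho G J) v k
      = ∑ c, ∑ d, (1 / 2) * pd c (scalarCurv G) v * (G v)⁻¹ c d * om G J v d k := by
  obtain ⟨P, hf⟩ := h.exists_adapted hv
  rw [← sub_eq_zero]
  refine sum_mul_injective hf.isUnit_det (F := fun k => dv G (rho G J) v k
    - ∑ c, ∑ d, (1 / 2) * pd c (scalarCurv G) v * (G v)⁻¹ c d * om G J v d k) (fun z => ?_) k
  simp only [smul_eq_mul, mul_sub, Finset.sum_sub_distrib]
  rw [sub_eq_zero]
  refine (hf.contract_pull3 (fun a => nab G a (rho G J) v) z).trans ?_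
  simp only [h.pull3_nab_rho hv hf]
  rw [(h.isNablaRic hv hf).rho.2 z]
  simp only [h.trace_frameD hv hf]
  have e1 : (G v)⁻¹ * om G J v * P = P * om0 := by
    rw [← hf.pull2_om, hf.inv_eq, pull2]; simp only [mul_assoc]
  have e2 : ∀ c, ∑ k, P k z * ∑ d, (G v)⁻¹ c d * om G J v d k = ∑ e, P c e * om0 e z := fun c => by
    have := congrFun (congrFun e1 c) z
    rw [Matrix.mul_apply, Matrix.mul_apply] at this
    rw [← this]
    exact Finset.sum_congr rfl fun k _ => by rw [Matrix.mul_apply, mul_comm]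
  have e3 : ∀ k, P k z * ∑ c, ∑ d, (1 / 2) * pd c (scalarCurv G) v * (G v)⁻¹ c d * om G J v d k
      = ∑ c, (1 / 2) * pd c (scalarCurv G) v * (P k z * ∑ d, (G v)⁻¹ c d * om G J v d k) := fun k => by
    rw [Finset.mul_sum]
    refine Finset.sum_congr rfl fun c _ => ?_
    simp only [Finset.mul_sum]
    exact Finset.sum_congr rfl fun d _ => by ring
  simp only [e3]
  rw [Finset.sum_comm]
  simp only [← Finset.mul_sum, e2]
  simp only [Finset.sum_mul, Finset.mul_sum]
  rw [Finset.sum_comm]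
  exact Finset.sum_congr rfl fun a _ => Finset.sum_congr rfl fun c _ => by ring

end

/-! ### The Bach tensor in terms of the Ricci tensor -/

section

variable {U : Set E4} {G : MatrixField}

lemma IsMetricOn.nab2_symm (hG : IsMetricOn U G) {A : MatrixField} (h : ∀ v ∈ U, (A v)ᵀ = A v)
    {u : E4} (hu : u ∈ U) (i j a b : Fin 4) : nab2 G i j A u a b = nab2 G i j A u b a := by
  have h1 : ∀ v ∈ U, ∀ j, (nab G j A v)ᵀ = nab G j A v := fun v hv j => by
    ext a b; exact hG.nab_symm h hv j b a
  simp only [nab2_apply, hG.nab_symm (fun v hv => h1 v hv j) hu i a b, hG.nab_symm h hu _ a b]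

lemma IsMetricOn.nabDv_hM (hG : IsMetricOn U G) {u : E4} (hu : u ∈ U) :
    nabDv G (hM G) u = (1 / 6 : ℝ) • hessM G (scalarCurv G) u := by
  ext k x
  have hd := pd_congr hG.isOpen (fun v hv => hG.dv_hM hv x) hu k
  rw [pd_const_mul ((hG.smooth_scalar.pd hG.isOpen x).diff hG.isOpen hu)] at hd
  simp only [nabDv, hessM, Matrix.of_apply, Matrix.smul_apply, smul_eq_mul, hd, hG.dv_hM hu, mul_sub,
    Finset.mul_sum]
  exact congrArg _ (Finset.sum_congr rfl fun l _ => by ring)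

lemma IsMetricOn.hessM_symm (hG : IsMetricOn U G) {f : E4 → ℝ} (hf : Smooth U f) {u : E4}
    (hu : u ∈ U) : (hessM G f u)ᵀ = hessM G f u := by
  ext i j
  simp only [hessM, Matrix.transpose_apply, Matrix.of_apply, pd_comm hG.isOpen hf hu j i,
    hG.christoffel_symm hu _ j i]

/-- The Bach tensor as a matrix field. -/
lemma IsMetricOn.matOf_bach (hG : IsMetricOn U G) {u : E4} (hu : u ∈ U) :
    matOf (bach G) u = (1 / 6 : ℝ) • hessM G (scalarCurv G) u
      - (curvAct G (hM G) u - comp G (ric G) (hM G) u)ᵀ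
      - ((1 / 2 : ℝ) • lap G (ric G) u + (laplacian G (scalarCurv G) u / 12) • G u)
      - curvAct G (hM G) u - (2 : ℝ) • comp G (hM G) (hM G) u
      + ((G u)⁻¹ * hM G u * (G u)⁻¹ * hM G u).trace • G u
      + ((G u)⁻¹ * hM G u).trace • hM G u := by
  ext x y
  -- The symmetry of `h` puts the contracted index first, so the mixed second derivative is `∇ div
  -- h` minus a curvature commutator.
  have h0 : ∑ i, ∑ j, (G u)⁻¹ i j * (nab2 G i y (hM G) u x j - nab2 G i j (hM G) u x y)
      = (nabDv G (hM G) u y x - commTerm G (hM G) u y x) - lap G (hM G) u x y := by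
    rw [← hG.sum_nab2_swap hG.smooth_hM hu, lap_apply]
    simp only [mul_sub, Finset.sum_sub_distrib,
      fun i j => hG.nab2_symm (fun v hv => hG.hM_symm hv) hu i y x j]
  set h := hM G u with hh
  set g := G u with hg
  set Q := g⁻¹ * h * g⁻¹ with hQ
  have hQt : Qᵀ = Q := by
    have e1 : hᵀ = h := hG.hM_symm hu
    have e2 : (g⁻¹)ᵀ = g⁻¹ := hG.inv_symm hu
    simp only [hQ, Matrix.transpose_mul, e1, e2, mul_assoc]
  have hQs : ∀ i k, Q i k = Q k i := fun i k => congrFun (congrFun hQt k) i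
  have hhs : ∀ i k, h i k = h k i := fun i k => congrFun (congrFun (hG.hM_symm hu) k) i
  have hgs : ∀ i k, g i k = g k i := hG.symm_apply hu
  have h1 : ∑ i, ∑ j, ∑ k, ∑ l, g⁻¹ i j * g⁻¹ k l * h j l * weyl G u ![x, i, k, y]
      = ∑ i, ∑ k, Q i k * weyl G u ![x, i, k, y] := by
    refine Finset.sum_congr rfl fun i _ => ?_
    rw [Finset.sum_comm]
    refine Finset.sum_congr rfl fun k _ => ?_
    simp only [hQ, Matrix.mul_apply, Finset.sum_mul]
    rw [Finset.sum_comm]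
    refine Finset.sum_congr rfl fun l _ => Finset.sum_congr rfl fun j _ => ?_
    rw [show g⁻¹ k l = g⁻¹ l k from hG.inv_symm_apply hu k l]; ring
  -- `t1` to `t5` contract `h`, with both indices raised, with the curvature and with the four
  -- Kulkarni-Nomizu terms in `W`.
  have t1 : ∑ i, ∑ k, Q i k * rm G x i u k y = - curvAct G (hM G) u x y := by
    simp only [curvAct, Matrix.of_apply, ← Finset.sum_neg_distrib]
    refine Finset.sum_congr rfl fun i _ => Finset.sum_congr rfl fun k _ => ?_
    rw [hG.rm_antisymm_right hu x i y k]; ring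
  have gQ : g * Q = h * g⁻¹ := by
    rw [hQ, ← mul_assoc, ← mul_assoc, hG.mul_inv hu, one_mul]
  have t2 : ∑ i, ∑ k, Q i k * (g x k * h i y) = comp G (hM G) (hM G) u x y := by
    have : comp G (hM G) (hM G) u = g * Q * h := by rw [gQ]; rfl
    rw [this]
    simp only [Matrix.mul_apply, Finset.sum_mul]
    exact Finset.sum_congr rfl fun i _ => Finset.sum_congr rfl fun k _ => by rw [hQs i k]; ring
  have t3 : ∑ i, ∑ k, Q i k * (g i y * h x k) = comp G (hM G) (hM G) u x y := by
    have : comp G (hM G) (hM G) u = h * (Q * g) := by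
      rw [hQ, mul_assoc _ _ g, hG.inv_mul hu, mul_one, ← mul_assoc]; rfl
    rw [this]
    simp only [Matrix.mul_apply, Finset.mul_sum]
    rw [Finset.sum_comm]
    exact Finset.sum_congr rfl fun i _ => Finset.sum_congr rfl fun k _ => by rw [hQs]; ring
  have t4 : ∑ i, ∑ k, Q i k * (g x y * h i k) = (Q * h).trace * g x y := by
    simp only [Matrix.trace, Matrix.diag, Matrix.mul_apply, Finset.sum_mul]
    exact Finset.sum_congr rfl fun i _ => Finset.sum_congr rfl fun k _ => by rw [hhs]; ring
  have t5 : ∑ i, ∑ k, Q i k * (g i k * h x y) = (g⁻¹ * h).trace * h x y := by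
    have : g⁻¹ * h = Q * g := by rw [hQ, mul_assoc _ _ g, hG.inv_mul hu, mul_one]
    rw [this]
    simp only [Matrix.trace, Matrix.diag, Matrix.mul_apply, Finset.sum_mul]
    exact Finset.sum_congr rfl fun i _ => Finset.sum_congr rfl fun k _ => by rw [hgs]; ring
  have h2 : ∑ i, ∑ k, Q i k * weyl G u ![x, i, k, y] = - curvAct G (hM G) u x y
      - comp G (hM G) (hM G) u x y - comp G (hM G) (hM G) u x y + (Q * h).trace * g x y
      + (g⁻¹ * h).trace * h x y := by
    have e : ∀ i k, Q i k * weyl G u ![x, i, k, y] = Q i k * rm G x i u k y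
        - Q i k * (g x k * h i y) - Q i k * (g i y * h x k) + Q i k * (g x y * h i k)
        + Q i k * (g i k * h x y) := fun i k => by
      rw [weyl_apply]; ring
    simp only [e, Finset.sum_add_distrib, Finset.sum_sub_distrib, t1, t2, t3, t4, t5]
  have hsym := congrFun (congrFun (hG.hessM_symm hG.smooth_scalar hu) x) y
  rw [Matrix.transpose_apply] at hsym
  rw [matOf_apply, hG.bach_apply hu, h0, h1, h2, hG.nabDv_hM hu, hG.commTerm_eq _ hu, hG.lap_hM hu]
  simp only [Matrix.add_apply, Matrix.sub_apply, Matrix.smul_apply, Matrix.transpose_apply,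
    smul_eq_mul, hsym]
  ring

end

/-! ### The Laplacians of the fundamental form and of the Ricci form -/

section

variable {U : Set E4} {G J : MatrixField} {u : E4} {P : Matrix (Fin 4) (Fin 4) ℝ}

lemma IsAlmostKahlerOn.nabDv_rho (h : IsAlmostKahlerOn U G J) (hu : u ∈ U) :
    nabDv G (rho G J) u = (1 / 2 : ℝ) • (hessM G (scalarCurv G) u * (G u)⁻¹ * om G J u)
      + Matrix.of fun j k => ∑ c, ∑ d, (1 / 2) * pd c (scalarCurv G) u * (G u)⁻¹ c d
          * nab G j (om G J) u d k := by
  ext j k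
  -- The covector `ds/2` is encoded as a matrix with four equal rows, so that the product rule for
  -- bilinear forms applies; only row `0` is used. Equation `e2` removes the connection term on the
  -- artificial row index.
  set M : MatrixField := fun v => Matrix.of fun _ c => (1 / 2) * pd c (scalarCurv G) v with hM'
  have sM : MSmooth U M := fun _ c => (Smooth.const U _).mul (h.smooth_scalar.pd h.isOpen c)
  have hdv : ∀ v ∈ U, ∀ k, dv G (rho G J) v k = comp G M (om G J) v 0 k := fun v hv k => by
    rw [h.dv_rho hv]
    simp only [comp, hM', Matrix.mul_apply, Matrix.of_apply, Finset.sum_mul]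
    exact Finset.sum_comm
  have e := h.nab_comp sM h.smooth_om hu j
  have e2 : mpd j (comp G M (om G J)) u - comp G M (om G J) u * gam G j u
      = (mpd j M u - M u * gam G j u) * (G u)⁻¹ * om G J u
        + M u * (G u)⁻¹ * nab G j (om G J) u := by
    rw [nab] at e
    rw [sub_right_comm, sub_eq_iff_eq_add] at e
    rw [e]
    simp only [comp, nab]; noncomm_ring
  have e3 := congrFun (congrFun e2 0) k
  have e4 : ∀ c, (mpd j M u - M u * gam G j u) 0 c = (1 / 2) * hessM G (scalarCurv G) u j c := by
    intro c
    have : pd j (fun v => M v 0 c) u = (1 / 2) * pd j (pd c (scalarCurv G)) u :=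
      pd_const_mul ((h.smooth_scalar.pd h.isOpen c).diff h.isOpen hu) _ _
    rw [Matrix.sub_apply, mpd_apply, this]
    simp only [Matrix.mul_apply, hessM, Matrix.of_apply, hM', gam_apply, mul_sub, Finset.mul_sum]
    exact congrArg _ (Finset.sum_congr rfl fun l _ => by ring)
  have e5 : nabDv G (rho G J) u j k
      = (mpd j (comp G M (om G J)) u - comp G M (om G J) u * gam G j u) 0 k := by
    have : pd j (fun v => dv G (rho G J) v k) u = pd j (fun v => comp G M (om G J) v 0 k) u :=
      pd_congr h.isOpen (fun v hv => hdv v hv k) hu j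
    rw [nabDv, Matrix.of_apply, this, Matrix.sub_apply, mpd_apply, Matrix.mul_apply]
    simp only [hdv u hu, gam_apply]
    exact congrArg _ (Finset.sum_congr rfl fun l _ => mul_comm _ _)
  rw [e5, e3, Matrix.add_apply, Matrix.add_apply]
  congr 1
  · rw [Matrix.smul_apply, mul_assoc, mul_assoc, Matrix.mul_apply, Matrix.mul_apply]
    simp only [e4, smul_eq_mul, Finset.mul_sum]
    exact Finset.sum_congr rfl fun l _ => by ring
  · simp only [hM', Matrix.mul_apply, Matrix.of_apply, Finset.sum_mul]
    exact Finset.sum_comm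

end

section

variable {U : Set E4} {G J : MatrixField} {u : E4} {P : Matrix (Fin 4) (Fin 4) ℝ}

/-! ### The Bach tensor in an adapted frame -/

lemma IsFrame.pull2_curvAct_eq (hf : IsFrame (G u) P) (A : MatrixField) :
    pull2 P (curvAct G A u) = actAlg (frameRm G u P) (pull2 P (A u)) := by
  ext x y; exact hf.pull2_curvAct A x y

lemma IsMetricOn.pull2_ric (hG : IsMetricOn U G) (hu : u ∈ U) (hf : IsFrame (G u) P) :
    pull2 P (ric G u) = actAlg (frameRm G u P) 1 := by
  rw [← hG.curvAct_metric hu, hf.pull2_curvAct_eq, hf.pull2_metric]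

lemma IsFrame.pull2_comp_eq (hf : IsFrame (G u) P) (A B : MatrixField) :
    pull2 P (comp G A B u) = pull2 P (A u) * pull2 P (B u) := hf.pull2_comp _ _

lemma IsFrame.trace_inv_mul (hf : IsFrame (G u) P) (A : Matrix (Fin 4) (Fin 4) ℝ) :
    ((G u)⁻¹ * A).trace = (pull2 P A).trace := by
  rw [hf.inv_eq, pull2, mul_assoc, mul_assoc, Matrix.trace_mul_comm P, mul_assoc]

lemma IsFrame.trace_pull2_ric (hf : IsFrame (G u) P) :
    (pull2 P (ric G u)).trace = scalarCurv G u := by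
  rw [scalarCurv_eq, hf.tr_eq]

lemma IsFrame.pull2_hM (hf : IsFrame (G u) P) :
    pull2 P (hM G u) = (1 / 2 : ℝ) • (pull2 P (ric G u) - (scalarCurv G u / 6) • 1) := by
  rw [hM, pull2_smul, pull2_sub, pull2_smul, hf.pull2_metric]

/-- Substituting `h = (Ric - (s/6) g)/2`, the term `Ric²` from the commutator cancels the one from
the Kulkarni-Nomizu part of `W`. -/
lemma IsMetricOn.pull2_bach (hG : IsMetricOn U G) (hu : u ∈ U) (hf : IsFrame (G u) P) :
    pull2 P (matOf (bach G) u) = (1 / 6 : ℝ) • pull2 P (hessM G (scalarCurv G) u)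
      - actAlg (frameRm G u P) (pull2 P (ric G u)) - (1 / 2 : ℝ) • pull2 P (lap G (ric G) u)
      - (laplacian G (scalarCurv G) u / 12) • 1 + (scalarCurv G u / 3) • pull2 P (ric G u)
      + ((pull2 P (ric G u) * pull2 P (ric G u)).trace / 4 - scalarCurv G u ^ 2 / 12) • 1 := by
  have hR := hG.isAlgCurv hu P
  have hr := hG.pull2_ric hu hf
  have hrt : (pull2 P (ric G u))ᵀ = pull2 P (ric G u) := by
    rw [← pull2_transpose, hG.ric_symm hu]
  have htr := hf.trace_pull2_ric
  rw [hG.matOf_bach hu]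
  simp only [pull2_add, pull2_sub, pull2_smul, pull2_transpose, hf.pull2_curvAct_eq,
    hf.pull2_comp_eq, hf.pull2_metric, hf.trace_inv_mul, hf.pull2_hM]
  have e1 : ((G u)⁻¹ * hM G u * (G u)⁻¹ * hM G u).trace
      = (pull2 P (hM G u) * pull2 P (hM G u)).trace := by
    rw [← hf.pull2_comp, ← hf.trace_inv_mul]; simp only [mul_assoc]
  rw [e1, hf.pull2_hM]
  set r := pull2 P (ric G u) with hrdef
  set s := scalarCurv G u
  have e2 : actAlg (frameRm G u P) ((1 / 2 : ℝ) • (r - (s / 6) • (1 : Matrix (Fin 4) (Fin 4) ℝ)))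
      = (1 / 2 : ℝ) • (actAlg (frameRm G u P) r - (s / 6) • r) := by
    rw [actAlg_smul, sub_eq_add_neg, ← neg_smul, actAlg_add, actAlg_smul, ← hr, neg_smul,
      ← sub_eq_add_neg]
  have e3 : (actAlg (frameRm G u P) r)ᵀ = actAlg (frameRm G u P) r := by
    rw [← hR.actAlg_transpose, hrt]
  rw [e2]
  simp only [Matrix.transpose_sub, Matrix.transpose_smul, Matrix.transpose_mul, e3, hrt,
    Matrix.smul_mul, Matrix.mul_smul, sub_mul, mul_sub, one_mul, mul_one,
    Matrix.trace_smul, Matrix.trace_sub, Matrix.trace_one, htr, smul_eq_mul, Fintype.card_fin]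
  module

/-- The pulled back contraction of the covariant derivatives. -/
lemma IsFrame.sum_pull2_comp (hf : IsFrame (G u) P) (N D : Fin 4 → MatrixField) :
    pull2 P (∑ i, ∑ j, (G u)⁻¹ i j • comp G (N i) (D j) u)
      = ∑ e, pull3 P (fun a => N a u) e * pull3 P (fun a => D a u) e :=
  hf.sum_pull2 (fun a => N a u) (fun a => D a u)

/-- The second-order Leibniz rule; the two mixed terms agree since `g⁻¹` is symmetric, hence the
factor `2`. -/
lemma IsMetricOn.lap_comp (hG : IsMetricOn U G) {A B : MatrixField} (hA : MSmooth U A)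
    (hB : MSmooth U B) (hu : u ∈ U) (hf : IsFrame (G u) P) :
    pull2 P (lap G (comp G A B) u) = pull2 P (lap G A u) * pull2 P (B u)
      + (2 : ℝ) • (∑ e, pull3 P (fun a => nab G a A u) e * pull3 P (fun a => nab G a B u) e)
      + pull2 P (A u) * pull2 P (lap G B u) := by
  have e1 : lap G (comp G A B) u = lap G A u * (G u)⁻¹ * B u
      + ∑ i, ∑ j, (G u)⁻¹ i j • comp G (nab G i A) (nab G j B) u
      + ∑ i, ∑ j, (G u)⁻¹ i j • comp G (nab G i A) (nab G j B) u
      + A u * (G u)⁻¹ * lap G B u := by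
    have sw : ∑ i, ∑ j, (G u)⁻¹ i j • comp G (nab G i A) (nab G j B) u
        = ∑ i, ∑ j, (G u)⁻¹ i j • comp G (nab G j A) (nab G i B) u := by
      rw [Finset.sum_comm]
      exact Finset.sum_congr rfl fun i _ => Finset.sum_congr rfl fun j _ => by
        rw [hG.inv_symm_apply hu]
    nth_rewrite 1 [sw]
    simp only [lap, hG.nab2_comp hA hB hu, Finset.sum_mul, Finset.mul_sum, smul_add,
      Finset.sum_add_distrib, Matrix.smul_mul, Matrix.mul_smul]
    rfl
  rw [e1, pull2_add, pull2_add, pull2_add, hf.pull2_comp, hf.pull2_comp, hf.sum_pull2_comp]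
  module

/-- In the Weitzenböck formula only the curvature terms survive, `Ω` being coclosed. -/
lemma IsAlmostKahlerOn.pull2_lap_om (h : IsAlmostKahlerOn U G J) (hu : u ∈ U)
    (hf : IsAdapted G J u P) :
    pull2 P (lap G (om G J) u) = om0 * pull2 P (ric G u) + pull2 P (ric G u) * om0
      - (2 : ℝ) • actAlg (frameRm G u P) om0 := by
  have hR := h.isAlgCurv hu P
  have h0 : nabDv G (om G J) u = 0 := by
    ext k x
    have := pd_congr h.isOpen (fun v hv => h.dv_om hv x) hu k
    simp [nabDv, this, pd_const, h.dv_om hu]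
  have hrt : (pull2 P (ric G u))ᵀ = pull2 P (ric G u) := by
    rw [← pull2_transpose, h.ric_symm hu]
  have hat : (actAlg (frameRm G u P) om0)ᵀ = - actAlg (frameRm G u P) om0 := by
    rw [← hR.actAlg_transpose, om0_transpose, ← neg_one_smul ℝ om0, actAlg_smul, neg_one_smul]
  rw [h.lap_closed h.smooth_om (fun v hv => h.om_transpose hv) (fun v hv => h.closed_om hv) hu, h0,
    h.commTerm_eq _ hu]
  simp only [pull2_add, pull2_sub, pull2_transpose, hf.pull2_curvAct_eq, hf.pull2_comp_eq,
    hf.pull2_om, Matrix.transpose_sub, Matrix.transpose_mul, Matrix.transpose_zero, pull2_zero, hrt,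
    hat, om0_transpose, neg_mul]
  module

/-- In the Weitzenböck formula for `ρ`, differentiating the divergence `ds ∘ Ω / 2` gives the
Hessian terms and the contraction of `ds` with `∇Ω`. -/
lemma IsAlmostKahlerOn.pull2_lap_rho (h : IsAlmostKahlerOn U G J) (hu : u ∈ U)
    (hf : IsAdapted G J u P) :
    pull2 P (lap G (rho G J) u)
      = (1 / 2 : ℝ) • (pull2 P (hessM G (scalarCurv G) u) * om0
          + om0 * pull2 P (hessM G (scalarCurv G) u)
          + ∑ e, (frameD G u P e).trace • frameN G J u P e)
        + (2 : ℝ) • (pull2 P (ric G u) * om0 * pull2 P (ric G u))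
        - (2 : ℝ) • actAlg (frameRm G u P) (om0 * pull2 P (ric G u)) := by
  have hR := h.isAlgCurv hu P
  have hrt : (pull2 P (ric G u))ᵀ = pull2 P (ric G u) := by
    rw [← pull2_transpose, h.ric_symm hu]
  have hHt : (pull2 P (hessM G (scalarCurv G) u))ᵀ = pull2 P (hessM G (scalarCurv G) u) := by
    rw [← pull2_transpose, h.hessM_symm h.smooth_scalar hu]
  have hrho : pull2 P (rho G J u) = om0 * pull2 P (ric G u) := by
    rw [rho, hf.pull2_comp_eq, hf.pull2_om]
  have hcomm : pull2 P (ric G u) * om0 = om0 * pull2 P (ric G u) := (h.isNablaRic hu hf).comm.symm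
  have hat : (actAlg (frameRm G u P) (om0 * pull2 P (ric G u)))ᵀ
      = - actAlg (frameRm G u P) (om0 * pull2 P (ric G u)) := by
    rw [← hR.actAlg_transpose, Matrix.transpose_mul, om0_transpose, hrt, mul_neg, hcomm,
      ← neg_one_smul ℝ, actAlg_smul, neg_one_smul]
  set X : Matrix (Fin 4) (Fin 4) ℝ := Matrix.of fun j k => ∑ c, ∑ d,
    (1 / 2) * pd c (scalarCurv G) u * (G u)⁻¹ c d * nab G j (om G J) u d k with hX
  have anti : ∀ d a b, nab G d (om G J) u a b = - nab G d (om G J) u b a := fun d a b => by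
    have e : nab G d (fun v => (om G J v)ᵀ) u = nab G d (fun v => - om G J v) u :=
      h.nab_congr (fun v hv => h.om_transpose hv) hu d
    rw [nab_transpose] at e
    have e2 : nab G d (fun v => - om G J v) u = - nab G d (om G J) u := by
      simp only [nab, mpd_neg]; noncomm_ring
    rw [e2] at e
    exact congrFun (congrFun e b) a
  -- Closedness of `Ω` turns the antisymmetrised contraction of `ds` with `∇_j Ω_{dk}` into the
  -- derivative of `Ω` along the gradient of `s`.
  have hXX : X - Xᵀ = (1 / 2 : ℝ) • ∑ c, ∑ d,
      (pd c (scalarCurv G) u * (G u)⁻¹ c d) • nab G d (om G J) u := by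
    ext j k
    simp only [hX, Matrix.sub_apply, Matrix.transpose_apply, Matrix.of_apply, Matrix.smul_apply,
      Matrix.sum_apply, smul_eq_mul, ← Finset.sum_sub_distrib, Finset.mul_sum]
    refine Finset.sum_congr rfl fun c _ => Finset.sum_congr rfl fun d _ => ?_
    linear_combination (-(1 / 2) * pd c (scalarCurv G) u * (G u)⁻¹ c d) * h.closed_om hu d j k
      + ((1 / 2) * pd c (scalarCurv G) u * (G u)⁻¹ c d) * anti j d k
  have hN : pull2 P (X - Xᵀ) = (1 / 2 : ℝ) • ∑ e, (frameD G u P e).trace • frameN G J u P e := by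
    rw [hXX, pull2_smul]
    congr 1
    simp only [h.trace_frameD hu hf, frameN, pull3, pull2_sum, pull2_smul, hf.inv_eq,
      Matrix.mul_apply, Matrix.transpose_apply, Finset.mul_sum, Finset.sum_mul, Finset.sum_smul,
      Finset.smul_sum, smul_smul]
    rw [Finset.sum_congr rfl fun c _ => Finset.sum_comm, Finset.sum_comm]
    refine Finset.sum_congr rfl fun e _ => ?_
    rw [Finset.sum_comm]
    refine Finset.sum_congr rfl fun d _ => Finset.sum_congr rfl fun c _ => ?_
    congr 1; ring
  rw [h.lap_closed h.smooth_rho (fun v hv => h.rho_transpose hv) (fun v hv => h.closed_rho hv) hu,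
    h.nabDv_rho hu, h.commTerm_eq _ hu, ← hX]
  simp only [pull2_add, pull2_sub, pull2_smul, pull2_transpose, hf.pull2_curvAct_eq,
    hf.pull2_comp_eq, hf.pull2_om, hf.pull2_comp, Matrix.transpose_sub,
    Matrix.transpose_add, Matrix.transpose_smul, hrho, hat] at hN ⊢
  simp only [Matrix.transpose_mul, hrt, hHt, om0_transpose, neg_mul, mul_neg]
  rw [smul_add, ← hN, mul_assoc _ om0]
  module

end

/-- The algebra behind the Bach tensor formula: `l` and `lΩ`, `lρ` are the Laplacians of the Ricci
tensor, the fundamental form and the Ricci form, `H` is the Hessian of the scalar curvature, and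
`NN`, `ND`, `Nt` are the contractions of the first derivatives. -/
lemma IsAlgCurv.lap_ric_add {R : Fin 4 → Fin 4 → Fin 4 → Fin 4 → ℝ} (hR : IsAlgCurv R)
    {r l lΩ lρ H NN ND Nt : Matrix (Fin 4) (Fin 4) ℝ} (hr : r = actAlg R 1)
    (hJ : om0 * r = r * om0)
    (h1 : lΩ = om0 * r + r * om0 - (2 : ℝ) • actAlg R om0)
    (h2 : lρ = (1 / 2 : ℝ) • (H * om0 + om0 * H + Nt) + (2 : ℝ) • (r * om0 * r)
      - (2 : ℝ) • actAlg R (om0 * r))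
    (h3 : lρ = lΩ * r + (2 : ℝ) • ND + om0 * l)
    (h4 : lΩ * om0 + (2 : ℝ) • NN + om0 * lΩ = 0) :
    l + (2 : ℝ) • (NN * (r - (r.trace / 4) • 1) - om0 * ND + (1 / 4 : ℝ) • (om0 * Nt))
      = (1 / 2 : ℝ) • (H - om0 * H * om0)
        + (2 : ℝ) • (- actAlg R r + (r.trace / 2) • r
          + ((r * r).trace / 4 - r.trace ^ 2 / 8) • 1) := by
  have q := hR.quadratic (by rw [← hr]; exact hJ)
  rw [← hr] at q
  have WW : ∀ A : Matrix (Fin 4) (Fin 4) ℝ, om0 * (om0 * A) = - A := fun A => by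
    rw [← mul_assoc, om0_sq, neg_one_mul]
  -- The twice differentiated relation `Ω² = -g`, with the Weitzenböck value of `L Ω`, makes `∑ ∇Ω
  -- ∇Ω` purely algebraic in the curvature.
  have eNN : NN = (2 : ℝ) • r + actAlg R om0 * om0 + om0 * actAlg R om0 := by
    have e : (2 : ℝ) • NN = (2 : ℝ) • ((2 : ℝ) • r + actAlg R om0 * om0 + om0 * actAlg R om0) := by
      rw [h1] at h4
      simp only [sub_mul, mul_sub, add_mul, mul_add, Matrix.smul_mul, Matrix.mul_smul, mul_assoc,
        WW, ← hJ] at h4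
      rw [← sub_eq_zero, ← h4]; module
    have := congrArg (fun A => (1 / 2 : ℝ) • A) e
    simpa [smul_smul] using this
  -- Equate the two expressions for `L ρ` and multiply by `Ω`, whose square is `-1`, to isolate `L
  -- Ric`.
  have el : l = (1 / 2 : ℝ) • (H - om0 * H * om0) - (1 / 2 : ℝ) • (om0 * Nt)
      + (2 : ℝ) • (om0 * actAlg R (om0 * r)) - (2 : ℝ) • (om0 * actAlg R om0 * r)
      + (2 : ℝ) • (om0 * ND) := by
    have e := congrArg (fun A => om0 * A) (h3.symm.trans h2)
    rw [h1] at e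
    simp only [sub_mul, mul_sub, add_mul, mul_add, Matrix.smul_mul, Matrix.mul_smul, mul_assoc,
      WW, ← hJ, smul_add] at e ⊢
    linear_combination (norm := module) (-1 : ℝ) • e
  rw [← eNN] at q
  rw [show - actAlg R r + (r.trace / 2) • r + ((r * r).trace / 4 - r.trace ^ 2 / 8) • 1 = _
    from q.symm, el]
  module

/-! ### The tensor `S` and the formula for `B` -/

section

variable {U : Set E4} {G J : MatrixField} {u : E4} {P : Matrix (Fin 4) (Fin 4) ℝ}

/-- The tensor `∇ρ₀` in a frame. -/
noncomputable def frameE (G J : MatrixField) (u : E4) (P : Matrix (Fin 4) (Fin 4) ℝ) :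
    Fin 4 → Matrix (Fin 4) (Fin 4) ℝ := pull3 P fun a => nab G a (comp G (om G J) (ric0 G)) u

lemma IsMetricOn.smooth_ric0 (hG : IsMetricOn U G) : MSmooth U (ric0 G) :=
  hG.smooth_ric.sub (MSmooth.smul (by
    simpa [div_eq_mul_inv] using hG.smooth_scalar.mul (Smooth.const U 4⁻¹)) hG.smooth)

lemma IsMetricOn.nab_ric0 (hG : IsMetricOn U G) (hu : u ∈ U) (a : Fin 4) :
    nab G a (ric0 G) u = nab G a (ric G) u - (pd a (scalarCurv G) u / 4) • G u := by
  have hs : Smooth U (fun v => scalarCurv G v / 4) := by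
    simpa [div_eq_mul_inv] using hG.smooth_scalar.mul (Smooth.const U 4⁻¹)
  have e : nab G a (ric0 G) u = nab G a (fun v => ric G v - (scalarCurv G v / 4) • G v) u := rfl
  rw [e, hG.nab_sub hG.smooth_ric (MSmooth.smul hs hG.smooth) hu, hG.nab_smul hG.smooth hs hu,
    hG.nab_metric hu, smul_zero, add_zero, pd_div_const (hG.smooth_scalar.diff hG.isOpen hu)]

lemma IsFrame.pull2_ric0 (hf : IsFrame (G u) P) :
    pull2 P (ric0 G u) = pull2 P (ric G u) - ((pull2 P (ric G u)).trace / 4) • 1 := by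
  rw [ric0, pull2_sub, pull2_smul, hf.pull2_metric, hf.trace_pull2_ric]

lemma IsAlmostKahlerOn.frameE_eq (h : IsAlmostKahlerOn U G J) (hu : u ∈ U)
    (hf : IsAdapted G J u P) (i : Fin 4) :
    frameE G J u P i
      = frameN G J u P i * (pull2 P (ric G u) - ((pull2 P (ric G u)).trace / 4) • 1)
        + om0 * (frameD G u P i - ((frameD G u P i).trace / 4) • 1) := by
  have e : ∀ a, nab G a (comp G (om G J) (ric0 G)) u
      = nab G a (om G J) u * (G u)⁻¹ * ric0 G u
        + om G J u * (G u)⁻¹ * nab G a (ric0 G) u :=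
    fun a => h.nab_comp h.smooth_om h.smooth_ric0 hu a
  have e2 : pull3 P (fun a => nab G a (ric0 G) u) i
      = frameD G u P i - ((frameD G u P i).trace / 4) • 1 := by
    rw [h.trace_frameD hu hf]
    simp only [h.nab_ric0 hu, frameD, pull3, pull2_sub, pull2_smul, hf.pull2_metric, smul_sub,
      Finset.sum_sub_distrib, smul_smul, Finset.sum_div, Finset.sum_smul, mul_div_assoc]
  simp only [frameE, e]
  rw [pull3_add (fun a => nab G a (om G J) u * (G u)⁻¹ * ric0 G u), hf.pull3_mul_right,
    hf.pull3_mul_left, hf.pull2_om, e2, hf.pull2_ric0]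
  rfl

/-- Composing endomorphisms reverses the order of the matrices of the bilinear forms, so the factor
`∇Ω` stands on the left. -/
lemma IsAlmostKahlerOn.pull2_tensorS (h : IsAlmostKahlerOn U G J) (hu : u ∈ U)
    (hf : IsFrame (G u) P) :
    pull2 P (matOf (tensorS G J) u) = ∑ e, frameN G J u P e * frameE G J u P e := by
  have e0 : ∀ i, nab G i (matOf (ricciForm0 G J)) u = nab G i (comp G (om G J) (ric0 G)) u :=
    fun i => h.nab_congr (fun v hv => by rw [matOf_ricciForm0, h.comp_om _ hv]) hu i
  have e : matOf (tensorS G J) u = ∑ i, ∑ j, (G u)⁻¹ i j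
      • comp G (nab G i (om G J)) (nab G j (comp G (om G J) (ric0 G))) u := by
    rw [Finset.sum_comm]
    ext a b
    simp only [matOf_apply, tensorS, covDeriv_matOf, matOf_fundForm, e0, Matrix.sum_apply,
      Matrix.smul_apply, smul_eq_mul, comp, Matrix.mul_apply, Finset.sum_mul]
    refine Finset.sum_congr rfl fun i _ => Finset.sum_congr rfl fun j _ => ?_
    rw [h.inv_symm_apply hu i j, Finset.sum_comm]
    rfl
  rw [e, hf.sum_pull2_comp]
  rfl

lemma IsAlmostKahlerOn.frame_mul (h : IsAlmostKahlerOn U G J) (hu : u ∈ U)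
    (hf : IsAdapted G J u P) (i : Fin 4) : ∃ a b p x y, frameN G J u P i = selfDual a b
      ∧ frameE G J u P i = antiSelfDual p x y := by
  obtain ⟨p, x, y, e⟩ := (h.isNablaRic hu hf).exists_antiSelfDual i
  exact ⟨_, _, p, x, y, eq_selfDual ((h.isNablaOm hu hf).anti i) ((h.isNablaOm hu hf).anticomm i),
    (h.frameE_eq hu hf i).trans e⟩

/-- Transposing a product of two commuting antisymmetric matrices does not change it. -/
lemma IsAlmostKahlerOn.tensorS_symm (h : IsAlmostKahlerOn U G J) (hu : u ∈ U) :
    (matOf (tensorS G J) u)ᵀ = matOf (tensorS G J) u := by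
  obtain ⟨P, hf⟩ := h.exists_adapted hu
  refine pull2_injective hf.isUnit_det ?_
  rw [pull2_transpose, h.pull2_tensorS hu hf.toIsFrame, Matrix.transpose_sum]
  refine Finset.sum_congr rfl fun i _ => ?_
  have ha := (h.isNablaOm hu hf).anti i
  obtain ⟨a, b, p, x, y, e1, e2⟩ := h.frame_mul hu hf i
  rw [Matrix.transpose_mul, ha, e1, e2, antiSelfDual_transpose, neg_mul_neg,
    selfDual_comm_antiSelfDual]

/-- `Ω` anticommutes with `∇Ω` and commutes with `∇ρ₀`, so it anticommutes with their products. -/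
lemma IsAlmostKahlerOn.tensorS_anti (h : IsAlmostKahlerOn U G J) (hu : u ∈ U) :
    (J u)ᵀ * matOf (tensorS G J) u * J u = - matOf (tensorS G J) u := by
  obtain ⟨P, hf⟩ := h.exists_adapted hu
  refine pull2_injective hf.isUnit_det ?_
  rw [hf.pull2_twist, pull2_neg, h.pull2_tensorS hu hf.toIsFrame, Finset.mul_sum, Finset.sum_mul]
  congr 1
  refine Finset.sum_congr rfl fun i _ => ?_
  have ha := eq_neg_of_add_eq_zero_right ((h.isNablaOm hu hf).anticomm i)
  obtain ⟨a, b, p, x, y, e1, e2⟩ := h.frame_mul hu hf i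
  rw [← mul_assoc, ha, e2, neg_mul, neg_mul, mul_assoc, mul_assoc, ← om0_comm_antiSelfDual,
    ← mul_assoc om0, om0_sq, neg_one_mul, mul_neg, neg_neg]

/-- **The Bach tensor of an almost Kähler metric with `J`-invariant Ricci tensor.** -/
theorem IsAlmostKahlerOn.matOf_bach_eq (h : IsAlmostKahlerOn U G J) (hu : u ∈ U) :
    matOf (bach G) u
      = -(1 / 6 : ℝ) • (hessM G (scalarCurv G) u + (J u)ᵀ * hessM G (scalarCurv G) u * J u)
        + (1 / 12 : ℝ) • (hessM G (scalarCurv G) u - (J u)ᵀ * hessM G (scalarCurv G) u * J u)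
        - (laplacian G (scalarCurv G) u / 12) • G u - (scalarCurv G u / 6) • ric0 G u
        + matOf (tensorS G J) u := by
  obtain ⟨P, hf⟩ := h.exists_adapted hu
  refine pull2_injective hf.isUnit_det ?_
  have hR := h.isAlgCurv hu P
  have hr := h.pull2_ric hu hf.toIsFrame
  have hn := h.isNablaRic hu hf
  have h2 := h.pull2_lap_rho hu hf
  have h3 : pull2 P (lap G (rho G J) u) = _ := h.lap_comp h.smooth_om h.smooth_ric hu hf.toIsFrame
  have h4 := h.lap_comp h.smooth_om h.smooth_om hu hf.toIsFrame
  rw [hf.pull2_om] at h3 h4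
  -- `Ω² = -g` is parallel, so its Laplacian vanishes.
  have z : lap G (comp G (om G J) (om G J)) u = 0 := by
    have e : ∀ i j, nab2 G i j (comp G (om G J) (om G J)) u = 0 := fun i j => by
      rw [h.nab2_congr (B := fun v => (-1 : ℝ) • G v)
        (fun v hv => by rw [h.comp_om_om hv, neg_one_smul]) hu,
        h.nab2_const_smul h.smooth _ hu]
      have e1 : ∀ v ∈ U, nab G j G v = (fun _ => 0 : MatrixField) v := fun v hv => h.nab_metric hv j
      simp [nab2, h.nab_congr e1 hu, nab_zero, h.nab_metric hu]
    simp [lap, e]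
  rw [z, pull2_zero] at h4
  have key := hR.lap_ric_add hr hn.comm (h.pull2_lap_om hu hf) h2 h3 h4.symm
  -- Expand `∇ρ₀ = ∇Ω Ric₀ + Ω ∇Ric₀` and move `Ω` to the left past `∇Ω`, which changes the sign.
  -- The last sum comes from the trace part of `∇Ric₀`.
  have eS : pull2 P (matOf (tensorS G J) u)
      = (∑ e, frameN G J u P e * frameN G J u P e)
          * (pull2 P (ric G u) - ((pull2 P (ric G u)).trace / 4) • 1)
        - om0 * (∑ e, frameN G J u P e * frameD G u P e)
        + (1 / 4 : ℝ) • (om0 * ∑ e, (frameD G u P e).trace • frameN G J u P e) := by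
    rw [h.pull2_tensorS hu hf.toIsFrame, Finset.sum_mul, Finset.mul_sum, Finset.mul_sum,
      Finset.smul_sum, ← Finset.sum_sub_distrib, ← Finset.sum_add_distrib]
    refine Finset.sum_congr rfl fun i _ => ?_
    have ha := eq_neg_of_add_eq_zero_left (hn.nabla.anticomm i)
    rw [h.frameE_eq hu hf, mul_add, ← mul_assoc, ← mul_assoc (frameN G J u P i) om0, ha]
    simp only [mul_sub, neg_mul, Matrix.mul_smul, mul_one, mul_assoc]
    module
  have key2 := (congrArg (fun A => pull2 P (lap G (ric G) u) + (2 : ℝ) • A) eS).trans key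
  rw [h.pull2_bach hu hf.toIsFrame, eq_sub_of_add_eq key2]
  simp only [pull2_add, pull2_sub, pull2_smul, hf.pull2_twist, hf.pull2_metric, hf.pull2_ric0,
    hf.trace_pull2_ric]
  module

lemma IsAlmostKahlerOn.ric0_twist (h : IsAlmostKahlerOn U G J) (hu : u ∈ U) :
    (J u)ᵀ * ric0 G u * J u = ric0 G u := by
  simp only [ric0, mul_sub, sub_mul, Matrix.mul_smul, Matrix.smul_mul, h.ricInv u hu, h.orth u hu]

/-- A Bach flat metric of constant nonzero scalar curvature is Einstein. -/
theorem IsAlmostKahlerOn.ric0_eq_zero_of_bach_eq_zero (h : IsAlmostKahlerOn U G J) {c : ℝ}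
    (hc : c ≠ 0) (hs : ∀ v ∈ U, scalarCurv G v = c) (hu : u ∈ U) (hB : matOf (bach G) u = 0) :
    ric0 G u = 0 := by
  have d1 : ∀ v ∈ U, ∀ j, pd j (scalarCurv G) v = 0 := fun v hv j =>
    (pd_congr h.isOpen hs hv j).trans (pd_const c v j)
  have hH : hessM G (scalarCurv G) u = 0 := by
    ext i j
    simp [hessM, (pd_congr h.isOpen (fun v hv => d1 v hv j) hu i).trans (pd_const 0 u i), d1 u hu]
  have hL : laplacian G (scalarCurv G) u = 0 := by simp [laplacian, hess_apply, hH]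
  have e := h.matOf_bach_eq hu
  rw [hB, hH, hL, hs u hu] at e
  simp only [mul_zero, zero_mul, add_zero, sub_zero, smul_zero, zero_div, zero_smul, zero_sub] at e
  have hS : matOf (tensorS G J) u = (c / 6) • ric0 G u := by
    rw [← sub_eq_zero, e]; abel
  -- Now `(c/6) Ric₀` is both `J`-invariant and `J`-anti-invariant.
  have ha := h.tensorS_anti hu
  rw [hS, Matrix.mul_smul, Matrix.smul_mul, h.ric0_twist hu, eq_neg_iff_add_eq_zero,
    ← add_smul] at ha
  exact (smul_eq_zero.1 ha).resolve_left fun h0 => hc (by linarith)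

end

/-! ### Components in a basis -/

lemma sum_basisVec (v : E4) : v = ∑ c, v c • basisVec c := by
  ext i; simp [basisVec, Finset.sum_apply, Pi.single_apply]

section

variable {V : Type*} [AddCommGroup V] [Module ℝ V] [TopologicalSpace V]
  {L : E4 →L[ℝ] V} {L' : V →L[ℝ] E4} {g : V →L[ℝ] V →L[ℝ] ℝ} {J : V →L[ℝ] V}

lemma map_sum_basisVec (L : E4 →L[ℝ] V) (v : E4) : L v = ∑ c, v c • L (basisVec c) := by
  conv_lhs => rw [sum_basisVec v]
  simp only [map_sum, map_smul]

/-- The matrix of an endomorphism in the basis `L (basisVec i)`. -/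
noncomputable def endoMatrix (L : E4 →L[ℝ] V) (L' : V →L[ℝ] E4) (J : V →L[ℝ] V) : Matrix (Fin 4) (Fin 4) ℝ :=
  Matrix.of fun c a => L' (J (L (basisVec a))) c

/-- The matrix of a bilinear form in the basis `L (basisVec i)`. -/
noncomputable def formMatrix (L : E4 →L[ℝ] V) (g : V →L[ℝ] V →L[ℝ] ℝ) : Matrix (Fin 4) (Fin 4) ℝ :=
  Matrix.of fun i j => g (L (basisVec i)) (L (basisVec j))

lemma endoMatrix_mul_self (h : ∀ v, L' (L v) = v) (h' : ∀ X, L (L' X) = X)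
    (hJ : ∀ X, J (J X) = -X) : endoMatrix L L' J * endoMatrix L L' J = -1 := by
  ext d a
  have e := map_sum_basisVec (L' ∘L J ∘L L) (L' (J (L (basisVec a))))
  have e2 : (L' ∘L J ∘L L) (L' (J (L (basisVec a)))) = - basisVec a := by
    simp [h', hJ, h]
  rw [e2] at e
  have e3 := congrArg (fun v : E4 => v d) e
  have e4 : (-1 : Matrix (Fin 4) (Fin 4) ℝ) d a = (- basisVec a : E4) d := by
    simp [basisVec, Matrix.one_apply]
  rw [e4, Matrix.mul_apply]
  refine Eq.trans ?_ e3.symm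
  simp [endoMatrix, mul_comm]

lemma endoMatrix_transpose_mul (h' : ∀ X, L (L' X) = X) (a b : Fin 4) :
    ((endoMatrix L L' J)ᵀ * formMatrix L g) a b
      = g (J (L (basisVec a))) (L (basisVec b)) := by
  conv_rhs => rw [← h' (J (L (basisVec a))), map_sum_basisVec L]
  simp [Matrix.mul_apply, endoMatrix, formMatrix]

lemma endoMatrix_orth (h' : ∀ X, L (L' X) = X) (hg : ∀ X Y, g (J X) (J Y) = g X Y) :
    (endoMatrix L L' J)ᵀ * formMatrix L g * endoMatrix L L' J = formMatrix L g := by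
  ext a b
  rw [Matrix.mul_apply]
  simp only [endoMatrix_transpose_mul h']
  have e : g (J (L (basisVec a))) (J (L (basisVec b)))
      = ∑ c, g (J (L (basisVec a))) (L (basisVec c)) * endoMatrix L L' J c b := by
    conv_lhs => rw [← h' (J (L (basisVec b))), map_sum_basisVec L (L' (J (L (basisVec b))))]
    simp [endoMatrix, mul_comm]
  rw [← e, hg, formMatrix, Matrix.of_apply]

lemma formMatrix_pos (h : ∀ v, L' (L v) = v) (hg : ∀ X, X ≠ 0 → 0 < g X X) (x : Fin 4 → ℝ)
    (hx : x ≠ 0) : 0 < x ⬝ᵥ formMatrix L g *ᵥ x := by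
  set v : E4 := WithLp.toLp 2 x with hv
  have hLv : L v ≠ 0 := fun h0 => hx <| by
    have := h v
    rw [h0, map_zero] at this
    funext i
    exact congrArg (fun w : E4 => w i) this.symm
  refine (hg _ hLv).trans_eq ?_
  rw [map_sum_basisVec L v]
  simp only [formMatrix, dotProduct, Matrix.mulVec, hv, map_sum, map_smul,
    sum_apply, smul_apply, smul_eq_mul, Matrix.of_apply,
    Finset.mul_sum]
  rw [Finset.sum_comm]
  exact Finset.sum_congr rfl fun i _ => Finset.sum_congr rfl fun j _ => by ring

end

lemma isUnit_det_of_pos {g : Matrix (Fin 4) (Fin 4) ℝ}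
    (hg : ∀ x : Fin 4 → ℝ, x ≠ 0 → 0 < x ⬝ᵥ g *ᵥ x) : IsUnit g.det := by
  rw [isUnit_iff_ne_zero]
  intro h0
  obtain ⟨x, hx, hx0⟩ := Matrix.exists_mulVec_eq_zero_iff.2 h0
  have := hg x hx
  rw [hx0, dotProduct_zero] at this
  exact lt_irrefl _ this

/-! ### From the manifold to its charts -/

section Manifold

variable {M : Type*} [TopologicalSpace M] [ChartedSpace E4 M]
  {e : OpenPartialHomeomorph M E4}

lemma contDiffOn_of_trivial {s : Set E4} {b : E4 → M} {f : E4 → ℝ}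
    (h : ContMDiffOn 𝓘(ℝ, E4) ((𝓡 4).prod 𝓘(ℝ, ℝ)) ∞
      (fun v => Bundle.TotalSpace.mk' ℝ (E := Bundle.Trivial M ℝ) (b v) (f v)) s) :
    ContDiffOn ℝ ∞ f s := by
  intro x hx
  have := h x hx
  rw [Bundle.contMDiffWithinAt_totalSpace] at this
  exact this.2.contDiffWithinAt

lemma mdifferentiable_of_mem_maximalAtlas (he : e ∈ IsManifold.maximalAtlas (𝓡 4) ∞ M) :
    e.MDifferentiable (𝓡 4) (𝓡 4) :=
  ⟨(contMDiffOn_of_mem_maximalAtlas he).mdifferentiableOn (by simp),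
    (contMDiffOn_symm_of_mem_maximalAtlas he).mdifferentiableOn (by simp)⟩

lemma mfderiv_symm_left (he : e ∈ IsManifold.maximalAtlas (𝓡 4) ∞ M) {u : E4} (hu : u ∈ e.target)
    (v : E4) : mfderiv (𝓡 4) (𝓡 4) e (e.symm u) (mfderiv (𝓡 4) (𝓡 4) e.symm u v) = v :=
  congrArg (fun A : TangentSpace (𝓡 4) u →L[ℝ] TangentSpace (𝓡 4) u => A v)
    ((mdifferentiable_of_mem_maximalAtlas he).comp_symm_deriv hu)

lemma mfderiv_symm_right (he : e ∈ IsManifold.maximalAtlas (𝓡 4) ∞ M) {u : E4}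
    (hu : u ∈ e.target) (X : TangentSpace (𝓡 4) (e.symm u)) :
    mfderiv (𝓡 4) (𝓡 4) e.symm u (mfderiv (𝓡 4) (𝓡 4) e (e.symm u) X) = X := by
  -- In finite dimension a one-sided inverse of an endomorphism is two-sided; the tangent spaces are
  -- treated as copies of `E4`.
  have key : ∀ A B : E4 →L[ℝ] E4, (∀ v, B (A v) = v) → ∀ v, A (B v) = v := fun A B h v => by
    have h1 : (B : E4 →ₗ[ℝ] E4) * (A : E4 →ₗ[ℝ] E4) = 1 := LinearMap.ext h
    exact congrArg (fun C : E4 →ₗ[ℝ] E4 => C v) (mul_eq_one_comm.1 h1)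
  exact key (mfderiv (𝓡 4) (𝓡 4) e.symm u) (mfderiv (𝓡 4) (𝓡 4) e (e.symm u))
    (mfderiv_symm_left he hu) X

variable [IsManifold (𝓡 4) ∞ M]

/-- The coordinate field is the tangent map of the inverse chart applied to a constant section. -/
lemma contMDiffOn_frame (he : e ∈ IsManifold.maximalAtlas (𝓡 4) ∞ M) (i : Fin 4) :
    ContMDiffOn 𝓘(ℝ, E4) ((𝓡 4).prod 𝓘(ℝ, E4)) ∞
      (fun v => Bundle.TotalSpace.mk' E4 (E := fun x : M => TangentSpace (𝓡 4) x)
        (e.symm v) (frame e v i)) e.target := by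
  have h1 : ContMDiffOn (𝓡 4) (𝓡 4) ∞ e.symm e.target := contMDiffOn_symm_of_mem_maximalAtlas he
  have h2 := h1.contMDiffOn_tangentMapWithin (m := ∞) (by simp) e.open_target.uniqueMDiffOn
  have h3 : ContMDiffOn 𝓘(ℝ, E4) (𝓘(ℝ, E4).prod 𝓘(ℝ, E4)) ∞
      (fun v : E4 => (Bundle.TotalSpace.mk' E4 (E := fun x : E4 => TangentSpace (𝓡 4) x)
        v (basisVec i))) e.target := by
    have := (contMDiffOn_vectorSpace_iff_contDiffOn (𝕜 := ℝ) (n := ∞) (s := e.target)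
      (V := fun v : E4 => (basisVec i : E4))).2 contDiffOn_const
    exact this
  refine (h2.comp h3 (fun v hv => hv)).congr fun v hv => ?_
  simp only [Function.comp_apply, tangentMapWithin, frame]
  rw [mfderivWithin_of_isOpen e.open_target hv]

namespace AlmostKahler

lemma contDiffOn_inner (K : AlmostKahler M) (he : e ∈ IsManifold.maximalAtlas (𝓡 4) ∞ M)
    {v w : ∀ u : E4, TangentSpace (𝓡 4) (e.symm u)}
    (hv : ContMDiffOn 𝓘(ℝ, E4) ((𝓡 4).prod 𝓘(ℝ, E4)) ∞
      (fun u => Bundle.TotalSpace.mk' E4 (E := fun x : M => TangentSpace (𝓡 4) x)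
        (e.symm u) (v u)) e.target)
    (hw : ContMDiffOn 𝓘(ℝ, E4) ((𝓡 4).prod 𝓘(ℝ, E4)) ∞
      (fun u => Bundle.TotalSpace.mk' E4 (E := fun x : M => TangentSpace (𝓡 4) x)
        (e.symm u) (w u)) e.target) :
    ContDiffOn ℝ ∞ (fun u => K.g.inner (e.symm u) (v u) (w u)) e.target := by
  refine contDiffOn_of_trivial (b := fun u => e.symm u) ?_
  apply ContMDiffOn.clm_bundle_apply₂ (F₁ := E4) (F₂ := E4)
  · exact K.g.contMDiff.comp_contMDiffOn (contMDiffOn_symm_of_mem_maximalAtlas he)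
  · exact hv
  · exact hw

lemma smooth_G (K : AlmostKahler M) (he : e ∈ IsManifold.maximalAtlas (𝓡 4) ∞ M) :
    MSmooth e.target (K.G e) := fun i j =>
  K.contDiffOn_inner he (contMDiffOn_frame he i) (contMDiffOn_frame he j)

lemma om_apply (K : AlmostKahler M) (he : e ∈ IsManifold.maximalAtlas (𝓡 4) ∞ M) {u : E4}
    (hu : u ∈ e.target) (a b : Fin 4) : om (K.G e) (K.Jc e) u a b
      = K.g.inner (e.symm u) (K.J (e.symm u) (frame e u a)) (frame e u b) :=
  endoMatrix_transpose_mul (L := mfderiv (𝓡 4) (𝓡 4) e.symm u)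
    (L' := mfderiv (𝓡 4) (𝓡 4) e (e.symm u)) (g := K.g.inner (e.symm u)) (J := K.J (e.symm u))
    (mfderiv_symm_right he hu) a b

lemma smooth_om (K : AlmostKahler M) (he : e ∈ IsManifold.maximalAtlas (𝓡 4) ∞ M) :
    MSmooth e.target (om (K.G e) (K.Jc e)) := fun a b => by
  refine ContDiffOn.congr (K.contDiffOn_inner he ?_ (contMDiffOn_frame he b))
    fun v hv => K.om_apply he hv a b
  apply ContMDiffOn.clm_bundle_apply (F₁ := E4)
  · exact K.smooth_J.comp_contMDiffOn (contMDiffOn_symm_of_mem_maximalAtlas he)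
  · exact contMDiffOn_frame he a

lemma pos_G (K : AlmostKahler M) (he : e ∈ IsManifold.maximalAtlas (𝓡 4) ∞ M) {u : E4}
    (hu : u ∈ e.target) (x : Fin 4 → ℝ) (hx : x ≠ 0) : 0 < x ⬝ᵥ K.G e u *ᵥ x :=
  formMatrix_pos (L := mfderiv (𝓡 4) (𝓡 4) e.symm u)
    (L' := mfderiv (𝓡 4) (𝓡 4) e (e.symm u)) (g := K.g.inner (e.symm u))
    (mfderiv_symm_left he hu) (fun X hX => K.g.pos _ X hX) x hx

/-- The components of an almost Kähler structure with `J`-invariant Ricci tensor. -/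
lemma isAlmostKahlerOn (K : AlmostKahler M) (hRic : K.RicciInvariant)
    (he : e ∈ IsManifold.maximalAtlas (𝓡 4) ∞ M) :
    IsAlmostKahlerOn e.target (K.G e) (K.Jc e) where
  isOpen := e.open_target
  smooth := K.smooth_G he
  symm v _ := by ext i j; exact K.g.symm _ _ _
  det v hv := isUnit_det_of_pos (K.pos_G he hv)
  pos v hv := K.pos_G he hv
  -- The components of `Ω` are scalar functions, so their smoothness follows by pairing with the
  -- frame; `J` is then recovered as the transpose of `Ω g⁻¹`.
  smoothJ := by
    have h1 := ((K.smooth_om he).mul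
      ((K.smooth_G he).inv fun v hv => isUnit_det_of_pos (K.pos_G he hv))).transpose
    refine h1.congr fun v hv => ?_
    rw [om, mul_assoc, Matrix.mul_nonsing_inv _ (isUnit_det_of_pos (K.pos_G he hv)), mul_one,
      Matrix.transpose_transpose]
  J_sq v hv := endoMatrix_mul_self (mfderiv_symm_left he hv) (mfderiv_symm_right he hv)
    (K.J_sq (e.symm v))
  orth v hv := endoMatrix_orth (g := K.g.inner (e.symm v)) (mfderiv_symm_right he hv)
    (K.orthogonal (e.symm v))
  closed v hv := K.closed e he v hv
  ricInv v hv := by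
    ext a b
    exact (twist_apply _ _ _ _ _).symm.trans (hRic e he v hv a b)

end AlmostKahler

end Manifold

end BachFormula

theorem lemma4 {M : Type*} [TopologicalSpace M] [ChartedSpace E4 M] [IsManifold (𝓡 4) ∞ M]
    (K : AlmostKahler M) (hRic : K.RicciInvariant) :
    (∀ e ∈ IsManifold.maximalAtlas (𝓡 4) ∞ M, ∀ u ∈ e.target, ∀ a b : Fin 4,
      bach (K.G e) u ![a, b]
          = -(1 / 3) * invPart (K.Jc e) (hess (K.G e) (scalarCurv (K.G e))) u ![a, b]
            + (1 / 6) * antiPart (K.Jc e) (hess (K.G e) (scalarCurv (K.G e))) u ![a, b]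
            - laplacian (K.G e) (scalarCurv (K.G e)) u / 12 * K.G e u a b
            - scalarCurv (K.G e) u / 6 * ricci0 (K.G e) u ![a, b]
            + tensorS (K.G e) (K.Jc e) u ![a, b]
        ∧ tensorS (K.G e) (K.Jc e) u ![a, b] = tensorS (K.G e) (K.Jc e) u ![b, a]
        ∧ twist (K.Jc e) (tensorS (K.G e) (K.Jc e)) u ![a, b]
            = -tensorS (K.G e) (K.Jc e) u ![a, b])
    ∧ ((∃ c : ℝ, K.ScalarCurvEq c) → K.BachFlat → K.Einstein ∨ K.ScalarCurvEq 0) := by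
  refine ⟨fun e he u hu a b => ?_, ?_⟩
  · have h := K.isAlmostKahlerOn hRic he
    refine ⟨?_, ?_, ?_⟩
    · have hm : matOf (hess (K.G e) (scalarCurv (K.G e))) u
          = hessM (K.G e) (scalarCurv (K.G e)) u := by
        ext i j; exact hess_apply _ _ _ _ _
      have hb := congrFun (congrFun (h.matOf_bach_eq hu) a) b
      simp only [matOf_apply, Matrix.add_apply, Matrix.sub_apply, Matrix.smul_apply,
        smul_eq_mul] at hb
      -- The factors `1/2` in `invPart` and `antiPart` turn `-1/3` and `1/6` into the coefficients
      -- `-1/6` and `1/12` of the matrix formula.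
      rw [hb, invPart, antiPart, twist_apply, hm, hess_apply, ricci0_apply]
      ring
    · exact congrFun (congrFun (h.tensorS_symm hu) b) a
    · rw [twist_apply, h.tensorS_anti hu]; rfl
  · rintro ⟨c, hc⟩ hB
    -- The same constant serves every chart, so the alternative is global even when `M` is not
    -- connected.
    by_cases hc0 : c = 0
    · right; rw [← hc0]; exact hc
    · left
      intro e he u hu a b
      have h := K.isAlmostKahlerOn hRic he
      exact congrFun (congrFun (h.ric0_eq_zero_of_bach_eq_zero hc0 (hc e he) hu
        (by ext i j; exact hB e he u hu i j)) a) b
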